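/- Let $n\ge 1$, let $\triangle\subset\mathbb{R}^n$ be a reflexive lattice polytope (a lattice polytope with $0$ in its interior whose dual $\{u:\langle u,x\rangle\ge -1\ \forall x\in\triangle\}$ is also a lattice polytope), and let $X$ be the associated toric Fano variety, i.e. the toric variety of the normal fan of $\triangle$, with open torus $(\mathbb{C}^*)^n$ and coordinates $z_1,\dots,z_n$. The sections of $K_X^{-k}$ are identified with Laurent polynomials via the trivialisation $z_1\partial_{z_1}\wedge\dots\wedge z_n\partial_{z_n}$ of $K_X^{-1}$ over the torus. Let $Y=\{s=0\}\in|-K_X|$ with $s=\sum_{p\in\triangle\cap\mathbb{Z}^n}b(p)z^p$ general, in the sense that $b(p)\neq 0$ for every vertex $p$ of $\triangle$. Let $\lambda(t)$ be the one-parameter subgroup of $(\mathbb{C}^*)^n$ generated by $v_\lambda=\sum_i\lambda_i z_i\,\partial/\partial z_i$, acting on sections by $\lambda(t)\cdot z^p=t^{-\langle p,\lambda\rangle}z^p$. It induces the product test configuration $X\times\mathbb{C}$ of $(X,K_X^{-1})$, with central fibre $X_0=X$, and the test configuration $\mathcal{Y}=\overline{\{(\lambda(t)y,t):y\in Y,\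 t\ne 0\}}\subset X\times\mathbb{C}$ of $Y$, with central fibre $Y_0$. (For $\lambda\in\mathbb{Z}^n$ this is literally a test configuration; for general $\lambda\in\mathbb{R}^n$ the same definitions are read with powers $t^\gamma$, $\gamma\in\Gamma$, in place of integral powers of $t$, where $\Gamma$ is any subgroup of $\mathbb{R}$ containing all $\lambda_i$.) Let $d_k,\tilde d_k$ be the dimensions of $H^0(X_0,K_X^{-k})$ and $H^0(Y_0,K_X^{-k}|_{Y_0})$, and $w_k,\tilde w_k$ the weights of the induced action of $\lambda$ on their top exterior powers. Then there are expansions, as $k\to\infty$, $$w_k=a_0k^{n+1}+a_1k^n+O(k^{n-1}),\quad d_k=b_0k^n+b_1k^{n-1}+O(k^{n-2}),$$ $$\tilde w_k=\tilde a_0k^n+O(k^{n-1}),\quad \tilde d_k=\tilde b_0k^{n-1}+O(k^{n-2}),$$ and for every $\beta\in\mathbb{R}$ the log-Futaki invariant of the pair with cone angle $2\pi\beta$ along $Y$, i.e. with boundary $(1-\beta)Y$, $$F(K_X^{-1},\beta Y)(\lambda):=\frac{2(a_1b_0-a_0b_1)}{b_0}+(1-\beta)\left(-\tilde a_0+\frac{\tilde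 b_0}{b_0}a_0\right),$$ satisfies $$F(K_X^{-1},\beta Y)(\lambda)=-\bigl(\beta\langle P_c,\lambda\rangle+(1-\beta)W(\lambda)\bigr)\,\mathrm{Vol}(\triangle),$$ where $P_c$ is the barycenter of $\triangle$, $\mathrm{Vol}(\triangle)$ its Euclidean volume, and $W(\lambda)=\max_{p\in\triangle}\langle p,\lambda\rangle$. -/

import Mathlib

open scoped Matrix Asymptotics

namespace ToricFano

noncomputable section

/-! ### Reflexive polytopes -/

/-- The real vector of an integral vector. -/
def toReal {n : ℕ} (m : Fin n → ℤ) : Fin n → ℝ := fun i => (m i : ℝ)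

/-- A lattice polytope: the convex hull of finitely many lattice points. -/
def IsLatticePolytope {n : ℕ} (P : Set (Fin n → ℝ)) : Prop :=
  ∃ S : Finset (Fin n → ℤ), P = convexHull ℝ (toReal '' (S : Set (Fin n → ℤ)))

/-- The dual polytope `{u | ⟨u, x⟩ ≥ -1 for all x ∈ P}`. -/
def polarDual {n : ℕ} (P : Set (Fin n → ℝ)) : Set (Fin n → ℝ) :=
  {u | ∀ x ∈ P, -1 ≤ u ⬝ᵥ x}

/-- A reflexive polytope: a lattice polytope with the origin in its interior whose dual is again
a lattice polytope. -/
structure IsReflexive {n : ℕ} (P : Set (Fin n → ℝ)) : Prop where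
  lattice : IsLatticePolytope P
  zero_mem : (0 : Fin n → ℝ) ∈ interior P
  dual_lattice : IsLatticePolytope (polarDual P)

/-- The vertices of `P`. They index the maximal cones of the normal fan of `P`, that is, the
maximal affine toric charts `U_v` of the toric variety `X_P`. -/
abbrev Vertex {n : ℕ} (P : Set (Fin n → ℝ)) : Type := ↥(P.extremePoints ℝ)

/-- The primitive generators of the rays of the maximal cone `σ_v` of the normal fan: the inner
normals `u` of the facets `{⟨u, x⟩ = -1}` of `P` through the vertex `v`. (For reflexive `P` the
primitive inner facet normals are the vertices of the dual polytope.) The cone `σ_v ∩ σ_w`, whose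
chart is `U_v ∩ U_w`, is generated by `rays P v ∩ rays P w`. -/
def rays {n : ℕ} (P : Set (Fin n → ℝ)) (v : Fin n → ℝ) : Set (Fin n → ℝ) :=
  {u | u ∈ (polarDual P).extremePoints ℝ ∧ u ⬝ᵥ v = -1}

/-! ### The toric variety and its anticanonical bundle

Everything lives in the coordinate ring `ℂ[ℤⁿ]` of the open torus, whose monomial
`AddMonoidAlgebra.single m 1` is `z^m`. -/

/-- The coordinate ring of the torus `(ℂ^*)ⁿ`. -/
abbrev Laurent (n : ℕ) : Type := AddMonoidAlgebra ℂ (Fin n → ℤ)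

/-- The sections of `K_X^{-k}` over the affine toric chart `U_R` of the cone with ray generators
`R`. Here `K_X^{-1} = O(∑ D_u)`, over all torus invariant prime divisors `D_u`, the Laurent
polynomial `f` standing for `f · (z₁∂₁ ∧ … ∧ zₙ∂ₙ)^k`; as `z^m` vanishes to order `⟨u, m⟩` along
`D_u`, the sections are spanned by the `z^m` with `⟨u, m⟩ ≥ -k` for `u ∈ R`. For `k = 0` this is
the coordinate ring of `U_R`. -/
def localSections {n : ℕ} (R : Set (Fin n → ℝ)) (k : ℤ) : Submodule ℂ (Laurent n) :=
  Submodule.span ℂ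
    {f | ∃ m : Fin n → ℤ, (∀ u ∈ R, -(k : ℝ) ≤ u ⬝ᵥ toReal m) ∧ f = AddMonoidAlgebra.single m 1}

/-- `s` is a global section of `K_X^{-1}`: it is regular on every chart. -/
def IsAnticanonicalSection {n : ℕ} (P : Set (Fin n → ℝ)) (s : Laurent n) : Prop :=
  ∀ v : Vertex P, s ∈ localSections (rays P v) 1

/-! ### Global sections on a closed subscheme

A closed subscheme `Z` of `X` is given by its ideals `I R` in the coordinate rings of the
charts `U_R`. -/

/-- The sections over `U_R` of the subsheaf `I_Z · K_X^{-k}`; the sections of `K_X^{-k}|_Z` over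
`Z ∩ U_R` are the quotient of `localSections R k` by it. -/
def vanishing {n : ℕ} (I : Set (Fin n → ℝ) → Submodule ℂ (Laurent n)) (k : ℤ)
    (R : Set (Fin n → ℝ)) : Submodule ℂ (Laurent n) :=
  I R * localSections R k

/-- Families of sections of `K_X^{-k}` over the charts `U_v` whose restrictions to `Z` agree on the
overlaps `U_v ∩ U_w`. -/
def compatible {n : ℕ} (P : Set (Fin n → ℝ)) (I : Set (Fin n → ℝ) → Submodule ℂ (Laurent n))
    (k : ℤ) : Submodule ℂ (Vertex P → Laurent n) :=
  Submodule.pi Set.univ (fun v : Vertex P => localSections (rays P v) k) ⊓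
    ⨅ (v : Vertex P) (w : Vertex P),
      (vanishing I k (rays P v ∩ rays P w)).comap
        ((LinearMap.proj v : (Vertex P → Laurent n) →ₗ[ℂ] Laurent n) - LinearMap.proj w)

/-- Families of local sections that vanish on `Z`. -/
def vanishingFamilies {n : ℕ} (P : Set (Fin n → ℝ))
    (I : Set (Fin n → ℝ) → Submodule ℂ (Laurent n)) (k : ℤ) :
    Submodule ℂ (Vertex P → Laurent n) :=
  Submodule.pi Set.univ (fun v : Vertex P => vanishing I k (rays P v))

/-- `H⁰(Z, K_X^{-k}|_Z)`: compatible families of local sections over the cover of `Z` by the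
charts `Z ∩ U_v`. -/
abbrev H0 {n : ℕ} (P : Set (Fin n → ℝ)) (I : Set (Fin n → ℝ) → Submodule ℂ (Laurent n))
    (k : ℤ) : Type :=
  ↥(compatible P I k) ⧸ (vanishingFamilies P I k).submoduleOf (compatible P I k)

/-! ### The one-parameter subgroup -/

/-- The diagonal automorphism `z^a ↦ exp(φ a) z^a` of a monoid algebra. -/
def twist {A : Type*} [AddCommMonoid A] (φ : A →+ ℂ) :
    AddMonoidAlgebra ℂ A →ₐ[ℂ] AddMonoidAlgebra ℂ A :=
  AddMonoidAlgebra.lift ℂ (AddMonoidAlgebra ℂ A) A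
    { toFun := fun a => AddMonoidAlgebra.single (Multiplicative.toAdd a)
        (Complex.exp (φ (Multiplicative.toAdd a)))
      map_one' := by simp [AddMonoidAlgebra.one_def]
      map_mul' := fun a b => by
        simp [AddMonoidAlgebra.single_mul_single, Complex.exp_add] }

theorem twist_single {A : Type*} [AddCommMonoid A] (φ : A →+ ℂ) (a : A) (c : ℂ) :
    twist φ (AddMonoidAlgebra.single a c) = AddMonoidAlgebra.single a (c * Complex.exp (φ a)) := by
  simp [twist, AddMonoidAlgebra.lift_single]

/-- The pairing `m ↦ ⟨m, l⟩` as a homomorphism. -/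
def pairingHom {n : ℕ} (l : Fin n → ℝ) : (Fin n → ℤ) →+ ℝ where
  toFun m := toReal m ⬝ᵥ l
  map_zero' := by simp [toReal, dotProduct]
  map_add' a b := by simp [toReal, dotProduct, add_mul, Finset.sum_add_distrib]

theorem pairingHom_apply {n : ℕ} (l : Fin n → ℝ) (m : Fin n → ℤ) :
    pairingHom l m = toReal m ⬝ᵥ l := rfl

/-- The action on sections of the element `t = exp τ` of the one-parameter group generated by
`v_l = ∑ lᵢ zᵢ ∂/∂zᵢ`, namely `t · z^m = t^{-⟨m, l⟩} z^m`. -/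
def act {n : ℕ} (l : Fin n → ℝ) (τ : ℂ) : Laurent n →ₐ[ℂ] Laurent n :=
  twist ((AddMonoidHom.mulLeft (-τ)).comp (Complex.ofRealHom.toAddMonoidHom.comp (pairingHom l)))

theorem act_single {n : ℕ} (l : Fin n → ℝ) (τ : ℂ) (m : Fin n → ℤ) (c : ℂ) :
    act l τ (AddMonoidAlgebra.single m c)
      = AddMonoidAlgebra.single m (c * Complex.exp (-τ * ((toReal m ⬝ᵥ l : ℝ) : ℂ))) := by
  simp [act, twist_single, pairingHom_apply]

theorem act_mem_localSections {n : ℕ} (l : Fin n → ℝ) (τ : ℂ) (R : Set (Fin n → ℝ)) (k : ℤ)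
    {f : Laurent n} (hf : f ∈ localSections R k) : act l τ f ∈ localSections R k := by
  have h : localSections R k ≤ (localSections R k).comap (act l τ).toLinearMap := by
    rw [localSections, Submodule.span_le]
    rintro _ ⟨m, hm, rfl⟩
    have : act l τ (AddMonoidAlgebra.single m 1)
        = Complex.exp (-τ * ((toReal m ⬝ᵥ l : ℝ) : ℂ)) • AddMonoidAlgebra.single m (1 : ℂ) := by
      simp [act_single]
    simp only [Submodule.comap_coe, Set.mem_preimage, AlgHom.toLinearMap_apply, SetLike.mem_coe]
    rw [this]
    exact Submodule.smul_mem _ _ (Submodule.subset_span ⟨m, hm, rfl⟩)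
  exact h hf

/-- The closed subscheme with ideals `I` is preserved by the one-parameter group. -/
def IsInvariant {n : ℕ} (l : Fin n → ℝ) (I : Set (Fin n → ℝ) → Submodule ℂ (Laurent n)) : Prop :=
  ∀ (τ : ℂ) (R : Set (Fin n → ℝ)), ∀ f ∈ I R, act l τ f ∈ I R

theorem act_mem_vanishing {n : ℕ} {l : Fin n → ℝ}
    {I : Set (Fin n → ℝ) → Submodule ℂ (Laurent n)} (hI : IsInvariant l I) (τ : ℂ)
    (R : Set (Fin n → ℝ)) (k : ℤ) {f : Laurent n} (hf : f ∈ vanishing I k R) :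
    act l τ f ∈ vanishing I k R := by
  have h : vanishing I k R ≤ (vanishing I k R).comap (act l τ).toLinearMap := by
    refine Submodule.mul_le.2 fun a ha b hb => ?_
    simp only [Submodule.mem_comap, AlgHom.toLinearMap_apply, map_mul]
    exact Submodule.mul_mem_mul (hI τ R a ha) (act_mem_localSections l τ R k hb)
  exact h hf

/-- The action on families of local sections. -/
def actFamily {n : ℕ} (P : Set (Fin n → ℝ)) (l : Fin n → ℝ) (τ : ℂ) :
    (Vertex P → Laurent n) →ₗ[ℂ] (Vertex P → Laurent n) :=
  LinearMap.pi fun v => (act l τ).toLinearMap ∘ₗ LinearMap.proj v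

theorem actFamily_mem_compatible {n : ℕ} (P : Set (Fin n → ℝ)) {l : Fin n → ℝ}
    {I : Set (Fin n → ℝ) → Submodule ℂ (Laurent n)} (hI : IsInvariant l I) (k : ℤ) (τ : ℂ) :
    ∀ f ∈ compatible P I k, actFamily P l τ f ∈ compatible P I k := by
  intro f hf
  simp only [compatible, Submodule.mem_inf, Submodule.mem_pi, Set.mem_univ, forall_const,
    Submodule.mem_iInf, Submodule.mem_comap, LinearMap.sub_apply, LinearMap.proj_apply] at hf ⊢
  refine ⟨fun v => act_mem_localSections l τ _ k (hf.1 v), fun v w => ?_⟩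
  have := act_mem_vanishing hI τ _ k (hf.2 v w)
  rwa [map_sub] at this

/-- The action of `t = exp τ` on `H⁰(Z, K_X^{-k}|_Z)` for an invariant closed subscheme `Z`. -/
def actH0 {n : ℕ} (P : Set (Fin n → ℝ)) {l : Fin n → ℝ}
    {I : Set (Fin n → ℝ) → Submodule ℂ (Laurent n)} (hI : IsInvariant l I) (k : ℤ) (τ : ℂ) :
    H0 P I k →ₗ[ℂ] H0 P I k :=
  Submodule.mapQ _ _ ((actFamily P l τ).restrict (actFamily_mem_compatible P hI k τ)) (by
    intro f hf
    simp only [Submodule.submoduleOf, Submodule.mem_comap, Submodule.subtype_apply,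
      LinearMap.coe_restrict_apply, vanishingFamilies, Submodule.mem_pi, Set.mem_univ,
      forall_const] at hf ⊢
    exact fun v => act_mem_vanishing hI τ _ k (hf v))

/-- `w` is the weight of the action on `H⁰(Z, K_X^{-k}|_Z)`: this space is finite-dimensional and
`t = exp τ` acts on its top exterior power, i.e. with determinant, `t^w`. -/
def IsWeight {n : ℕ} (P : Set (Fin n → ℝ)) {l : Fin n → ℝ}
    {I : Set (Fin n → ℝ) → Submodule ℂ (Laurent n)} (hI : IsInvariant l I) (k : ℤ) (w : ℝ) :
    Prop :=
  Module.Finite ℂ (H0 P I k) ∧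
    ∀ τ : ℂ, LinearMap.det (actH0 P hI k τ) = Complex.exp (τ * (w : ℂ))

/-! ### The test configuration

The one-parameter subgroup induces the product configuration `X × ℂ` of `X`, with central fibre `X`,
and the configuration of `Y = {s = 0}` whose total space is the closure in `X × ℂ` of
`{(λ(t) y, t) | y ∈ Y, t ≠ 0}`. Exponents of `t` are taken in a subgroup `Γ` of `ℝ` containing
the `lᵢ`: the base is the spectrum of the monoid algebra of `{γ ∈ Γ | γ ≥ 0}`, its open part
`t ≠ 0` the spectrum of the group algebra of `Γ`. For `Γ = ℤ`, so integral `l`, the base is the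
affine line; larger `Γ` are needed only to speak of real `l`. -/

/-- Laurent polynomials in `z` and in real powers of `t`; `single (m, γ) 1` is `z^m t^γ`. -/
abbrev LaurentT (n : ℕ) : Type := AddMonoidAlgebra ℂ ((Fin n → ℤ) × ℝ)

/-- Sections of the pullback of `K_X^{-k}` over the product of `U_R` and the base, with the exponents
of `t` in `T`. -/
def familySections {n : ℕ} (R : Set (Fin n → ℝ)) (k : ℤ) (T : Set ℝ) :
    Submodule ℂ (LaurentT n) :=
  Submodule.span ℂ
    {f | ∃ (m : Fin n → ℤ) (γ : ℝ), (∀ u ∈ R, -(k : ℝ) ≤ u ⬝ᵥ toReal m) ∧ γ ∈ T ∧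
      f = AddMonoidAlgebra.single (m, γ) 1}

/-- `λ(t) · s = ∑ b(p) t^{-⟨p, l⟩} z^p` for `s = ∑ b(p) z^p`, the equation of `λ(t) Y`. -/
def moved {n : ℕ} (l : Fin n → ℝ) (s : Laurent n) : LaurentT n :=
  AddMonoidAlgebra.mapDomain (fun m => (m, -(toReal m ⬝ᵥ l))) s

/-- The ideal of the total space `𝒴` over the chart `U_R`: the regular functions on the product of
`U_R` and the base that over `t ≠ 0` lie in the ideal `(λ(t) · s) · K_X` of the divisor
of `λ(t) · s`. -/
def totalIdeal {n : ℕ} (Γ : AddSubgroup ℝ) (l : Fin n → ℝ) (s : Laurent n)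
    (R : Set (Fin n → ℝ)) : Submodule ℂ (LaurentT n) :=
  familySections R 0 {γ | γ ∈ Γ ∧ 0 ≤ γ} ⊓
    (familySections R (-1) (Γ : Set ℝ)).map (LinearMap.mulLeft ℂ (moved l s))

/-- The coefficient of `t^0`; on functions without negative powers of `t` this is restriction to
`t = 0`. -/
def atZero (n : ℕ) : LaurentT n →ₗ[ℂ] Laurent n where
  toFun f := .ofCoeff (f.coeff.comapDomain (fun m => (m, (0 : ℝ)))
    (Prod.mk_left_injective (0 : ℝ)).injOn)
  map_add' f g := by ext; simp
  map_smul' c f := by ext; simp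

theorem atZero_single_zero {n : ℕ} (m : Fin n → ℤ) (c : ℂ) :
    atZero n (AddMonoidAlgebra.single (m, 0) c) = AddMonoidAlgebra.single m c := by
  classical
  ext m'
  simp [atZero, Finsupp.single_apply]

theorem atZero_single_of_ne {n : ℕ} {m : Fin n → ℤ} {γ : ℝ} (hγ : γ ≠ 0) (c : ℂ) :
    atZero n (AddMonoidAlgebra.single (m, γ) c) = 0 := by
  classical
  ext m'
  simp [atZero, hγ]

/-- The ideals of the central fibre `Y₀` of the configuration of `Y`. -/
def centralIdeal {n : ℕ} (Γ : AddSubgroup ℝ) (l : Fin n → ℝ) (s : Laurent n)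
    (R : Set (Fin n → ℝ)) : Submodule ℂ (Laurent n) :=
  (totalIdeal Γ l s R).map (atZero n)

/-- The ideals of `X` itself. -/
def zeroIdeal (n : ℕ) (_R : Set (Fin n → ℝ)) : Submodule ℂ (Laurent n) := ⊥

theorem zeroIdeal_invariant {n : ℕ} (l : Fin n → ℝ) : IsInvariant l (zeroIdeal n) := by
  intro τ R f hf
  rw [zeroIdeal, Submodule.mem_bot] at hf ⊢
  rw [hf, map_zero]

/-- The action on the family, `t` being scaled along with `z`. -/
def actT {n : ℕ} (l : Fin n → ℝ) (τ : ℂ) : LaurentT n →ₐ[ℂ] LaurentT n :=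
  twist ((AddMonoidHom.mulLeft (-τ)).comp (Complex.ofRealHom.toAddMonoidHom.comp
    ((pairingHom l).comp (AddMonoidHom.fst _ _) + AddMonoidHom.snd _ _)))

theorem actT_single {n : ℕ} (l : Fin n → ℝ) (τ : ℂ) (m : Fin n → ℤ) (γ : ℝ) (c : ℂ) :
    actT l τ (AddMonoidAlgebra.single (m, γ) c) = AddMonoidAlgebra.single (m, γ)
      (c * Complex.exp (-τ * ((toReal m ⬝ᵥ l + γ : ℝ) : ℂ))) := by
  simp [actT, twist_single, pairingHom_apply]

theorem actT_mem_familySections {n : ℕ} (l : Fin n → ℝ) (τ : ℂ) (R : Set (Fin n → ℝ)) (k : ℤ)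
    (T : Set ℝ) {f : LaurentT n} (hf : f ∈ familySections R k T) :
    actT l τ f ∈ familySections R k T := by
  have h : familySections R k T ≤ (familySections R k T).comap (actT l τ).toLinearMap := by
    rw [familySections, Submodule.span_le]
    rintro _ ⟨m, γ, hm, hγ, rfl⟩
    have : actT l τ (AddMonoidAlgebra.single (m, γ) 1)
        = Complex.exp (-τ * ((toReal m ⬝ᵥ l + γ : ℝ) : ℂ)) •
          AddMonoidAlgebra.single (m, γ) (1 : ℂ) := by
      rw [actT_single]; simp
    simp only [Submodule.comap_coe, Set.mem_preimage, AlgHom.toLinearMap_apply, SetLike.mem_coe]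
    rw [this]
    exact Submodule.smul_mem _ _ (Submodule.subset_span ⟨m, γ, hm, hγ, rfl⟩)
  exact h hf

theorem actT_moved {n : ℕ} (l : Fin n → ℝ) (τ : ℂ) (s : Laurent n) :
    actT l τ (moved l s) = moved l s := by
  induction s using AddMonoidAlgebra.induction_linear with
  | zero => simp [moved]
  | add f g hf hg =>
    rw [moved, AddMonoidAlgebra.mapDomain_add, map_add]
    exact congrArg₂ (· + ·) hf hg
  | single m c =>
    rw [moved, AddMonoidAlgebra.mapDomain_single, actT_single]
    simp

theorem atZero_actT {n : ℕ} (l : Fin n → ℝ) (τ : ℂ) (f : LaurentT n) :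
    atZero n (actT l τ f) = act l τ (atZero n f) := by
  induction f using AddMonoidAlgebra.induction_linear with
  | zero => simp
  | add f g hf hg => simp only [map_add, hf, hg]
  | single a c =>
    obtain ⟨m, γ⟩ := a
    rw [actT_single]
    by_cases hγ : γ = 0
    · subst hγ
      rw [atZero_single_zero, atZero_single_zero, act_single, add_zero]
    · rw [atZero_single_of_ne hγ, atZero_single_of_ne hγ, map_zero]

theorem centralIdeal_invariant {n : ℕ} (Γ : AddSubgroup ℝ) (l : Fin n → ℝ) (s : Laurent n) :
    IsInvariant l (centralIdeal Γ l s) := by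
  rintro τ R _ ⟨F, ⟨hF, g, hg, hgF⟩, rfl⟩
  refine ⟨actT l τ F, ⟨actT_mem_familySections l τ R 0 _ hF, actT l τ g,
    actT_mem_familySections l τ R (-1) _ hg, ?_⟩, atZero_actT l τ F⟩
  rw [← hgF, LinearMap.mulLeft_apply, LinearMap.mulLeft_apply, map_mul, actT_moved]

/-! ### The log-Futaki invariant -/

/-- `F` is the log-Futaki invariant of the configuration induced by `v_l` for the pair of
`(X, K_X^{-1})` and the boundary `(1 - β) Y`, `Y = {s = 0}`. With `d_k`, `w_k` the dimension and
weight of `H⁰(X₀, K_X^{-k})`, `X₀ = X`, and `d'_k`, `w'_k` those of `H⁰(Y₀, K_X^{-k}|_{Y₀})`, there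
are expansions as displayed, and `F = 2 (a₁ b₀ - a₀ b₁) / b₀ + (1 - β) (-a'₀ + (b'₀ / b₀) a₀)`. -/
def IsLogFutaki {n : ℕ} (P : Set (Fin n → ℝ)) (Γ : AddSubgroup ℝ) (l : Fin n → ℝ)
    (s : Laurent n) (β F : ℝ) : Prop :=
  ∃ (w w' : ℕ → ℝ) (a₀ a₁ b₀ b₁ a'₀ b'₀ : ℝ),
    (∀ᶠ k : ℕ in Filter.atTop, IsWeight P (zeroIdeal_invariant l) k (w k)) ∧
    (∀ᶠ k : ℕ in Filter.atTop, IsWeight P (centralIdeal_invariant Γ l s) k (w' k)) ∧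
    (fun k : ℕ => w k - (a₀ * (k : ℝ) ^ (n + 1) + a₁ * (k : ℝ) ^ n))
      =O[Filter.atTop] (fun k : ℕ => (k : ℝ) ^ ((n : ℤ) - 1)) ∧
    (fun k : ℕ => (Module.finrank ℂ (H0 P (zeroIdeal n) k) : ℝ)
        - (b₀ * (k : ℝ) ^ n + b₁ * (k : ℝ) ^ ((n : ℤ) - 1)))
      =O[Filter.atTop] (fun k : ℕ => (k : ℝ) ^ ((n : ℤ) - 2)) ∧
    (fun k : ℕ => w' k - a'₀ * (k : ℝ) ^ n)
      =O[Filter.atTop] (fun k : ℕ => (k : ℝ) ^ ((n : ℤ) - 1)) ∧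
    (fun k : ℕ => (Module.finrank ℂ (H0 P (centralIdeal Γ l s) k) : ℝ)
        - b'₀ * (k : ℝ) ^ ((n : ℤ) - 1))
      =O[Filter.atTop] (fun k : ℕ => (k : ℝ) ^ ((n : ℤ) - 2)) ∧
    F = 2 * (a₁ * b₀ - a₀ * b₁) / b₀ + (1 - β) * (-a'₀ + b'₀ / b₀ * a₀)

/-! ### The polytope side -/

/-- The Euclidean volume of `P`. -/
def vol {n : ℕ} (P : Set (Fin n → ℝ)) : ℝ := MeasureTheory.volume.real P

/-- The barycenter of `P`, the mean of `x` over `P`. -/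
def barycenter {n : ℕ} (P : Set (Fin n → ℝ)) : Fin n → ℝ := ⨍ x in P, x

/-- `W(l) = max_{p ∈ P} ⟨p, l⟩`. -/
def supportValue {n : ℕ} (P : Set (Fin n → ℝ)) (l : Fin n → ℝ) : ℝ :=
  sSup ((fun p => p ⬝ᵥ l) '' P)

end

end ToricFano

/-! Write V for the volume of `P`, A for the integral of ⟨x, l⟩ over `P` (so A = ⟨P_c, l⟩ V) and W
for the maximum of ⟨·, l⟩ on `P`. The sections of K_X^{-k} have the lattice points of kP as a
monomial basis, so d_k counts these points and w_k is minus the sum of ⟨m, l⟩ over them.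

The central fibre Y₀ is the divisor of the initial form s₀ of s, the part of s supported where ⟨p,
l⟩ = W (`centralIdeal_eq`). It is nonzero because W is attained at a vertex and s does not vanish
there. Multiplication by s₀ and restriction give 0 → H⁰(K_X^{-(k-1)}) → H⁰(K_X^{-k}) → H⁰(Y₀,
K_X^{-k}) → 0 for k ≥ 1. Surjectivity is the vanishing of H¹(K_X^{-(k-1)})
(`IsReflexive.exists_splitting`), which reduces for each monomial to the connectedness of a convex
set of linear forms covered by the cones of the normal fan (`IsReflexive.eq_of_visible`). As s₀ has
weight -W, the dimension on Y₀ is d_k - d_{k-1} and the weight is w_k - w_{k-1} + W d_{k-1}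
(`IsReflexive.isWeight_of_divisor`).

It remains to find two coefficients of the sums over kP. They are eventually polynomial in k, by a
Hilbert–Serre induction on the lattice points of the cone over `P` (`levelSum_eventuallyPoly`), and
their leading coefficients are integrals over `P`. For the second coefficient, reflexivity makes the
gauge g of `P` integral on lattice points, so the sum over j < k of the sums of f over jP equals the
sum over all m of f(m) max(0, k - g(m)). The summand is now continuous up to the boundary: after
rescaling this is a Riemann sum of a compactly supported Lipschitz function, whose error is o(1/k)
by Rademacher's theorem and a symmetrisation (`tendsto_riemannSum`). Hence the polynomial of partial
sums has no second term, and its difference starts with A_d (k^d + (d/2) k^{d-1})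
(`EventuallyPoly.expansion`).

So d_k = V k^n + (n/2) V k^{n-1} + …, and w_k = -A k^{n+1} - ((n+1)/2) A k^n + …. The Futaki term is
-A, the boundary term is (1-β)(A - W V), and their sum is the formula. Uniqueness of the
coefficients of an asymptotic expansion gives the converse half of the equivalence. -/

namespace ToricFano

open Filter Polynomial

/-! ### Eventually polynomial functions -/

/-- `F` agrees with a real polynomial for all large arguments. -/
def EventuallyPoly (F : ℕ → ℝ) : Prop :=
  ∃ p : ℝ[X], ∀ᶠ k : ℕ in atTop, F k = p.eval (k : ℝ)

theorem EventuallyPoly.add {F G : ℕ → ℝ} (hF : EventuallyPoly F) (hG : EventuallyPoly G) :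
    EventuallyPoly (fun k => F k + G k) := by
  obtain ⟨p, hp⟩ := hF
  obtain ⟨q, hq⟩ := hG
  refine ⟨p + q, ?_⟩
  filter_upwards [hp, hq] with k h1 h2
  rw [h1, h2, eval_add]

theorem EventuallyPoly.sub {F G : ℕ → ℝ} (hF : EventuallyPoly F) (hG : EventuallyPoly G) :
    EventuallyPoly (fun k => F k - G k) := by
  obtain ⟨p, hp⟩ := hF
  obtain ⟨q, hq⟩ := hG
  refine ⟨p - q, ?_⟩
  filter_upwards [hp, hq] with k h1 h2
  rw [h1, h2, eval_sub]

theorem EventuallyPoly.comp_succ {F : ℕ → ℝ} (hF : EventuallyPoly F) :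
    EventuallyPoly (fun k => F (k + 1)) := by
  obtain ⟨p, hp⟩ := hF
  refine ⟨p.comp (X + 1), ?_⟩
  filter_upwards [(tendsto_add_atTop_nat 1).eventually hp] with k h1
  rw [h1]
  simp

/-- Every real polynomial is the difference of a polynomial. -/
theorem exists_antidifference (p : ℝ[X]) :
    ∃ q : ℝ[X], ∀ x : ℝ, q.eval (x + 1) - q.eval x = p.eval x := by
  induction p using Polynomial.induction_on' with
  | add p q hp hq =>
    obtain ⟨p', hp'⟩ := hp
    obtain ⟨q', hq'⟩ := hq
    refine ⟨p' + q', fun x => ?_⟩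
    rw [eval_add, eval_add, eval_add, ← hp', ← hq']
    ring
  | monomial e a =>
    -- Bernoulli polynomials satisfy B_{e+1}(x + 1) - B_{e+1}(x) = (e + 1) x^e.
    refine ⟨C (a / (e + 1)) * (Polynomial.bernoulli (e + 1)).map (algebraMap ℚ ℝ), fun x => ?_⟩
    have h := congrArg (fun r : ℚ[X] => (r.map (algebraMap ℚ ℝ)).eval x)
      (bernoulli_comp_one_add_X (e + 1))
    simp only [Polynomial.map_comp, eval_comp, Polynomial.map_add, Polynomial.map_one,
      Polynomial.map_X, eval_add, eval_one, eval_X,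
      Polynomial.map_pow, eval_pow, nsmul_eq_mul, Polynomial.map_mul, eval_mul,
      Polynomial.map_natCast, eval_natCast] at h
    rw [eval_mul, eval_mul, eval_C, add_comm x 1, h, eval_monomial]
    have : ((e : ℝ) + 1) ≠ 0 := by positivity
    generalize eval x _ = B
    push_cast
    rw [eval_C, ← mul_sub, add_sub_cancel_left]
    field_simp

/-- Past the point N where the difference is polynomial, F and an antidifference have the same
increments, hence differ by the constant fixed at N. -/
theorem EventuallyPoly.of_difference {F : ℕ → ℝ}
    (h : EventuallyPoly (fun k => F (k + 1) - F k)) : EventuallyPoly F := by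
  obtain ⟨p, hp⟩ := h
  obtain ⟨q, hq⟩ := exists_antidifference p
  obtain ⟨N, hN⟩ := eventually_atTop.1 hp
  refine ⟨q + C (F N - q.eval (N : ℝ)), eventually_atTop.2 ⟨N, fun k hk => ?_⟩⟩
  induction k, hk using Nat.le_induction with
  | base => simp
  | succ k hk ih =>
    have h1 := hN k hk
    have h2 := hq k
    simp only [eval_add, eval_C] at ih ⊢
    push_cast
    linarith

/-! ### Counting in graded sets

For a set `D` in a graded abelian group that is a finitely generated module, in a combinatorial
sense, over the monoid spanned by finitely many elements `v` of degree one, the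
number of elements of degree `k` of `D` is eventually polynomial in `k`. -/

section Graded

variable {M : Type*} [AddCommGroup M]

/-- `D` is convex and well-quasi-ordered for the preorder given by the monoid spanned by `S`. -/
structure IsNoetherianSet (S D : Set M) : Prop where
  convex : ∀ a ∈ D, ∀ x ∈ AddSubmonoid.closure S, ∀ y ∈ AddSubmonoid.closure S,
    a + x + y ∈ D → a + x ∈ D
  wqo : D.PartiallyWellOrderedOn (fun a b => b - a ∈ AddSubmonoid.closure S)

theorem mem_closure_insert {S : Set M} {v x : M} :
    x ∈ AddSubmonoid.closure (insert v S) ↔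
      ∃ (c : ℕ), ∃ y ∈ AddSubmonoid.closure S, x = c • v + y := by
  rw [Set.insert_eq, AddSubmonoid.closure_union, AddSubmonoid.mem_sup]
  constructor
  · rintro ⟨a, ha, y, hy, rfl⟩
    obtain ⟨c, rfl⟩ := AddSubmonoid.mem_closure_singleton.1 ha
    exact ⟨c, y, hy, rfl⟩
  · rintro ⟨c, y, hy, rfl⟩
    exact ⟨c • v, AddSubmonoid.mem_closure_singleton.2 ⟨c, rfl⟩, y, hy, rfl⟩

/-- No two elements of `E` differ by v plus an element of the larger monoid, so a comparison in `E`
cannot use the generator v and already holds over `S`. -/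
theorem IsNoetherianSet.of_subset {S D E : Set M} {v : M} (hD : IsNoetherianSet (insert v S) D)
    (hE : E ⊆ D)
    (hconv : ∀ a ∈ E, ∀ x ∈ AddSubmonoid.closure S, ∀ y ∈ AddSubmonoid.closure S,
      a + x + y ∈ E → a + x ∈ E)
    (hv : ∀ a ∈ E, ∀ x ∈ AddSubmonoid.closure (insert v S), a + v + x ∉ E) :
    IsNoetherianSet S E := by
  refine ⟨hconv, ?_⟩
  rw [Set.partiallyWellOrderedOn_iff_exists_lt]
  intro f hf
  obtain ⟨i, j, hij, h⟩ := hD.wqo.exists_lt (fun i => hE (hf i))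
  obtain ⟨c, y, hy, hc⟩ := mem_closure_insert.1 h
  refine ⟨i, j, hij, ?_⟩
  rcases c with _ | c
  · simpa [hc] using hy
  · exfalso
    refine hv _ (hf i) (c • v + y) (mem_closure_insert.2 ⟨c, y, hy, rfl⟩) ?_
    have : f i + v + (c • v + y) = f j := by
      rw [← sub_add_cancel (f j) (f i), hc, succ_nsmul]; abel
    rw [this]
    exact hf j

/-- Combinatorial form of the kernel of multiplication by v. Convexity ensures that an element
pushed out of `D` by v never returns, so this set needs only the remaining generators. -/
theorem IsNoetherianSet.kernel {S D : Set M} {v : M} (hD : IsNoetherianSet (insert v S) D) :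
    IsNoetherianSet S {a ∈ D | a + v ∉ D} := by
  have hv : v ∈ AddSubmonoid.closure (insert v S) :=
    AddSubmonoid.subset_closure (Set.mem_insert _ _)
  have hmono := AddSubmonoid.closure_mono (Set.subset_insert v S)
  refine hD.of_subset (fun a h => h.1) ?_ ?_
  · rintro a ⟨ha, hav⟩ x hx y hy ⟨h, -⟩
    refine ⟨hD.convex a ha x (hmono hx) y (hmono hy) h, fun h' => hav ?_⟩
    refine hD.convex a ha v hv x (hmono hx) ?_
    rwa [add_right_comm]
  · rintro a ⟨ha, hav⟩ x hx ⟨h, -⟩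
    exact hav (hD.convex a ha v hv x hx h)

/-- Combinatorial form of the cokernel of multiplication by v: by convexity a + v + x in `D` forces
a + x in `D`, so a + v + x is a multiple of v and is not in this set. -/
theorem IsNoetherianSet.cokernel {S D : Set M} {v : M} (hD : IsNoetherianSet (insert v S) D) :
    IsNoetherianSet S {a ∈ D | a - v ∉ D} := by
  have hv : v ∈ AddSubmonoid.closure (insert v S) :=
    AddSubmonoid.subset_closure (Set.mem_insert _ _)
  have hmono := AddSubmonoid.closure_mono (Set.subset_insert v S)
  refine hD.of_subset (fun a h => h.1) ?_ ?_
  · rintro a ⟨ha, hav⟩ x hx y hy ⟨h, hc⟩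
    refine ⟨hD.convex a ha x (hmono hx) y (hmono hy) h, fun h' => hc ?_⟩
    have := hD.convex (a + x - v) h' y (hmono hy) v hv (by convert h using 1; abel)
    convert this using 1
    abel
  · rintro a ⟨ha, hav⟩ x hx ⟨h, hc⟩
    refine hc ?_
    have := hD.convex a ha x hx v hv (by convert h using 1; abel)
    convert this using 1
    abel

variable (deg : M →+ ℤ)

theorem degree_nonneg {S : Set M} (hS : ∀ v ∈ S, deg v = 1) {x : M}
    (hx : x ∈ AddSubmonoid.closure S) : 0 ≤ deg x ∧ (deg x = 0 → x = 0) := by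
  induction hx using AddSubmonoid.closure_induction with
  | mem x h => simp [hS x h]
  | zero => simp
  | add x y _ _ hx hy =>
    rw [map_add]
    refine ⟨add_nonneg hx.1 hy.1, fun h => ?_⟩
    rw [hx.2 (by linarith [hx.1, hy.1]), hy.2 (by linarith [hx.1, hy.1]), add_zero]

/-- In an infinite level the well-quasi-order would give two distinct comparable elements of equal
degree, but the only monoid element of degree 0 is 0. -/
theorem IsNoetherianSet.finite_level {S D : Set M} (hS : ∀ v ∈ S, deg v = 1)
    (hD : IsNoetherianSet S D) (k : ℤ) : {a ∈ D | deg a = k}.Finite := by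
  by_contra hinf
  have hinf : {a ∈ D | deg a = k}.Infinite := hinf
  let f := hinf.natEmbedding
  obtain ⟨i, j, hij, h⟩ := hD.wqo.exists_lt (f := fun i => (f i : M)) (fun i => (f i).2.1)
  have h1 : deg ((f j : M) - f i) = 0 := by
    rw [map_sub, (f j).2.2, (f i).2.2, sub_self]
  have h2 := sub_eq_zero.1 ((degree_nonneg deg hS h).2 h1)
  exact hij.ne (f.injective (Subtype.ext h2)).symm

/-- The sum of the affine function `c + f` over the elements of degree `k` of `D`. -/
noncomputable def levelSum (f : M →+ ℝ) (c : ℝ) (D : Set M) (k : ℕ) : ℝ :=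
  ∑ᶠ a ∈ {a ∈ D | deg a = k}, (c + f a)

/-- Translation by v is a bijection from the degree k elements outside the kernel to the degree k +
1 elements outside the cokernel. It raises the summand by f v, which produces the middle term, a
multiple of the count of `D` itself. -/
theorem levelSum_succ {S D : Set M} {v : M} (hS : ∀ w ∈ insert v S, deg w = 1)
    (hD : IsNoetherianSet (insert v S) D) (f : M →+ ℝ) (c : ℝ) (k : ℕ) :
    levelSum deg f c D (k + 1) - levelSum deg f c D k
      = levelSum deg f c {a ∈ D | a - v ∉ D} (k + 1) + levelSum deg 0 (f v) D k
        - levelSum deg f (c + f v) {a ∈ D | a + v ∉ D} k := by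
  have hfin := hD.finite_level deg hS
  have hv : deg v = 1 := hS v (Set.mem_insert _ _)
  have h1 : levelSum deg f c D (k + 1) = levelSum deg f c {a ∈ D | a - v ∉ D} (k + 1)
      + ∑ᶠ a ∈ {a ∈ D | deg a = k} \ {a ∈ {a ∈ D | a + v ∉ D} | deg a = k},
        (c + f v + f a) := by
    have himg : ∑ᶠ a ∈ {a ∈ D | deg a = k} \ {a ∈ {a ∈ D | a + v ∉ D} | deg a = k},
        (c + f v + f a) = ∑ᶠ a ∈ (fun a => a + v) ''
          ({a ∈ D | deg a = k} \ {a ∈ {a ∈ D | a + v ∉ D} | deg a = k}), (c + f a) := by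
      rw [finsum_mem_image (add_left_injective v).injOn]
      refine finsum_mem_congr rfl fun a _ => ?_
      rw [map_add]; ring
    rw [himg, levelSum, levelSum, ← finsum_mem_union]
    · refine finsum_mem_congr ?_ fun _ _ => rfl
      ext a
      simp only [Set.mem_ofPred_eq, Set.mem_union, Set.mem_image, Set.mem_sdiff]
      push_cast
      constructor
      · rintro ⟨ha, hk⟩
        by_cases hav : a - v ∈ D
        · refine Or.inr ⟨a - v, ⟨⟨hav, by rw [map_sub, hv, hk]; ring⟩, ?_⟩, by abel⟩
          rintro ⟨⟨-, h⟩, -⟩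
          exact h (by simpa using ha)
        · exact Or.inl ⟨⟨ha, hav⟩, hk⟩
      · rintro (⟨⟨ha, -⟩, hk⟩ | ⟨b, ⟨⟨hb, hk⟩, h⟩, rfl⟩)
        · exact ⟨ha, hk⟩
        · refine ⟨?_, by rw [map_add, hv, hk]⟩
          by_contra h'
          exact h ⟨⟨hb, h'⟩, hk⟩
    · rw [Set.disjoint_left]
      rintro _ ⟨⟨ha, hav⟩, -⟩ ⟨b, ⟨⟨hb, -⟩, -⟩, rfl⟩
      exact hav (by simpa using hb)
    · exact (hfin _).subset fun a h => ⟨h.1.1, h.2⟩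
    · exact ((hfin k).subset Set.sdiff_subset).image _
  have h2 : levelSum deg f (c + f v) {a ∈ D | a + v ∉ D} k
      + ∑ᶠ a ∈ {a ∈ D | deg a = k} \ {a ∈ {a ∈ D | a + v ∉ D} | deg a = k}, (c + f v + f a)
      = ∑ᶠ a ∈ {a ∈ D | deg a = k}, (c + f v + f a) :=
    finsum_mem_add_sdiff (fun a h => ⟨h.1.1, h.2⟩) (hfin k)
  have h3 : ∑ᶠ a ∈ {a ∈ D | deg a = k}, (c + f v + f a)
      = levelSum deg f c D k + levelSum deg 0 (f v) D k := by
    rw [levelSum, levelSum, ← finsum_mem_add_distrib (hfin k)]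
    refine finsum_mem_congr rfl fun a _ => ?_
    simp only [AddMonoidHom.zero_apply]
    ring
  linarith

theorem levelSum_eventuallyPoly_of_empty {D : Set M} (hD : IsNoetherianSet ∅ D) (f : M →+ ℝ)
    (c : ℝ) : EventuallyPoly (levelSum deg f c D) := by
  have hfin : D.Finite := by
    by_contra hinf
    have hinf : D.Infinite := hinf
    let g := hinf.natEmbedding
    obtain ⟨i, j, hij, h⟩ := hD.wqo.exists_lt (f := fun i => (g i : M)) (fun i => (g i).2)
    rw [AddSubmonoid.closure_empty, AddSubmonoid.mem_bot, sub_eq_zero] at h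
    exact hij.ne (g.injective (Subtype.ext h)).symm
  obtain ⟨N, hN⟩ := (hfin.image deg).bddAbove
  refine ⟨0, eventually_atTop.2 ⟨N.toNat + 1, fun k hk => ?_⟩⟩
  have : {a ∈ D | deg a = k} = ∅ := by
    ext a
    simp only [Set.mem_ofPred_eq, Set.mem_empty_iff_false, iff_false, not_and]
    intro ha h
    have := hN ⟨a, ha, rfl⟩
    omega
  rw [levelSum, this, finsum_mem_empty, eval_zero]

/-- Hilbert–Serre: induct on the generators, since the difference of the level sum involves only
kernel and cokernel, which need one generator fewer, and a multiple of a count. -/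
theorem levelSum_eventuallyPoly {S : Set M} (hfin : S.Finite) (hS : ∀ v ∈ S, deg v = 1)
    {D : Set M} (hD : IsNoetherianSet S D) (f : M →+ ℝ) (c : ℝ) :
    EventuallyPoly (levelSum deg f c D) := by
  -- Constant summands come first: for general f the count of `D` enters over the full set of
  -- generators, so the induction hypothesis does not cover it.
  have hcount : ∀ (S : Set M), S.Finite → (∀ v ∈ S, deg v = 1) → ∀ D : Set M,
      IsNoetherianSet S D → ∀ c : ℝ, EventuallyPoly (levelSum deg 0 c D) := by
    intro S hfin
    induction S, hfin using Set.Finite.induction_on with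
    | empty => exact fun _ D hD c => levelSum_eventuallyPoly_of_empty deg hD 0 c
    | @insert v S _ _ ih =>
      intro hS D hD c
      have hS' : ∀ w ∈ S, deg w = 1 := fun w hw => hS w (Set.mem_insert_of_mem _ hw)
      refine EventuallyPoly.of_difference ?_
      have h := (ih hS' _ hD.cokernel c).comp_succ.sub (ih hS' _ hD.kernel c)
      convert h using 2 with k
      rw [levelSum_succ deg hS hD]
      simp [levelSum]
  induction S, hfin using Set.Finite.induction_on generalizing D c with
  | empty => exact levelSum_eventuallyPoly_of_empty deg hD f c
  | @insert v S _ hSfin ih =>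
    have hS' : ∀ w ∈ S, deg w = 1 := fun w hw => hS w (Set.mem_insert_of_mem _ hw)
    refine EventuallyPoly.of_difference ?_
    have h := ((ih hS' hD.cokernel c).comp_succ.add
      (hcount _ (hSfin.insert v) hS D hD (f v))).sub (ih hS' hD.kernel (c + f v))
    convert h using 2 with k
    rw [levelSum_succ deg hS hD]

end Graded

end ToricFano

namespace ToricFano

open Filter MeasureTheory Topology

/-! ### Riemann sums of Lipschitz functions -/

theorem round_eq_iff_mem_Ico (x : ℝ) (m : ℤ) :
    round x = m ↔ x ∈ Set.Ico ((m : ℝ) - 1 / 2) (m + 1 / 2) := by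
  rw [round_eq, Int.floor_eq_iff, Set.mem_Ico]
  constructor <;> rintro ⟨h1, h2⟩ <;> constructor <;> linarith

theorem measurable_round_real : Measurable (round : ℝ → ℤ) := by
  have : (round : ℝ → ℤ) = fun x => ⌊x + 1 / 2⌋ := funext fun x => round_eq x
  rw [this]
  exact Int.measurable_floor.comp (measurable_id.add_const _)

theorem volume_eq_tsum_round {A : Set ℝ} (hA : MeasurableSet A) :
    volume A = ∑' m : ℤ, volume (A ∩ round ⁻¹' {m}) := by
  rw [← measure_iUnion]
  · congr 1
    ext x
    simp
  · intro i j hij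
    refine Set.disjoint_left.2 fun x hx hy => hij ?_
    rw [← (hx.2 : round x = i), ← (hy.2 : round x = j)]
  · exact fun m => hA.inter (measurable_round_real (measurableSet_singleton m))

/-- The reflection of each unit interval around an integer is measure preserving. -/
theorem measurePreserving_reflect :
    MeasurePreserving (fun x : ℝ => 2 * (round x : ℝ) - x) volume volume := by
  have hmeas : Measurable (fun x : ℝ => 2 * (round x : ℝ) - x) :=
    ((measurable_from_top (f := fun m : ℤ => (m : ℝ)).comp measurable_round_real).const_mul 2).sub
      measurable_id
  refine ⟨hmeas, Measure.ext fun A hA => ?_⟩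
  rw [Measure.map_apply hmeas hA, volume_eq_tsum_round (hmeas hA), volume_eq_tsum_round hA]
  refine tsum_congr fun m => ?_
  have hIco : round ⁻¹' {m} = Set.Ico ((m : ℝ) - 1 / 2) (m + 1 / 2) := by
    ext x; simpa using round_eq_iff_mem_Ico x m
  -- Reflection about m exchanges the two ends of the half-open cell; the endpoints are a null set.
  have h1 : (fun x : ℝ => 2 * (round x : ℝ) - x) ⁻¹' A ∩ round ⁻¹' {m}
      = (fun x : ℝ => 2 * (m : ℝ) - x) ⁻¹' (A ∩ Set.Ioc ((m : ℝ) - 1 / 2) (m + 1 / 2)) := by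
    ext x
    simp only [Set.mem_inter_iff, Set.mem_preimage, Set.mem_singleton_iff, Set.mem_Ioc]
    constructor
    · rintro ⟨h, hr⟩
      have := (round_eq_iff_mem_Ico x m).1 hr
      rw [hr] at h
      exact ⟨h, by linarith [this.2], by linarith [this.1]⟩
    · rintro ⟨h, h2, h3⟩
      have hr := (round_eq_iff_mem_Ico x m).2 ⟨by linarith, by linarith⟩
      rw [hr]
      exact ⟨h, rfl⟩
  have h2 := (Measure.measurePreserving_sub_left volume (2 * (m : ℝ))).measure_preimage
    (hA.inter (measurableSet_Ioc (a := (m : ℝ) - 1 / 2) (b := m + 1 / 2))).nullMeasurableSet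
  rw [h1, h2, hIco]
  exact measure_congr ((ae_eq_refl A).inter Ico_ae_eq_Ioc.symm)

/-- The nearest lattice point, coordinatewise. -/
noncomputable def nearest {n : ℕ} (x : Fin n → ℝ) : Fin n → ℤ := fun i => round (x i)

theorem measurable_nearest {n : ℕ} : Measurable (nearest (n := n)) :=
  measurable_pi_lambda _ fun i => measurable_round_real.comp (measurable_pi_apply i)

theorem measurable_toReal {n : ℕ} : Measurable (toReal (n := n)) :=
  measurable_pi_lambda _ fun i =>
    measurable_from_top (f := fun m : ℤ => (m : ℝ)).comp (measurable_pi_apply i)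

theorem norm_toReal_nearest_sub_le {n : ℕ} (x : Fin n → ℝ) : ‖toReal (nearest x) - x‖ ≤ 1 / 2 := by
  refine (pi_norm_le_iff_of_nonneg (by norm_num)).2 fun i => ?_
  rw [Pi.sub_apply, norm_sub_rev]
  exact abs_sub_round (x i)

theorem measurePreserving_reflect_pi {n : ℕ} :
    MeasurePreserving (fun x : Fin n → ℝ => (2 : ℝ) • toReal (nearest x) - x) volume volume :=
  volume_preserving_pi (fun _ : Fin n => measurePreserving_reflect)

theorem volume_nearest_preimage {n : ℕ} (m : Fin n → ℤ) :
    volume.real (nearest ⁻¹' {m}) = 1 := by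
  have : nearest ⁻¹' {m} = Set.univ.pi fun i => Set.Ico ((m i : ℝ) - 1 / 2) (m i + 1 / 2) := by
    ext x
    simp only [Set.mem_preimage, Set.mem_singleton_iff, Set.mem_univ_pi, nearest, funext_iff,
      round_eq_iff_mem_Ico]
  rw [this, measureReal_def, volume_pi_pi]
  norm_num [Real.volume_Ico]

theorem integral_comp_nearest {n : ℕ} (G : (Fin n → ℤ) → ℝ) (hG : (Function.support G).Finite) :
    ∫ x, G (nearest x) = ∑ᶠ m, G m := by
  rw [finsum_eq_sum_of_support_subset (s := hG.toFinset) G (by simp)]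
  have hfin : ∀ m : Fin n → ℤ, volume (nearest ⁻¹' {m}) ≠ ⊤ := by
    intro m h
    have := volume_nearest_preimage m
    rw [measureReal_def, h] at this
    simp at this
  have hms : ∀ m : Fin n → ℤ, MeasurableSet (nearest ⁻¹' {m}) :=
    fun m => measurable_nearest (measurableSet_singleton m)
  have : ∀ x, G (nearest x)
      = ∑ m ∈ hG.toFinset, (nearest ⁻¹' {m}).indicator (fun _ => G m) x := by
    intro x
    rw [Finset.sum_eq_single (nearest x)]
    · simp
    · intro m _ hm
      exact Set.indicator_of_notMem (fun h => hm h.symm) _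
    · intro h
      simp only [Set.Finite.mem_toFinset, Function.mem_support, not_not] at h
      simp [h]
  simp_rw [this]
  rw [integral_finsetSum]
  · refine Finset.sum_congr rfl fun m _ => ?_
    rw [integral_indicator (hms m), setIntegral_const, volume_nearest_preimage, one_smul]
  · intro m _
    exact (integrable_indicator_iff (hms m)).2 (integrableOn_const (hfin m))

theorem finite_toReal_preimage {n : ℕ} {B : Set (Fin n → ℝ)} (hB : Bornology.IsBounded B) :
    (toReal ⁻¹' B).Finite := by
  obtain ⟨R, hR⟩ := hB.subset_closedBall 0
  refine (Set.finite_Icc (fun _ : Fin n => -⌈R⌉) (fun _ => ⌈R⌉)).subset fun m hm => ?_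
  have h := mem_closedBall_zero_iff.1 (hR hm)
  have hi : ∀ i, |(m i : ℝ)| ≤ ⌈R⌉ := fun i =>
    ((norm_le_pi_norm (toReal m) i).trans h).trans (Int.le_ceil R)
  refine ⟨fun i => ?_, fun i => ?_⟩
  · exact_mod_cast (abs_le.1 (hi i)).1
  · exact_mod_cast (abs_le.1 (hi i)).2

/-- The linear parts at x cancel in the second difference, which is therefore o(‖z‖), and ‖z‖ ≤ 1/k.
-/
theorem tendsto_second_difference {n : ℕ} {h : (Fin n → ℝ) → ℝ} {x : Fin n → ℝ}
    (hx : DifferentiableAt ℝ h x) {z : ℕ → Fin n → ℝ} (hz : ∀ᶠ k : ℕ in atTop, ‖z k‖ ≤ 1 / k) :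
    Tendsto (fun k : ℕ => (k : ℝ) * (h x + h (x + (2 : ℝ) • z k) - 2 * h (x + z k)))
      atTop (𝓝 0) := by
  have hd := (hasFDerivAt_iff_isLittleO_nhds_zero.1 hx.hasFDerivAt)
  have hz0 : Tendsto z atTop (𝓝 0) :=
    squeeze_zero_norm' hz tendsto_one_div_atTop_nhds_zero_nat
  have hz2 : Tendsto (fun k => (2 : ℝ) • z k) atTop (𝓝 0) := by
    simpa using hz0.const_smul (2 : ℝ)
  rw [Metric.tendsto_atTop]
  intro ε hε
  have h1 := hz0.eventually (Asymptotics.isLittleO_iff.1 hd (show 0 < ε / 8 by positivity))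
  have h2 := hz2.eventually (Asymptotics.isLittleO_iff.1 hd (show 0 < ε / 8 by positivity))
  obtain ⟨N, hN⟩ := eventually_atTop.1 ((h1.and h2).and (hz.and (eventually_gt_atTop 0)))
  refine ⟨N, fun k hk => ?_⟩
  obtain ⟨⟨h1, h2⟩, hzk, hk0⟩ := hN k hk
  have hk0' : (0 : ℝ) < k := by exact_mod_cast hk0
  rw [norm_smul, map_smul, smul_eq_mul, Real.norm_eq_abs, Real.norm_eq_abs, abs_two] at h2
  rw [Real.norm_eq_abs] at h1
  rw [Real.dist_eq, sub_zero, abs_mul, abs_of_pos hk0']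
  -- The Taylor error at 2z is at most (ε/8) · 2‖z‖, and the one at z, counted twice, is at most 2 ·
  -- (ε/8)‖z‖.
  have h3 : |h x + h (x + (2 : ℝ) • z k) - 2 * h (x + z k)| ≤ ε / 2 * ‖z k‖ := by
    rw [abs_le] at h1 h2 ⊢
    constructor <;> nlinarith [h1.1, h1.2, h2.1, h2.2]
  calc (k : ℝ) * |h x + h (x + (2 : ℝ) • z k) - 2 * h (x + z k)| ≤ k * (ε / 2 * (1 / k)) := by
        gcongr
        exact h3.trans (by gcongr)
    _ = ε / 2 := by field_simp
    _ < ε := by linarith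

/-- Riemann sums of a Lipschitz function with bounded support converge to the integral faster
than the mesh. -/
theorem tendsto_riemannSum {n : ℕ} {h : (Fin n → ℝ) → ℝ} {C : NNReal} (hC : LipschitzWith C h)
    {R : ℝ} (hR : ∀ x, R < ‖x‖ → h x = 0) :
    Tendsto (fun k : ℕ => (k : ℝ) *
      ((∑ᶠ m : Fin n → ℤ, h ((k : ℝ)⁻¹ • toReal m)) / (k : ℝ) ^ n - ∫ x, h x)) atTop (𝓝 0) := by
  -- r k x is the point of (1/k)ℤⁿ nearest to x. The Riemann sum is ∫ h(r), and reflecting each cell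
  -- in its centre gives ∫ h(2r - x) = ∫ h. Hence the error is -1/2 times the integral of the second
  -- difference h(x) + h(2r - x) - 2h(r). Multiplied by k, this integrand is bounded by the
  -- Lipschitz constant and tends to 0 almost everywhere.
  let r : ℕ → (Fin n → ℝ) → (Fin n → ℝ) := fun k x => (k : ℝ)⁻¹ • toReal (nearest ((k : ℝ) • x))
  have hrdist : ∀ k : ℕ, 0 < k → ∀ x, ‖r k x - x‖ ≤ 1 / 2 * (1 / k) := by
    intro k hk x
    have hk' : (0 : ℝ) < k := by exact_mod_cast hk
    have : r k x - x = (k : ℝ)⁻¹ • (toReal (nearest ((k : ℝ) • x)) - (k : ℝ) • x) := by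
      rw [smul_sub, smul_smul, inv_mul_cancel₀ hk'.ne', one_smul]
    rw [this, norm_smul, norm_inv, Real.norm_natCast, mul_comm, ← one_div]
    gcongr
    exact norm_toReal_nearest_sub_le _
  have hcpt : HasCompactSupport h :=
    HasCompactSupport.intro (isCompact_closedBall 0 R) fun x hx => hR x (by simpa using hx)
  have hint : Integrable h := hC.continuous.integrable_of_hasCompactSupport hcpt
  have hrmeas : ∀ k, Measurable (r k) := fun k =>
    (measurable_toReal.comp (measurable_nearest.comp (measurable_const_smul (k : ℝ)))).const_smul
      ((k : ℝ)⁻¹)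
  -- bounds for the three terms of the second difference
  have hmem : ∀ k : ℕ, 0 < k → ∀ x, h x ≠ 0 ∨ h (r k x) ≠ 0 ∨ h ((2 : ℝ) • r k x - x) ≠ 0 →
      x ∈ Metric.closedBall (0 : Fin n → ℝ) (R + 1) := by
    intro k hk x hx
    have hk' : (1 : ℝ) ≤ k := by exact_mod_cast hk
    have h1 : ‖r k x - x‖ ≤ 1 / 2 := (hrdist k hk x).trans (by
      have : 1 / (k : ℝ) ≤ 1 := by rw [div_le_one] <;> linarith
      linarith)
    have hb : ∀ y, h y ≠ 0 → ‖y‖ ≤ R := fun y hy => not_lt.1 fun hlt => hy (hR y hlt)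
    rw [mem_closedBall_zero_iff]
    rcases hx with hx | hx | hx
    · linarith [hb _ hx]
    · have := norm_sub_norm_le x (r k x)
      rw [norm_sub_rev] at this
      linarith [hb _ hx]
    · have h2 := norm_sub_norm_le x ((2 : ℝ) • r k x - x)
      have h3 : x - ((2 : ℝ) • r k x - x) = (-2 : ℝ) • (r k x - x) := by module
      rw [h3, norm_smul, Real.norm_eq_abs, abs_neg, abs_two] at h2
      linarith [hb _ hx]
  have hintr : ∀ k : ℕ, 0 < k → Integrable (fun x => h (r k x)) := by
    intro k hk
    obtain ⟨c, hc⟩ := hC.continuous.bounded_above_of_compact_support hcpt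
    refine (integrable_indicator_iff (s := Metric.closedBall (0 : Fin n → ℝ) (R + 1))
      measurableSet_closedBall |>.2 (integrableOn_const (C := c) ?_)).mono'
      (hC.continuous.measurable.comp (hrmeas k)).aestronglyMeasurable (ae_of_all _ fun x => ?_)
    · exact (isCompact_closedBall _ _).measure_lt_top.ne
    · by_cases hx : h (r k x) = 0
      · simp only [hx, norm_zero]
        exact Set.indicator_nonneg (fun _ _ => (norm_nonneg _).trans (hc 0)) x
      · rw [Set.indicator_of_mem (hmem k hk x (Or.inr (Or.inl hx)))]
        exact hc _
  have hscale : ∀ (k : ℕ), 0 < k → ∀ f : (Fin n → ℝ) → ℝ,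
      ∫ x, f ((k : ℝ) • x) = ((k : ℝ) ^ n)⁻¹ * ∫ x, f x := by
    intro k hk f
    rw [Measure.integral_comp_smul, Module.finrank_fin_fun, smul_eq_mul, abs_of_nonneg]
    positivity
  have hrsum : ∀ k : ℕ, 0 < k → ∫ x, h (r k x)
      = (∑ᶠ m : Fin n → ℤ, h ((k : ℝ)⁻¹ • toReal m)) / (k : ℝ) ^ n := by
    intro k hk
    have hk' : (0 : ℝ) < k := by exact_mod_cast hk
    rw [hscale k hk (fun y => h ((k : ℝ)⁻¹ • toReal (nearest y))),
      integral_comp_nearest (fun m => h ((k : ℝ)⁻¹ • toReal m)), div_eq_inv_mul]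
    refine (finite_toReal_preimage (Metric.isBounded_closedBall (x := (0 : Fin n → ℝ))
      (r := k * R))).subset fun m hm => ?_
    rw [Set.mem_preimage, mem_closedBall_zero_iff]
    by_contra hlt
    refine hm (hR _ ?_)
    rw [norm_smul, norm_inv, Real.norm_natCast, lt_inv_mul_iff₀ hk']
    exact not_le.1 hlt
  have hrefl : ∀ k : ℕ, 0 < k → Integrable (fun x => h ((2 : ℝ) • r k x - x)) ∧
      ∫ x, h ((2 : ℝ) • r k x - x) = ∫ x, h x := by
    intro k hk
    have hk' : (0 : ℝ) < k := by exact_mod_cast hk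
    have heq : ∀ x, h ((2 : ℝ) • r k x - x)
        = (fun y => h ((k : ℝ)⁻¹ • ((2 : ℝ) • toReal (nearest y) - y))) ((k : ℝ) • x) := by
      intro x
      simp only [r]
      congr 1
      rw [smul_sub, smul_smul, smul_smul, smul_smul, inv_mul_cancel₀ hk'.ne', one_smul, mul_comm]
    simp_rw [heq]
    have hi : Integrable (fun y => h ((k : ℝ)⁻¹ • y)) := hint.comp_smul (by positivity)
    have hi2 := measurePreserving_reflect_pi.integrable_comp_of_integrable hi
    refine ⟨Integrable.comp_smul (f := fun y => h ((k : ℝ)⁻¹ • ((2 : ℝ) • toReal (nearest y) - y)))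
      hi2 hk'.ne', ?_⟩
    rw [hscale k hk (fun y => h ((k : ℝ)⁻¹ • ((2 : ℝ) • toReal (nearest y) - y)))]
    have h3 := integral_map (μ := volume) measurePreserving_reflect_pi.measurable.aemeasurable
      (f := fun y : Fin n → ℝ => h ((k : ℝ)⁻¹ • y))
      (hC.continuous.comp (continuous_const_smul _)).aestronglyMeasurable
    rw [measurePreserving_reflect_pi.map_eq] at h3
    rw [← h3, ← hscale k hk (fun y => h ((k : ℝ)⁻¹ • y))]
    simp_rw [smul_smul, inv_mul_cancel₀ hk'.ne', one_smul]
  have hlim : Tendsto (fun k : ℕ => ∫ x, (k : ℝ) * (h x + h ((2 : ℝ) • r k x - x) - 2 * h (r k x)))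
      atTop (𝓝 (∫ _ : Fin n → ℝ, (0 : ℝ))) := by
    refine tendsto_integral_filter_of_dominated_convergence
      ((Metric.closedBall (0 : Fin n → ℝ) (R + 1)).indicator fun _ => (C : ℝ)) ?_ ?_ ?_ ?_
    · refine Eventually.of_forall fun k => Measurable.aestronglyMeasurable ?_
      have hm := hC.continuous.measurable
      exact ((hm.add (hm.comp (((hrmeas k).const_smul (2 : ℝ)).sub measurable_id))).sub
        ((hm.comp (hrmeas k)).const_mul 2)).const_mul _
    · filter_upwards [eventually_gt_atTop 0] with k hk
      refine ae_of_all _ fun x => ?_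
      have hk' : (0 : ℝ) < k := by exact_mod_cast hk
      by_cases hx : x ∈ Metric.closedBall (0 : Fin n → ℝ) (R + 1)
      · rw [Set.indicator_of_mem hx, norm_mul, Real.norm_natCast]
        have h1 := hC.dist_le_mul x (r k x)
        have h2 := hC.dist_le_mul ((2 : ℝ) • r k x - x) (r k x)
        have h4 : (2 : ℝ) • r k x - x - r k x = r k x - x := by module
        rw [Real.dist_eq, dist_eq_norm, norm_sub_rev] at h1
        rw [Real.dist_eq, dist_eq_norm, h4] at h2
        have h5 : (C : ℝ) * ‖r k x - x‖ ≤ C * (1 / 2 * (1 / k)) := by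
          gcongr
          exact hrdist k hk x
        have h6 : ‖h x + h ((2 : ℝ) • r k x - x) - 2 * h (r k x)‖ ≤ C * (1 / k) := by
          rw [Real.norm_eq_abs]
          rw [abs_le] at h1 h2 ⊢
          constructor <;> linarith [h1.1, h1.2, h2.1, h2.2]
        calc (k : ℝ) * ‖h x + h ((2 : ℝ) • r k x - x) - 2 * h (r k x)‖ ≤ k * (C * (1 / k)) := by
              gcongr
          _ = C := by field_simp
      · have hz := mt (hmem k hk x) hx
        rw [not_or, not_or, not_ne_iff, not_ne_iff, not_ne_iff] at hz
        rw [Set.indicator_of_notMem hx, hz.1, hz.2.1, hz.2.2]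
        simp
    · exact (integrable_indicator_iff measurableSet_closedBall).2
        (integrableOn_const (isCompact_closedBall _ _).measure_lt_top.ne)
    -- Rademacher's theorem, applied with increments z = r k x - x.
    · filter_upwards [hC.ae_differentiableAt (μ := volume)] with x hx
      have := tendsto_second_difference hx (z := fun k => r k x - x) (by
        filter_upwards [eventually_gt_atTop 0] with k hk
        refine (hrdist k hk x).trans ?_
        have : 0 ≤ 1 / (k : ℝ) := by positivity
        linarith)
      convert this using 6 with k k
      · module
      · module
  rw [integral_zero] at hlim
  have hlim' := hlim.const_mul (-(1 / 2 : ℝ))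
  rw [mul_zero] at hlim'
  refine hlim'.congr' ?_
  filter_upwards [eventually_gt_atTop 0] with k hk
  have hadd : Integrable (fun x => h x + h ((2 : ℝ) • r k x - x)) := hint.add (hrefl k hk).1
  rw [integral_const_mul, integral_sub hadd ((hintr k hk).const_mul 2), integral_add hint (hrefl k hk).1, integral_const_mul, (hrefl k hk).2, hrsum k hk]
  ring

end ToricFano

namespace ToricFano

open Filter Topology

/-! ### Convex geometry of reflexive polytopes -/

/-- A convex combination lying on the face a = c uses only points of `E` on that face, and one of
these has x-value at most the average. -/
theorem exists_vertex_le_of_mem_convexHull {n : ℕ} {E : Set (Fin n → ℝ)} {y : Fin n → ℝ}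
    (hy : y ∈ convexHull ℝ E) {a : Fin n → ℝ} {c : ℝ} (ha : ∀ u ∈ E, c ≤ a ⬝ᵥ u)
    (hay : a ⬝ᵥ y = c) (x : Fin n → ℝ) : ∃ u ∈ E, a ⬝ᵥ u = c ∧ x ⬝ᵥ u ≤ x ⬝ᵥ y := by
  rw [convexHull_eq] at hy
  obtain ⟨ι, t, w, z, hw0, hw1, hz, rfl⟩ := hy
  rw [Finset.centerMass_eq_of_sum_1 _ _ hw1] at hay ⊢
  simp only [dotProduct_sum, dotProduct_smul, smul_eq_mul] at hay ⊢
  have h0 : ∀ i ∈ t, w i * (a ⬝ᵥ z i - c) = 0 := by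
    refine (Finset.sum_eq_zero_iff_of_nonneg fun i hi =>
      mul_nonneg (hw0 i hi) (sub_nonneg.2 (ha _ (hz i hi)))).1 ?_
    simp only [mul_sub, Finset.sum_sub_distrib, hay, ← Finset.sum_mul, hw1]
    ring
  by_contra! hcon
  have hpos : ∀ i ∈ t, 0 ≤ w i * (x ⬝ᵥ z i - ∑ i ∈ t, w i * (x ⬝ᵥ z i)) := by
    intro i hi
    rcases mul_eq_zero.1 (h0 i hi) with h | h
    · simp [h]
    · exact mul_nonneg (hw0 i hi) (sub_nonneg.2 (hcon _ (hz i hi) (sub_eq_zero.1 h)).le)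
  have hsum : ∑ i ∈ t, w i * (x ⬝ᵥ z i - ∑ i ∈ t, w i * (x ⬝ᵥ z i)) = 0 := by
    simp only [mul_sub, Finset.sum_sub_distrib, ← Finset.sum_mul, hw1]
    ring
  have hw : ∀ i ∈ t, w i = 0 := by
    intro i hi
    rcases mul_eq_zero.1 ((Finset.sum_eq_zero_iff_of_nonneg hpos).1 hsum i hi) with h | h
    · exact h
    · rcases mul_eq_zero.1 (h0 i hi) with h' | h'
      · exact h'
      · exact absurd (sub_eq_zero.1 h) (hcon _ (hz i hi) (sub_eq_zero.1 h')).ne'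
  rw [Finset.sum_eq_zero hw] at hw1
  exact zero_ne_one hw1

theorem le_dotProduct_of_mem_convexHull {n : ℕ} {E : Set (Fin n → ℝ)} {y : Fin n → ℝ}
    (hy : y ∈ convexHull ℝ E) {a : Fin n → ℝ} {c : ℝ} (ha : ∀ u ∈ E, c ≤ a ⬝ᵥ u) :
    c ≤ a ⬝ᵥ y := by
  -- For a = 0 and c = 0 the face is the whole hull.
  obtain ⟨u, hu, -, h⟩ := exists_vertex_le_of_mem_convexHull hy (a := 0) (c := 0) (by simp)
    (by simp) a
  exact (ha u hu).trans h

section LatticePolytope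

variable {n : ℕ} {A : Set (Fin n → ℝ)} (hA : IsLatticePolytope A)

include hA

theorem IsLatticePolytope.isCompact : IsCompact A := by
  obtain ⟨S, rfl⟩ := hA
  exact (S.finite_toSet.image _).isCompact_convexHull ℝ

theorem IsLatticePolytope.convex : Convex ℝ A := by
  obtain ⟨S, rfl⟩ := hA
  exact convex_convexHull ℝ _

theorem IsLatticePolytope.exists_toReal {v : Fin n → ℝ} (hv : v ∈ A.extremePoints ℝ) :
    ∃ m : Fin n → ℤ, toReal m = v := by
  obtain ⟨S, rfl⟩ := hA
  obtain ⟨m, -, hm⟩ := extremePoints_convexHull_subset hv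
  exact ⟨m, hm⟩

theorem IsLatticePolytope.finite_extremePoints : (A.extremePoints ℝ).Finite := by
  obtain ⟨S, rfl⟩ := hA
  exact (S.finite_toSet.image _).subset extremePoints_convexHull_subset

theorem IsLatticePolytope.convexHull_extremePoints : convexHull ℝ (A.extremePoints ℝ) = A := by
  have h := closure_convexHull_extremePoints hA.isCompact hA.convex
  rwa [(hA.finite_extremePoints.isCompact_convexHull ℝ).isClosed.closure_eq] at h

end LatticePolytope

theorem exists_dotProduct_eq {n : ℕ} (f : (Fin n → ℝ) →L[ℝ] ℝ) :
    ∃ a : Fin n → ℝ, ∀ x, f x = a ⬝ᵥ x := by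
  refine ⟨fun i => f (Pi.single i 1), fun x => ?_⟩
  have h := (f : (Fin n → ℝ) →ₗ[ℝ] ℝ).pi_apply_eq_sum_univ x
  rw [ContinuousLinearMap.coe_coe] at h
  rw [h, dotProduct]
  refine Finset.sum_congr rfl fun i _ => ?_
  rw [smul_eq_mul, mul_comm]
  congr 2
  ext j
  simp [Pi.single_apply, eq_comm]

section Reflexive

variable {n : ℕ} {P : Set (Fin n → ℝ)} (hP : IsReflexive P)

include hP

theorem IsReflexive.zero_mem_self : (0 : Fin n → ℝ) ∈ P := interior_subset hP.zero_mem

theorem IsReflexive.mem_polarDual_iff {u : Fin n → ℝ} :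
    u ∈ polarDual P ↔ ∀ v ∈ P.extremePoints ℝ, -1 ≤ u ⬝ᵥ v := by
  refine ⟨fun h v hv => h v hv.1, fun h x hx => ?_⟩
  rw [← hP.lattice.convexHull_extremePoints] at hx
  exact le_dotProduct_of_mem_convexHull hx h

/-- The bipolar theorem: a functional separating x from `P` is positive at its threshold since 0 ∈
`P`, so it can be rescaled into the dual polytope, which is the hull of its extreme points. -/
theorem IsReflexive.mem_iff {x : Fin n → ℝ} :
    x ∈ P ↔ ∀ u ∈ (polarDual P).extremePoints ℝ, -1 ≤ u ⬝ᵥ x := by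
  refine ⟨fun h u hu => hu.1 x h, fun h => ?_⟩
  by_contra hx
  obtain ⟨f, c, hf, hc⟩ := geometric_hahn_banach_closed_point hP.lattice.convex
    hP.lattice.isCompact.isClosed hx
  obtain ⟨a, ha⟩ := exists_dotProduct_eq f
  have hc0 : 0 < c := by simpa using hf 0 hP.zero_mem_self
  have hmem : -(c⁻¹ • a) ∈ polarDual P := by
    intro y hy
    have := hf y hy
    rw [neg_dotProduct, smul_dotProduct, ← ha, smul_eq_mul, neg_le_neg_iff, inv_mul_le_iff₀ hc0]
    linarith
  rw [← hP.dual_lattice.convexHull_extremePoints] at hmem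
  have h1 : -1 ≤ x ⬝ᵥ (-(c⁻¹ • a)) :=
    le_dotProduct_of_mem_convexHull hmem fun u hu => by
      rw [dotProduct_comm]; exact h u hu
  rw [dotProduct_neg, dotProduct_smul, dotProduct_comm, ← ha, smul_eq_mul, neg_le_neg_iff,
    inv_mul_le_iff₀ hc0] at h1
  linarith

theorem IsReflexive.inv_smul_mem_iff {x : Fin n → ℝ} {r : ℝ} (hr : 0 < r) :
    r⁻¹ • x ∈ P ↔ ∀ u ∈ (polarDual P).extremePoints ℝ, -r ≤ u ⬝ᵥ x := by
  rw [hP.mem_iff]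
  refine forall₂_congr fun u _ => ?_
  rw [dotProduct_smul, smul_eq_mul, le_inv_mul_iff₀ hr, mul_neg_one]

theorem IsReflexive.nonempty_vertex : Nonempty (Vertex P) :=
  (hP.lattice.isCompact.extremePoints_nonempty ⟨0, hP.zero_mem_self⟩).to_subtype

theorem IsReflexive.finite_vertex : Finite (Vertex P) :=
  hP.lattice.finite_extremePoints.to_subtype

/-- If u were tight at no vertex of `P`, it could be moved a little both ways along a nonzero
direction inside the dual, so it would not be extreme. -/
theorem IsReflexive.exists_vertex_of_ray (hn : 1 ≤ n) {u : Fin n → ℝ}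
    (hu : u ∈ (polarDual P).extremePoints ℝ) : ∃ v : Vertex P, u ∈ rays P v := by
  by_contra! hcon
  have hlt : ∀ v ∈ P.extremePoints ℝ, -1 < u ⬝ᵥ v := by
    intro v hv
    refine lt_of_le_of_ne (hu.1 v hv.1) fun h => hcon ⟨v, hv⟩ ⟨hu, h.symm⟩
  let d : Fin n → ℝ := Pi.single ⟨0, hn⟩ 1
  have hd : d ≠ 0 := by simp [d]
  have hev : ∀ e : Fin n → ℝ, ∀ᶠ ε : ℝ in 𝓝[>] 0, u + ε • e ∈ polarDual P := by
    intro e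
    have : ∀ᶠ ε : ℝ in 𝓝[>] 0, ∀ v ∈ P.extremePoints ℝ, -1 < (u + ε • e) ⬝ᵥ v := by
      rw [eventually_all_finite hP.lattice.finite_extremePoints]
      intro v hv
      refine nhdsWithin_le_nhds (ContinuousAt.eventually_lt (x₀ := (0 : ℝ)) continuousAt_const ?_ ?_)
      · simp only [add_dotProduct, smul_dotProduct, smul_eq_mul]
        fun_prop
      · simpa using hlt v hv
    exact this.mono fun ε h => hP.mem_polarDual_iff.2 fun v hv => (h v hv).le
  obtain ⟨ε, ⟨h1, h2⟩, hε⟩ := (((hev d).and (hev (-d))).and self_mem_nhdsWithin).exists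
  have h3 : u ∈ openSegment ℝ (u + ε • d) (u + ε • (-d)) :=
    ⟨1 / 2, 1 / 2, by norm_num, by norm_num, by norm_num, by module⟩
  have h4 := hu.2 h1 h2 h3
  rw [add_eq_left, smul_eq_zero] at h4
  rcases h4 with h4 | h4
  · exact (ne_of_gt hε) h4
  · exact hd h4

/-- As v and w both minimise y, a positive multiple of y lies on the face of the dual where both are
tight, that is, y lies in the cone σ_v ∩ σ_w. The inequality on x, taken at this multiple, passes to
some vertex of that face. -/
theorem IsReflexive.exists_ray_lt {v w : Vertex P} {x y : Fin n → ℝ} {j : ℝ}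
    (hv : ∀ v' ∈ P.extremePoints ℝ, (v : Fin n → ℝ) ⬝ᵥ y ≤ v' ⬝ᵥ y)
    (hw : ∀ v' ∈ P.extremePoints ℝ, (w : Fin n → ℝ) ⬝ᵥ y ≤ v' ⬝ᵥ y)
    (hy : x ⬝ᵥ y < j * ((v : Fin n → ℝ) ⬝ᵥ y)) :
    ∃ u ∈ rays P v ∩ rays P w, u ⬝ᵥ x < -j := by
  have hvw : (w : Fin n → ℝ) ⬝ᵥ y = (v : Fin n → ℝ) ⬝ᵥ y :=
    le_antisymm (hw v v.2) (hv w w.2)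
  have hy0 : y ≠ 0 := by rintro rfl; simp at hy
  -- Since 0 is interior, -εy ∈ `P` for small ε > 0, so the minimum of y on `P` is at most -ε⟨y, y⟩.
  have hneg : (v : Fin n → ℝ) ⬝ᵥ y < 0 := by
    have hcont : Tendsto (fun ε : ℝ => (-ε) • y) (𝓝[>] 0) (𝓝 0) := by
      refine tendsto_nhdsWithin_of_tendsto_nhds ?_
      have : Continuous fun ε : ℝ => (-ε) • y := by fun_prop
      simpa using this.tendsto 0
    obtain ⟨ε, h1, h2⟩ := ((hcont.eventually
      (mem_interior_iff_mem_nhds.1 hP.zero_mem)).and self_mem_nhdsWithin).exists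
    have h1 : (-ε) • y ∈ P := h1
    have h2 : 0 < ε := h2
    have h3 : (v : Fin n → ℝ) ⬝ᵥ y ≤ y ⬝ᵥ ((-ε) • y) := by
      rw [← hP.lattice.convexHull_extremePoints] at h1
      exact le_dotProduct_of_mem_convexHull h1 fun v' hv' => by
        rw [dotProduct_comm y]; exact hv v' hv'
    have h4 : 0 < y ⬝ᵥ y := by
      refine lt_of_le_of_ne (Finset.sum_nonneg fun i _ => mul_self_nonneg _) ?_
      exact fun h => hy0 (dotProduct_self_eq_zero.1 h.symm)
    rw [dotProduct_smul, smul_eq_mul] at h3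
    nlinarith
  set g := -((v : Fin n → ℝ) ⬝ᵥ y) with hg
  have hg0 : 0 < g := by linarith
  have hmem : g⁻¹ • y ∈ polarDual P := by
    rw [hP.mem_polarDual_iff]
    intro v' hv'
    rw [smul_dotProduct, smul_eq_mul, le_inv_mul_iff₀ hg0, dotProduct_comm y]
    linarith [hv v' hv']
  rw [← hP.dual_lattice.convexHull_extremePoints] at hmem
  have hE : ∀ u ∈ (polarDual P).extremePoints ℝ, ∀ v' : Vertex P,
      -1 ≤ (v' : Fin n → ℝ) ⬝ᵥ u := fun u hu v' => by
    rw [dotProduct_comm]; exact hu.1 v' v'.2.1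
  -- On the dual v and w are each ≥ -1, so v + w = -2 cuts out the points where both equal -1.
  obtain ⟨u, hu, hu1, hu2⟩ := exists_vertex_le_of_mem_convexHull hmem
    (a := (v : Fin n → ℝ) + w) (c := -2)
    (fun u hu => by rw [add_dotProduct]; linarith [hE u hu v, hE u hu w])
    (by
      rw [dotProduct_smul, add_dotProduct, hvw, smul_eq_mul, inv_mul_eq_iff_eq_mul₀ hg0.ne']
      linarith) x
  rw [add_dotProduct] at hu1
  refine ⟨u, ⟨⟨hu, ?_⟩, ⟨hu, ?_⟩⟩, ?_⟩
  · rw [dotProduct_comm]; linarith [hE u hu v, hE u hu w]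
  · rw [dotProduct_comm]; linarith [hE u hu v, hE u hu w]
  · rw [dotProduct_comm]
    refine hu2.trans_lt ?_
    rw [dotProduct_smul, smul_eq_mul, inv_mul_lt_iff₀ hg0]
    linarith

/-- A function on the vertices of `P` that agrees on vertices of a common facet `u` with
`⟨u, x⟩ < -j` is constant on the set of vertices of such facets. -/
theorem IsReflexive.eq_of_visible {α : Type*} (c : Vertex P → α) {x : Fin n → ℝ} {j : ℝ}
    (hj : 0 ≤ j) (hc : ∀ v w : Vertex P, (∃ u ∈ rays P v ∩ rays P w, u ⬝ᵥ x < -j) → c v = c w)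
    {v w : Vertex P} (hv : ∃ u ∈ rays P v, u ⬝ᵥ x < -j) (hw : ∃ u ∈ rays P w, u ⬝ᵥ x < -j) :
    c v = c w := by
  have := hP.finite_vertex
  -- D is convex and contains every ray u with ⟨u, x⟩ < -j, using j ≥ 0. The closed cones T v of the
  -- normal fan cover it. If the value c v and some other value both occurred on D, connectedness
  -- would give a point of D in two cones with different values, and `IsReflexive.exists_ray_lt`
  -- would give those cones a common visible ray.
  let D : Set (Fin n → ℝ) := {y | ∀ v : Vertex P, x ⬝ᵥ y < j * ((v : Fin n → ℝ) ⬝ᵥ y)}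
  let T : Vertex P → Set (Fin n → ℝ) := fun v =>
    {y | ∀ v' ∈ P.extremePoints ℝ, (v : Fin n → ℝ) ⬝ᵥ y ≤ v' ⬝ᵥ y}
  have hD : Convex ℝ D := by
    intro y hy z hz a b ha hb hab v
    have h1 := hy v
    have h2 := hz v
    simp only [dotProduct_add, dotProduct_smul, smul_eq_mul]
    rcases ha.eq_or_lt with rfl | ha
    · rw [zero_add] at hab
      subst hab
      linarith
    · nlinarith [mul_lt_mul_of_pos_left h1 ha, mul_le_mul_of_nonneg_left h2.le hb]
  have hT : ∀ v, IsClosed (T v) := by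
    intro v
    have : T v = ⋂ v' ∈ P.extremePoints ℝ, {y | (v : Fin n → ℝ) ⬝ᵥ y ≤ v' ⬝ᵥ y} := by
      ext y; simp [T]
    rw [this]
    refine isClosed_biInter fun v' _ => isClosed_le ?_ ?_ <;>
    exact Continuous.dotProduct continuous_const continuous_id
  have hclosed : ∀ S : Set (Vertex P), IsClosed (⋃ v ∈ S, T v) := fun S =>
    S.toFinite.isClosed_biUnion fun v _ => hT v
  have hmem : ∀ v : Vertex P, (∃ u ∈ rays P v, u ⬝ᵥ x < -j) → ∃ u, u ∈ D ∧ u ∈ T v := by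
    rintro v ⟨u, hu, hux⟩
    refine ⟨u, fun v' => ?_, fun v' hv' => ?_⟩
    · have := hu.1.1 v' v'.2.1
      rw [dotProduct_comm x, dotProduct_comm (v' : Fin n → ℝ)]
      nlinarith
    · rw [dotProduct_comm, hu.2, dotProduct_comm]
      exact hu.1.1 v' hv'.1
  have hcover : ∀ y, ∃ v : Vertex P, y ∈ T v := by
    intro y
    have := hP.nonempty_vertex
    obtain ⟨v, hv⟩ := Finite.exists_min (fun v : Vertex P => (v : Fin n → ℝ) ⬝ᵥ y)
    exact ⟨v, fun v' hv' => hv ⟨v', hv'⟩⟩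
  by_contra hne
  obtain ⟨y, hyD, hy1, hy2⟩ := isPreconnected_closed_iff.1 hD.isPreconnected
    (⋃ v' ∈ {v' | c v' = c v}, T v') (⋃ v' ∈ {v' | c v' ≠ c v}, T v')
    (hclosed _) (hclosed _)
    (by
      intro y _
      obtain ⟨v', hv'⟩ := hcover y
      by_cases h : c v' = c v
      · exact Or.inl (Set.mem_biUnion (x := v') h hv')
      · exact Or.inr (Set.mem_biUnion (x := v') h hv'))
    (by
      obtain ⟨u, h1, h2⟩ := hmem v hv
      exact ⟨u, h1, Set.mem_biUnion (x := v) rfl h2⟩)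
    (by
      obtain ⟨u, h1, h2⟩ := hmem w hw
      exact ⟨u, h1, Set.mem_biUnion (x := w) (fun h => hne h.symm) h2⟩)
  obtain ⟨v₁, hv₁, hy₁⟩ := Set.mem_iUnion₂.1 hy1
  obtain ⟨v₂, hv₂, hy₂⟩ := Set.mem_iUnion₂.1 hy2
  have h := hc v₁ v₂ (hP.exists_ray_lt hy₁ hy₂ (hyD v₁))
  exact hv₂ (h ▸ hv₁)

theorem IsReflexive.exists_supportValue (l : Fin n → ℝ) :
    (∃ p ∈ P.extremePoints ℝ, p ⬝ᵥ l = supportValue P l) ∧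
      ∀ x ∈ P, x ⬝ᵥ l ≤ supportValue P l := by
  have := hP.finite_vertex
  have := hP.nonempty_vertex
  obtain ⟨v, hv⟩ := Finite.exists_max (fun v : Vertex P => (v : Fin n → ℝ) ⬝ᵥ l)
  have hmax : ∀ x ∈ P, x ⬝ᵥ l ≤ (v : Fin n → ℝ) ⬝ᵥ l := by
    intro x hx
    rw [← hP.lattice.convexHull_extremePoints] at hx
    have := le_dotProduct_of_mem_convexHull hx (a := -l) (c := -((v : Fin n → ℝ) ⬝ᵥ l))
      fun u hu => by
        rw [neg_dotProduct, dotProduct_comm l, neg_le_neg_iff]; exact hv ⟨u, hu⟩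
    rwa [neg_dotProduct, dotProduct_comm l, neg_le_neg_iff] at this
  have : supportValue P l = (v : Fin n → ℝ) ⬝ᵥ l := by
    refine IsGreatest.csSup_eq ⟨⟨v, v.2.1, rfl⟩, ?_⟩
    rintro _ ⟨x, hx, rfl⟩
    exact hmax x hx
  rw [this]
  exact ⟨⟨v, v.2, rfl⟩, hmax⟩

end Reflexive

end ToricFano

namespace ToricFano

/-! ### Sections by their supports -/

theorem AddMonoidAlgebra.mem_span_single_iff {A : Type*} (T : Set A) (f : AddMonoidAlgebra ℂ A) :
    f ∈ Submodule.span ℂ {f | ∃ a ∈ T, f = AddMonoidAlgebra.single a (1 : ℂ)} ↔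
      ∀ a, f.coeff a ≠ 0 → a ∈ T := by
  constructor
  · intro hf
    induction hf using Submodule.span_induction with
    | mem f h =>
      obtain ⟨a, ha, rfl⟩ := h
      intro b hb
      rw [AddMonoidAlgebra.coeff_single] at hb
      rwa [← (Finsupp.single_apply_ne_zero.1 hb).1] at ha
    | zero => simp
    | add f g _ _ hf hg =>
      intro a ha
      rw [AddMonoidAlgebra.coeff_add, Finsupp.add_apply] at ha
      by_cases h : f.coeff a = 0
      · exact hg a (by simpa [h] using ha)
      · exact hf a h
    | smul c f _ hf =>
      intro a ha
      rw [AddMonoidAlgebra.coeff_smul_apply] at ha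
      exact hf a (right_ne_zero_of_smul ha)
  · intro h
    rw [← AddMonoidAlgebra.sum_coeff_single f]
    refine Submodule.sum_mem _ fun a ha => ?_
    have : AddMonoidAlgebra.single a (f.coeff a)
        = f.coeff a • AddMonoidAlgebra.single a (1 : ℂ) := by
      rw [AddMonoidAlgebra.smul_single, smul_eq_mul, mul_one]
    rw [this]
    exact Submodule.smul_mem _ _ (Submodule.subset_span ⟨a, h a (Finsupp.mem_support_iff.1 ha), rfl⟩)

variable {n : ℕ}

theorem mem_localSections {R : Set (Fin n → ℝ)} {k : ℤ} {f : Laurent n} :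
    f ∈ localSections R k ↔ ∀ m, f.coeff m ≠ 0 → ∀ u ∈ R, -(k : ℝ) ≤ u ⬝ᵥ toReal m :=
  AddMonoidAlgebra.mem_span_single_iff {m : Fin n → ℤ | ∀ u ∈ R, -(k : ℝ) ≤ u ⬝ᵥ toReal m} f

theorem mem_familySections {R : Set (Fin n → ℝ)} {k : ℤ} {T : Set ℝ} {f : LaurentT n} :
    f ∈ familySections R k T ↔
      ∀ m γ, f.coeff (m, γ) ≠ 0 → (∀ u ∈ R, -(k : ℝ) ≤ u ⬝ᵥ toReal m) ∧ γ ∈ T := by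
  have : {f : LaurentT n | ∃ (m : Fin n → ℤ) (γ : ℝ), (∀ u ∈ R, -(k : ℝ) ≤ u ⬝ᵥ toReal m) ∧ γ ∈ T ∧
      f = AddMonoidAlgebra.single (m, γ) 1}
      = {f | ∃ a ∈ {a : (Fin n → ℤ) × ℝ | (∀ u ∈ R, -(k : ℝ) ≤ u ⬝ᵥ toReal a.1) ∧ a.2 ∈ T},
        f = AddMonoidAlgebra.single a (1 : ℂ)} := by
    ext f
    constructor
    · rintro ⟨m, γ, h1, h2, rfl⟩
      exact ⟨(m, γ), ⟨h1, h2⟩, rfl⟩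
    · rintro ⟨⟨m, γ⟩, ⟨h1, h2⟩, rfl⟩
      exact ⟨m, γ, h1, h2, rfl⟩
  rw [familySections, this, AddMonoidAlgebra.mem_span_single_iff]
  exact ⟨fun h m γ => h (m, γ), fun h a => h a.1 a.2⟩

theorem localSections_anti {R R' : Set (Fin n → ℝ)} (h : R ⊆ R') (k : ℤ) :
    localSections R' k ≤ localSections R k := fun _ hf =>
  mem_localSections.2 fun m hm u hu => mem_localSections.1 hf m hm u (h hu)

theorem toReal_add (a b : Fin n → ℤ) : toReal (a + b) = toReal a + toReal b := by
  ext i; simp [toReal]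

theorem toReal_sub (a b : Fin n → ℤ) : toReal (a - b) = toReal a - toReal b := by
  ext i; simp [toReal]

theorem toReal_smul (j : ℤ) (a : Fin n → ℤ) : toReal (j • a) = (j : ℝ) • toReal a := by
  ext i; simp [toReal]

theorem localSections_mul_le (R : Set (Fin n → ℝ)) (i j : ℤ) :
    localSections R i * localSections R j ≤ localSections R (i + j) := by
  rw [localSections, localSections, Submodule.span_mul_span, Submodule.span_le]
  rintro _ ⟨_, ⟨a, ha, rfl⟩, _, ⟨b, hb, rfl⟩, rfl⟩
  refine Submodule.subset_span ⟨a + b, fun u hu => ?_, ?_⟩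
  · rw [toReal_add, dotProduct_add]
    push_cast
    linarith [ha u hu, hb u hu]
  · simp [AddMonoidAlgebra.single_mul_single]

/-- On such a chart z^v generates K_X^{-1}, so z^{iv} can be split off any monomial section. -/
theorem localSections_mul {R : Set (Fin n → ℝ)} {v : Fin n → ℤ}
    (hv : ∀ u ∈ R, u ⬝ᵥ toReal v = -1) (i j : ℤ) :
    localSections R i * localSections R j = localSections R (i + j) := by
  refine le_antisymm (localSections_mul_le R i j) ?_
  rw [localSections, Submodule.span_le]
  rintro _ ⟨m, hm, rfl⟩
  have : (AddMonoidAlgebra.single m 1 : Laurent n)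
      = AddMonoidAlgebra.single (i • v) 1 * AddMonoidAlgebra.single (m - i • v) 1 := by
    simp [AddMonoidAlgebra.single_mul_single]
  rw [this]
  refine Submodule.mul_mem_mul (Submodule.subset_span ⟨_, fun u hu => ?_, rfl⟩)
    (Submodule.subset_span ⟨_, fun u hu => ?_, rfl⟩)
  · rw [toReal_smul, dotProduct_smul, hv u hu, smul_eq_mul, mul_neg_one]
  · have := hm u hu
    push_cast at this
    rw [toReal_sub, toReal_smul, dotProduct_sub, dotProduct_smul, hv u hu, smul_eq_mul]
    linarith

theorem familySections_mul_le (R : Set (Fin n → ℝ)) (i j : ℤ) {T T' T'' : Set ℝ}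
    (hT : ∀ a ∈ T, ∀ b ∈ T', a + b ∈ T'') :
    familySections R i T * familySections R j T' ≤ familySections R (i + j) T'' := by
  rw [familySections, familySections, Submodule.span_mul_span, Submodule.span_le]
  rintro _ ⟨_, ⟨a, γ, ha, hγ, rfl⟩, _, ⟨b, γ', hb, hγ', rfl⟩, rfl⟩
  refine Submodule.subset_span ⟨a + b, γ + γ', fun u hu => ?_, hT γ hγ γ' hγ', ?_⟩
  · rw [toReal_add, dotProduct_add]
    push_cast
    linarith [ha u hu, hb u hu]
  · simp [AddMonoidAlgebra.single_mul_single]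

/-! ### The central fibre -/

/-- The coefficient of `t^γ`. -/
noncomputable def slice (γ : ℝ) (f : LaurentT n) : Laurent n :=
  .ofCoeff (f.coeff.comapDomain (fun m => (m, γ)) (Prod.mk_left_injective γ).injOn)

theorem coeff_slice (γ : ℝ) (f : LaurentT n) (m : Fin n → ℤ) :
    (slice γ f).coeff m = f.coeff (m, γ) := rfl

theorem slice_zero_eq (f : LaurentT n) : atZero n f = slice 0 f := rfl

/-- The part of `s` on which the pairing with `l` takes the value `W`. -/
noncomputable def initialForm (l : Fin n → ℝ) (W : ℝ) (s : Laurent n) : Laurent n :=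
  open Classical in .ofCoeff (s.coeff.filter fun p => toReal p ⬝ᵥ l = W)

theorem coeff_initialForm_ne_zero {l : Fin n → ℝ} {W : ℝ} {s : Laurent n} {p : Fin n → ℤ} :
    (initialForm l W s).coeff p ≠ 0 ↔ s.coeff p ≠ 0 ∧ toReal p ⬝ᵥ l = W := by
  classical
  simp only [initialForm, Finsupp.filter_apply]
  split_ifs with h <;> simp [h]

theorem slice_moved_mul (l : Fin n → ℝ) (s : Laurent n) (g : LaurentT n) (γ : ℝ) :
    slice γ (moved l s * g) = s.coeff.sum fun p b =>
      AddMonoidAlgebra.single p b * slice (γ + toReal p ⬝ᵥ l) g := by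
  induction s using AddMonoidAlgebra.induction_linear with
  | zero => ext m; simp [moved, coeff_slice]
  | add f f' hf hf' =>
    rw [AddMonoidAlgebra.coeff_add, Finsupp.sum_add_index', ← hf, ← hf', moved,
      AddMonoidAlgebra.mapDomain_add, add_mul]
    · ext m
      simp [coeff_slice, moved]
    · simp
    · intro a b c
      rw [AddMonoidAlgebra.single_add, add_mul]
  | single p b =>
    ext m
    rw [AddMonoidAlgebra.coeff_single, Finsupp.sum_single_index (by simp), moved,
      AddMonoidAlgebra.mapDomain_single, coeff_slice, AddMonoidAlgebra.coeff_single_mul_apply,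
      AddMonoidAlgebra.coeff_single_mul_apply, coeff_slice]
    congr 2
    simp [add_comm]

/-- The lowest t-term of a product is the product of the lowest t-terms; an exponent p with ⟨p, l⟩ <
W would need a slice of g below γ. -/
theorem slice_moved_mul_of_lowest {l : Fin n → ℝ} {W : ℝ} {s : Laurent n}
    (hW : ∀ p, s.coeff p ≠ 0 → toReal p ⬝ᵥ l ≤ W) {g : LaurentT n} {γ : ℝ}
    (hg : ∀ γ' < γ, slice γ' g = 0) :
    slice (γ - W) (moved l s * g) = initialForm l W s * slice γ g := by
  classical
  have h : initialForm l W s = ∑ p ∈ s.coeff.support,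
      if toReal p ⬝ᵥ l = W then AddMonoidAlgebra.single p (s.coeff p) else 0 := by
    ext m
    simp only [initialForm, Finsupp.filter_apply, AddMonoidAlgebra.coeff_sum, Finsupp.coe_finsetSum,
      Finset.sum_apply]
    by_cases hm : s.coeff m = 0
    · rw [hm, ite_self, Finset.sum_eq_zero]
      intro p hp
      have : p ≠ m := by rintro rfl; exact Finsupp.mem_support_iff.1 hp hm
      split_ifs <;> simp [this]
    · rw [Finset.sum_eq_single m]
      · split_ifs <;> simp
      · intro p _ hp
        split_ifs <;> simp [hp]
      · intro h
        exact absurd (Finsupp.mem_support_iff.2 hm) h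
  rw [slice_moved_mul, h, Finset.sum_mul, Finsupp.sum]
  refine Finset.sum_congr rfl fun p hp => ?_
  split_ifs with hpW
  · rw [hpW, sub_add_cancel]
  · rw [hg, mul_zero, zero_mul]
    have := lt_of_le_of_ne (hW p (Finsupp.mem_support_iff.1 hp)) hpW
    linarith

theorem pairing_mem {Γ : AddSubgroup ℝ} {l : Fin n → ℝ} (hΓ : ∀ i, l i ∈ Γ) (p : Fin n → ℤ) :
    toReal p ⬝ᵥ l ∈ Γ := by
  refine Γ.sum_mem fun i _ => ?_
  have := Γ.zsmul_mem (hΓ i) (p i)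
  rwa [zsmul_eq_mul] at this

theorem moved_mem_familySections {Γ : AddSubgroup ℝ} {l : Fin n → ℝ} (hΓ : ∀ i, l i ∈ Γ) {W : ℝ}
    {s : Laurent n} (hW : ∀ p, s.coeff p ≠ 0 → toReal p ⬝ᵥ l ≤ W) {R : Set (Fin n → ℝ)} {k : ℤ}
    (hs : s ∈ localSections R k) :
    moved l s ∈ familySections R k {γ | γ ∈ Γ ∧ -W ≤ γ} := by
  have hinj : Function.Injective (fun m : Fin n → ℤ => (m, -(toReal m ⬝ᵥ l))) :=
    fun a b h => (Prod.mk.inj h).1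
  rw [mem_familySections]
  intro m γ h
  have hr : (m, γ) ∈ Set.range (fun m : Fin n → ℤ => (m, -(toReal m ⬝ᵥ l))) := by
    by_contra hr
    exact h (Finsupp.mapDomain_of_notMem_range _ _ hr)
  obtain ⟨p, hp⟩ := hr
  have h1 : p = m := (Prod.mk.inj hp).1
  have h2 : -(toReal p ⬝ᵥ l) = γ := (Prod.mk.inj hp).2
  subst h1
  rw [← hp] at h
  have hne : s.coeff p ≠ 0 := by
    intro h0
    exact h ((Finsupp.mapDomain_apply hinj s.coeff p).trans h0)
  subst h2
  exact ⟨mem_localSections.1 hs p hne, Γ.neg_mem (pairing_mem hΓ p), neg_le_neg (hW p hne)⟩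

/-- Over a chart where `s` is a regular section of `K_X^{-1}`, the central fibre is the
divisor of the initial form of `s`. -/
theorem centralIdeal_eq {Γ : AddSubgroup ℝ} {l : Fin n → ℝ} (hΓ : ∀ i, l i ∈ Γ) {W : ℝ}
    (hWΓ : W ∈ Γ) {s : Laurent n} (hW : ∀ p, s.coeff p ≠ 0 → toReal p ⬝ᵥ l ≤ W)
    (h0 : initialForm l W s ≠ 0) {R : Set (Fin n → ℝ)} (hs : s ∈ localSections R 1) :
    centralIdeal Γ l s R
      = (localSections R (-1)).map (LinearMap.mulLeft ℂ (initialForm l W s)) := by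
  apply le_antisymm
  · rintro _ ⟨F, ⟨hF, g, hg, rfl⟩, rfl⟩
    rw [LinearMap.mulLeft_apply] at hF
    -- A term of g below t^W of lowest order, multiplied by the nonzero initial form, would leave a
    -- negative power of t in the product, as Laurent polynomials form a domain.
    have hlow : ∀ γ < W, slice γ g = 0 := by
      by_contra! hcon
      let S : Set ℝ := {γ | slice γ g ≠ 0}
      have hS : S.Finite := by
        refine (g.coeff.support.finite_toSet.image Prod.snd).subset fun γ hγ => ?_
        have : ∃ m, (slice γ g).coeff m ≠ 0 := by
          by_contra! h
          exact hγ (by ext m; simpa using h m)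
        obtain ⟨m, hm⟩ := this
        exact ⟨(m, γ), Finsupp.mem_support_iff.2 hm, rfl⟩
      obtain ⟨γ₁, hγ₁, hne⟩ := hcon
      obtain ⟨γ, hγS, hmin⟩ := S.exists_min_image id hS ⟨γ₁, hne⟩
      have hγW : γ < W := (hmin γ₁ hne).trans_lt hγ₁
      have hsl := slice_moved_mul_of_lowest hW (g := g) (γ := γ) fun γ' hγ' => by
        by_contra h
        exact absurd (hmin γ' h) (not_le.2 hγ')
      have hne0 : initialForm l W s * slice γ g ≠ 0 := mul_ne_zero h0 hγS
      rw [← hsl] at hne0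
      refine hne0 ?_
      ext m
      by_contra h
      have := ((mem_familySections.1 hF) m (γ - W) h).2.2
      linarith
    refine ⟨slice W g, mem_localSections.2 fun m hm => (mem_familySections.1 hg m W hm).1, ?_⟩
    rw [slice_zero_eq, LinearMap.mulLeft_apply, LinearMap.mulLeft_apply,
      ← slice_moved_mul_of_lowest hW hlow, sub_self]
  · rintro _ ⟨f, hf, rfl⟩
    -- G = t^W f, the factor t^W just clearing the pole of `moved l s` at t = 0.
    let G : LaurentT n := AddMonoidAlgebra.mapDomain (fun m => (m, W)) f
    have hinj : Function.Injective (fun m : Fin n → ℤ => (m, W)) := Prod.mk_left_injective W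
    have hG : ∀ m γ, G.coeff (m, γ) = if γ = W then f.coeff m else 0 := by
      intro m γ
      split_ifs with h
      · subst h
        exact Finsupp.mapDomain_apply hinj f.coeff m
      · refine Finsupp.mapDomain_of_notMem_range _ _ ?_
        rintro ⟨p, hp⟩
        exact h (Prod.mk.inj hp).2.symm
    have hGmem : ∀ T : Set ℝ, W ∈ T → G ∈ familySections R (-1) T := by
      intro T hT
      rw [mem_familySections]
      intro m γ h
      rw [hG] at h
      split_ifs at h with hγ
      · exact ⟨mem_localSections.1 hf m h, hγ ▸ hT⟩
      · exact absurd rfl h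
    refine ⟨moved l s * G, ⟨?_, G, hGmem _ hWΓ, rfl⟩, ?_⟩
    · have := Submodule.mul_mem_mul (moved_mem_familySections hΓ hW hs)
        (hGmem {γ | γ ∈ Γ ∧ W ≤ γ} ⟨hWΓ, le_refl W⟩)
      have hle := familySections_mul_le R 1 (-1) (T := {γ | γ ∈ Γ ∧ -W ≤ γ})
        (T' := {γ | γ ∈ Γ ∧ W ≤ γ}) (T'' := {γ | γ ∈ Γ ∧ 0 ≤ γ}) (by
          rintro a ⟨ha, ha'⟩ b ⟨hb, hb'⟩
          exact ⟨Γ.add_mem ha hb, by linarith⟩)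
      rw [add_neg_cancel] at hle
      exact hle this
    · have hlow : ∀ γ < W, slice γ G = 0 := by
        intro γ hγ
        ext m
        rw [coeff_slice, hG, if_neg hγ.ne]
        rfl
      have hWsl : slice W G = f := by
        ext m
        rw [coeff_slice, hG, if_pos rfl]
      rw [slice_zero_eq, LinearMap.mulLeft_apply, ← sub_self W,
        slice_moved_mul_of_lowest hW hlow, hWsl]

theorem map_mulLeft_mul (a : Laurent n) (A B : Submodule ℂ (Laurent n)) :
    A.map (LinearMap.mulLeft ℂ a) * B = (A * B).map (LinearMap.mulLeft ℂ a) := by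
  apply le_antisymm
  · refine Submodule.mul_le.2 ?_
    rintro _ ⟨x, hx, rfl⟩ y hy
    exact ⟨x * y, Submodule.mul_mem_mul hx hy, by simp [mul_assoc]⟩
  · rw [Submodule.map_le_iff_le_comap]
    refine Submodule.mul_le.2 fun x hx y hy => ?_
    rw [Submodule.mem_comap, LinearMap.mulLeft_apply, ← mul_assoc]
    exact Submodule.mul_mem_mul ⟨x, hx, rfl⟩ hy

theorem vanishing_centralIdeal {Γ : AddSubgroup ℝ} {l : Fin n → ℝ} (hΓ : ∀ i, l i ∈ Γ) {W : ℝ}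
    (hWΓ : W ∈ Γ) {s : Laurent n} (hW : ∀ p, s.coeff p ≠ 0 → toReal p ⬝ᵥ l ≤ W)
    (h0 : initialForm l W s ≠ 0) {R : Set (Fin n → ℝ)} (hs : s ∈ localSections R 1)
    {v : Fin n → ℤ} (hv : ∀ u ∈ R, u ⬝ᵥ toReal v = -1) (k : ℤ) :
    vanishing (centralIdeal Γ l s) k R
      = (localSections R (k - 1)).map (LinearMap.mulLeft ℂ (initialForm l W s)) := by
  rw [vanishing, centralIdeal_eq hΓ hWΓ hW h0 hs, map_mulLeft_mul, localSections_mul hv,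
    neg_add_eq_sub]

end ToricFano

namespace ToricFano

/-! ### Determinants in exact sequences -/

/-- Determinants multiply over an invariant subspace and its quotient. The scalar c allows ι to be
equivariant only up to a character, as multiplication by an eigensection is. -/
theorem det_exact {U V H : Type*} [AddCommGroup U] [Module ℂ U] [AddCommGroup V] [Module ℂ V]
    [AddCommGroup H] [Module ℂ H] [Module.Finite ℂ V] {ι : U →ₗ[ℂ] V} {φ : V →ₗ[ℂ] H}
    (hι : Function.Injective ι) (hφ : Function.Surjective φ) (hex : φ.ker = ι.range)
    {a : U →ₗ[ℂ] U} {b : V →ₗ[ℂ] V} {d : H →ₗ[ℂ] H} {c : ℂ}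
    (hab : ∀ x, b (ι x) = c • ι (a x)) (hbd : ∀ x, d (φ x) = φ (b x)) :
    c ^ Module.finrank ℂ U * LinearMap.det a * LinearMap.det d = LinearMap.det b := by
  have hle : φ.ker ≤ φ.ker.comap b := by
    intro x hx
    rw [Submodule.mem_comap, LinearMap.mem_ker, ← hbd, LinearMap.mem_ker.1 hx, map_zero]
  let e : U ≃ₗ[ℂ] φ.ker := (LinearEquiv.ofInjective ι hι).trans (LinearEquiv.ofEq _ _ hex.symm)
  have he : ∀ x, (e x : V) = ι x := fun x => rfl
  have h1 : b.restrict hle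
      = (e : U →ₗ[ℂ] φ.ker) ∘ₗ (c • a) ∘ₗ (e.symm : φ.ker →ₗ[ℂ] U) := by
    ext1 x
    obtain ⟨x, rfl⟩ := e.surjective x
    apply Subtype.ext
    simp only [LinearMap.comp_apply, LinearEquiv.coe_coe, LinearEquiv.symm_apply_apply]
    rw [he, LinearMap.coe_restrict_apply, he, hab, LinearMap.smul_apply, map_smul]
  have h2 : d = (φ.quotKerEquivOfSurjective hφ) ∘ₗ φ.ker.mapQ φ.ker b hle ∘ₗ
      (φ.quotKerEquivOfSurjective hφ).symm := by
    ext1 x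
    obtain ⟨x, rfl⟩ := (φ.quotKerEquivOfSurjective hφ).surjective x
    obtain ⟨x, rfl⟩ := Submodule.mkQ_surjective _ x
    rw [LinearMap.comp_apply, LinearMap.comp_apply, LinearEquiv.coe_coe, LinearEquiv.coe_coe,
      LinearEquiv.symm_apply_apply]
    exact hbd x
  rw [LinearMap.det_eq_det_mul_det φ.ker b hle, h1, LinearMap.det_conj, LinearMap.det_smul, h2,
    LinearMap.det_conj]

theorem finrank_exact {U V H : Type*} [AddCommGroup U] [Module ℂ U] [AddCommGroup V] [Module ℂ V]
    [AddCommGroup H] [Module ℂ H] [Module.Finite ℂ V] {ι : U →ₗ[ℂ] V} {φ : V →ₗ[ℂ] H}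
    (hι : Function.Injective ι) (hφ : Function.Surjective φ) (hex : φ.ker = ι.range) :
    Module.finrank ℂ H + Module.finrank ℂ U = Module.finrank ℂ V := by
  rw [← φ.ker.finrank_quotient_add_finrank, (φ.quotKerEquivOfSurjective hφ).finrank_eq, hex,
    (LinearEquiv.ofInjective ι hι).finrank_eq]

/-! ### Global sections -/

variable {n : ℕ}

/-- The exponents of the monomial global sections of `K_X^{-k}`: the lattice points of `k P`. -/
def latticePoints (P : Set (Fin n → ℝ)) (k : ℤ) : Set (Fin n → ℤ) :=
  {m | ∀ u ∈ (polarDual P).extremePoints ℝ, -(k : ℝ) ≤ u ⬝ᵥ toReal m}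

/-- The global sections of `K_X^{-k}`. -/
noncomputable abbrev globalSections (P : Set (Fin n → ℝ)) (k : ℤ) : Submodule ℂ (Laurent n) :=
  localSections ((polarDual P).extremePoints ℝ) k

theorem mem_globalSections {P : Set (Fin n → ℝ)} {k : ℤ} {f : Laurent n} :
    f ∈ globalSections P k ↔ ∀ m, f.coeff m ≠ 0 → m ∈ latticePoints P k :=
  mem_localSections

theorem rays_subset (P : Set (Fin n → ℝ)) (v : Fin n → ℝ) :
    rays P v ⊆ (polarDual P).extremePoints ℝ := fun _ hu => hu.1

theorem IsReflexive.mem_globalSections_iff {P : Set (Fin n → ℝ)} (hP : IsReflexive P) (hn : 1 ≤ n)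
    {k : ℤ} {f : Laurent n} :
    f ∈ globalSections P k ↔ ∀ v : Vertex P, f ∈ localSections (rays P v) k := by
  refine ⟨fun h v => localSections_anti (rays_subset P v) k h, fun h => ?_⟩
  rw [mem_localSections]
  intro m hm u hu
  obtain ⟨v, hv⟩ := hP.exists_vertex_of_ray hn hu
  exact mem_localSections.1 (h v) m hm u hv

theorem IsReflexive.finite_latticePoints {P : Set (Fin n → ℝ)} (hP : IsReflexive P) (k : ℤ) :
    (latticePoints P k).Finite := by
  -- Dilation by |k| + 1 is positive for every integer k, so k ≤ 0 needs no separate case.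
  have hpos : (0 : ℝ) < |(k : ℝ)| + 1 := by positivity
  refine (finite_toReal_preimage (hP.lattice.isCompact.isBounded.smul₀ (|(k : ℝ)| + 1))).subset
    fun m hm => ?_
  refine ⟨(|(k : ℝ)| + 1)⁻¹ • toReal m, (hP.inv_smul_mem_iff hpos).2 fun u hu => ?_, ?_⟩
  · have := hm u hu
    linarith [le_abs_self (k : ℝ)]
  · simp only
    rw [smul_smul, mul_inv_cancel₀ hpos.ne', one_smul]

/-- A global section of `K_X^{-k}` restricted to a closed subscheme. -/
noncomputable def toH0 (P : Set (Fin n → ℝ)) (I : Set (Fin n → ℝ) → Submodule ℂ (Laurent n))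
    (k : ℤ) : ↥(globalSections P k) →ₗ[ℂ] H0 P I k :=
  Submodule.mkQ _ ∘ₗ LinearMap.codRestrict (compatible P I k)
    ((LinearMap.pi fun _ : Vertex P => LinearMap.id) ∘ₗ (globalSections P k).subtype) (by
      intro f
      simp only [compatible, Submodule.mem_inf, Submodule.mem_pi, Submodule.mem_iInf]
      refine ⟨fun v _ => localSections_anti (rays_subset P v) k f.2, fun v w => ?_⟩
      simp)

theorem toH0_eq_iff {P : Set (Fin n → ℝ)} {I : Set (Fin n → ℝ) → Submodule ℂ (Laurent n)} {k : ℤ}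
    (f : globalSections P k) (F : compatible P I k) :
    toH0 P I k f = Submodule.Quotient.mk F ↔
      ∀ v : Vertex P, (f : Laurent n) - (F : Vertex P → Laurent n) v ∈ vanishing I k (rays P v) := by
  rw [toH0, LinearMap.comp_apply, Submodule.mkQ_apply, Submodule.Quotient.eq]
  simp [Submodule.submoduleOf, vanishingFamilies, Submodule.mem_pi]

theorem mem_ker_toH0 {P : Set (Fin n → ℝ)} {I : Set (Fin n → ℝ) → Submodule ℂ (Laurent n)} {k : ℤ}
    (f : globalSections P k) :
    f ∈ (toH0 P I k).ker ↔ ∀ v : Vertex P, (f : Laurent n) ∈ vanishing I k (rays P v) := by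
  have := toH0_eq_iff f (0 : compatible P I k)
  rw [Submodule.Quotient.mk_zero] at this
  rw [LinearMap.mem_ker, this]
  simp

/-- The action on global sections. -/
noncomputable def actSections (P : Set (Fin n → ℝ)) (l : Fin n → ℝ) (k : ℤ) (τ : ℂ) :
    ↥(globalSections P k) →ₗ[ℂ] ↥(globalSections P k) :=
  (act l τ).toLinearMap.restrict fun _ hf => act_mem_localSections l τ _ k hf

theorem coe_actSections (P : Set (Fin n → ℝ)) (l : Fin n → ℝ) (k : ℤ) (τ : ℂ)
    (f : globalSections P k) : (actSections P l k τ f : Laurent n) = act l τ f := rfl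

theorem actH0_toH0 {P : Set (Fin n → ℝ)} {l : Fin n → ℝ}
    {I : Set (Fin n → ℝ) → Submodule ℂ (Laurent n)} (hI : IsInvariant l I) (k : ℤ) (τ : ℂ)
    (f : globalSections P k) :
    actH0 P hI k τ (toH0 P I k f) = toH0 P I k (actSections P l k τ f) := rfl

theorem coeff_act (l : Fin n → ℝ) (τ : ℂ) (f : Laurent n) (m : Fin n → ℤ) :
    (act l τ f).coeff m = f.coeff m * Complex.exp (-τ * ((toReal m ⬝ᵥ l : ℝ) : ℂ)) := by
  classical
  induction f using AddMonoidAlgebra.induction_linear with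
  | zero => simp
  | add f g hf hg =>
    rw [map_add, AddMonoidAlgebra.coeff_add, AddMonoidAlgebra.coeff_add, Finsupp.add_apply,
      Finsupp.add_apply, hf, hg, add_mul]
  | single p c =>
    rw [act_single, AddMonoidAlgebra.coeff_single, AddMonoidAlgebra.coeff_single,
      Finsupp.single_apply, Finsupp.single_apply]
    split_ifs with h
    · rw [h]
    · rw [zero_mul]

/-- The basis of monomials. -/
noncomputable def monomialBasis (P : Set (Fin n → ℝ)) (k : ℤ) [Fintype (latticePoints P k)] :
    Module.Basis (latticePoints P k) ℂ (globalSections P k) :=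
  Module.Basis.ofEquivFun
    { toFun := fun f m => (f : Laurent n).coeff m
      map_add' := fun _ _ => rfl
      map_smul' := fun _ _ => rfl
      invFun := fun c => ⟨∑ m : latticePoints P k, AddMonoidAlgebra.single (m : Fin n → ℤ) (c m), by
        classical
        refine Submodule.sum_mem _ fun m _ => mem_globalSections.2 fun p hp => ?_
        rw [AddMonoidAlgebra.coeff_single] at hp
        rw [(Finsupp.single_apply_ne_zero.1 hp).1]
        exact m.2⟩
      left_inv := fun f => by
        classical
        ext p
        simp only [AddMonoidAlgebra.coeff_sum, Finsupp.coe_finsetSum, Finset.sum_apply,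
          AddMonoidAlgebra.coeff_single, Finsupp.single_apply]
        by_cases hp : p ∈ latticePoints P k
        · rw [Finset.sum_eq_single ⟨p, hp⟩]
          · simp
          · intro m _ hm
            rw [if_neg fun h => hm (Subtype.ext h)]
          · simp
        · rw [Finset.sum_eq_zero]
          · by_contra h
            exact hp (mem_globalSections.1 f.2 p (Ne.symm h))
          · intro m _
            rw [if_neg]
            rintro rfl
            exact hp m.2
      right_inv := fun c => by
        classical
        ext p
        simp only [AddMonoidAlgebra.coeff_sum, Finsupp.coe_finsetSum, Finset.sum_apply,
          AddMonoidAlgebra.coeff_single, Finsupp.single_apply]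
        rw [Finset.sum_eq_single p]
        · simp
        · intro m _ hm
          rw [if_neg fun h => hm (Subtype.ext h)]
        · simp }

theorem monomialBasis_repr (P : Set (Fin n → ℝ)) (k : ℤ) [Fintype (latticePoints P k)]
    (f : globalSections P k) (m : latticePoints P k) :
    (monomialBasis P k).repr f m = (f : Laurent n).coeff m := rfl

theorem IsReflexive.finite_globalSections {P : Set (Fin n → ℝ)} (hP : IsReflexive P) (k : ℤ) :
    Module.Finite ℂ (globalSections P k) := by
  have := (hP.finite_latticePoints k).fintype
  exact Module.Finite.of_basis (monomialBasis P k)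

/-- The number of lattice points of `k P`. -/
noncomputable def latticeCount (P : Set (Fin n → ℝ)) (k : ℤ) : ℝ :=
  ∑ᶠ m ∈ latticePoints P k, (1 : ℝ)

/-- The sum of the pairings with `l` of the lattice points of `k P`. -/
noncomputable def latticeMoment (P : Set (Fin n → ℝ)) (l : Fin n → ℝ) (k : ℤ) : ℝ :=
  ∑ᶠ m ∈ latticePoints P k, toReal m ⬝ᵥ l

theorem IsReflexive.finrank_globalSections {P : Set (Fin n → ℝ)} (hP : IsReflexive P) (k : ℤ) :
    (Module.finrank ℂ (globalSections P k) : ℝ) = latticeCount P k := by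
  have := (hP.finite_latticePoints k).fintype
  rw [Module.finrank_eq_card_basis (monomialBasis P k), latticeCount,
    finsum_mem_eq_finite_toFinset_sum _ (hP.finite_latticePoints k), Finset.sum_const,
    nsmul_eq_mul, mul_one, ← Set.ncard_eq_toFinset_card _ (hP.finite_latticePoints k),
    ← Nat.card_coe_set_eq, Nat.card_eq_fintype_card]

theorem IsReflexive.det_actSections {P : Set (Fin n → ℝ)} (hP : IsReflexive P) (l : Fin n → ℝ)
    (k : ℤ) (τ : ℂ) :
    LinearMap.det (actSections P l k τ) = Complex.exp (-τ * (latticeMoment P l k : ℂ)) := by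
  classical
  have := (hP.finite_latticePoints k).fintype
  have hmat : LinearMap.toMatrix (monomialBasis P k) (monomialBasis P k) (actSections P l k τ)
      = Matrix.diagonal fun m : latticePoints P k =>
        Complex.exp (-τ * ((toReal (m : Fin n → ℤ) ⬝ᵥ l : ℝ) : ℂ)) := by
    ext i j
    rw [LinearMap.toMatrix_apply, monomialBasis_repr, coe_actSections, coeff_act,
      ← monomialBasis_repr, Module.Basis.repr_self, Matrix.diagonal_apply, Finsupp.single_apply]
    split_ifs with h1 h2 h2
    · rw [one_mul]
    · exact absurd h1.symm h2
    · exact absurd h2.symm h1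
    · rw [zero_mul]
  rw [← LinearMap.det_toMatrix (monomialBasis P k), hmat, Matrix.det_diagonal, ← Complex.exp_sum,
    ← Finset.mul_sum, latticeMoment, ← finsum_set_coe_eq_finsum_mem, finsum_eq_sum_of_fintype]
  push_cast
  rfl

theorem IsReflexive.finite_H0 {P : Set (Fin n → ℝ)} (hP : IsReflexive P)
    {I : Set (Fin n → ℝ) → Submodule ℂ (Laurent n)} {k : ℤ}
    (hsurj : Function.Surjective (toH0 P I k)) : Module.Finite ℂ (H0 P I k) := by
  have := hP.finite_globalSections k
  exact Module.Finite.of_surjective _ hsurj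

/-! ### Sections on `X` -/

theorem IsReflexive.toH0_zeroIdeal_surjective {P : Set (Fin n → ℝ)} (hP : IsReflexive P)
    (hn : 1 ≤ n) (k : ℤ) : Function.Surjective (toH0 P (zeroIdeal n) k) := by
  intro x
  obtain ⟨F, rfl⟩ := Submodule.mkQ_surjective _ x
  obtain ⟨v₀⟩ := hP.nonempty_vertex
  have hF := F.2
  simp only [compatible, Submodule.mem_inf, Submodule.mem_pi, Set.mem_univ, forall_const,
    Submodule.mem_iInf, Submodule.mem_comap, LinearMap.sub_apply, LinearMap.proj_apply, vanishing,
    zeroIdeal, Submodule.bot_mul, Submodule.mem_bot, sub_eq_zero] at hF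
  refine ⟨⟨(F : Vertex P → Laurent n) v₀, (hP.mem_globalSections_iff hn).2 fun v => ?_⟩, ?_⟩
  · rw [hF.2 v₀ v]; exact hF.1 v
  · refine (toH0_eq_iff _ F).2 fun v => ?_
    have h : (F : Vertex P → Laurent n) v₀ - (F : Vertex P → Laurent n) v = 0 :=
      sub_eq_zero.2 (hF.2 v₀ v)
    exact h ▸ Submodule.zero_mem _

theorem IsReflexive.ker_toH0_zeroIdeal {P : Set (Fin n → ℝ)} (hP : IsReflexive P) (k : ℤ) :
    (toH0 P (zeroIdeal n) k).ker = ⊥ := by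
  rw [eq_bot_iff]
  intro f hf
  obtain ⟨v₀⟩ := hP.nonempty_vertex
  have := (mem_ker_toH0 f).1 hf v₀
  rw [vanishing, zeroIdeal, Submodule.bot_mul, Submodule.mem_bot] at this
  exact (Submodule.mem_bot ℂ).2 (Subtype.ext this)

theorem IsReflexive.isWeight_zeroIdeal {P : Set (Fin n → ℝ)} (hP : IsReflexive P) (hn : 1 ≤ n)
    (l : Fin n → ℝ) (k : ℤ) :
    IsWeight P (zeroIdeal_invariant l) k (-latticeMoment P l k) := by
  have hs := hP.toH0_zeroIdeal_surjective hn k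
  have := hP.finite_globalSections k
  refine ⟨hP.finite_H0 hs, fun τ => ?_⟩
  -- Restriction to X itself has zero kernel, so the subspace in the exact sequence is trivial.
  have h := det_exact (U := PUnit) (ι := 0) (a := 0) (c := 1) (Function.injective_of_subsingleton _)
    hs ((hP.ker_toH0_zeroIdeal k).trans LinearMap.range_zero.symm) (b := actSections P l k τ)
    (by simp) (actH0_toH0 (zeroIdeal_invariant l) k τ)
  rw [LinearMap.det_eq_one_of_subsingleton, one_pow, one_mul, one_mul, hP.det_actSections] at h
  rw [h]
  push_cast
  ring_nf

theorem IsReflexive.finrank_H0_zeroIdeal {P : Set (Fin n → ℝ)} (hP : IsReflexive P) (hn : 1 ≤ n)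
    (k : ℤ) : (Module.finrank ℂ (H0 P (zeroIdeal n) k) : ℝ) = latticeCount P k := by
  have := hP.finite_globalSections k
  have h := finrank_exact (U := PUnit) (ι := 0) (Function.injective_of_subsingleton _)
    (hP.toH0_zeroIdeal_surjective hn k)
    ((hP.ker_toH0_zeroIdeal k).trans LinearMap.range_zero.symm)
  rw [← hP.finrank_globalSections, ← h, Module.finrank_zero_of_subsingleton (M := PUnit), add_zero]

/-! ### Sections on a divisor -/

/-- The vanishing of the first cohomology of `K_X^{-j}`, `j ≥ 0`: a family of Laurent polynomials
whose differences are regular on the overlaps differs by a constant family from a family of local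
sections. -/
theorem IsReflexive.exists_splitting {P : Set (Fin n → ℝ)} (hP : IsReflexive P) {j : ℤ}
    (hj : 0 ≤ j) (g : Vertex P → Laurent n)
    (hg : ∀ v w : Vertex P, g v - g w ∈ localSections (rays P v ∩ rays P w) j) :
    ∃ κ : Laurent n, ∀ v : Vertex P, g v - κ ∈ localSections (rays P v) j := by
  classical
  have := hP.finite_vertex
  -- Work monomial by monomial. If z^m is not regular on the chart of v, then κ must have the same
  -- coefficient at m as g v. By `IsReflexive.eq_of_visible` all such charts prescribe the same
  -- value.
  let bad : (Fin n → ℤ) → Vertex P → Prop := fun m v => ∃ u ∈ rays P v, u ⬝ᵥ toReal m < -(j : ℝ)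
  have hbad : ∀ m v w, bad m v → bad m w → (g v).coeff m = (g w).coeff m := by
    intro m v w hv hw
    refine hP.eq_of_visible (fun v => (g v).coeff m) (x := toReal m) (j := j)
      (by exact_mod_cast hj) ?_ hv hw
    rintro v w ⟨u, hu, hlt⟩
    by_contra hne
    have h := mem_localSections.1 (hg v w) m
      (by rw [AddMonoidAlgebra.coeff_sub]; exact sub_ne_zero.2 hne) u hu
    linarith
  -- Where every chart is regular the coefficient is free; the default 0 keeps the support finite.
  let c : (Fin n → ℤ) → ℂ := fun m => if h : ∃ v, bad m v then (g h.choose).coeff m else 0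
  have hc : ∀ m v, bad m v → c m = (g v).coeff m := by
    intro m v hv
    have h : ∃ v, bad m v := ⟨v, hv⟩
    simp only [c, dif_pos h]
    exact hbad m _ v h.choose_spec hv
  have hfin : (Function.support c).Finite := by
    refine (Set.finite_iUnion fun v : Vertex P => (g v).coeff.support.finite_toSet).subset ?_
    intro m hm
    have h : ∃ v, bad m v := by
      by_contra h
      exact hm (dif_neg h)
    obtain ⟨v, hv⟩ := h
    rw [Function.mem_support, hc m v hv] at hm
    exact Set.mem_iUnion.2 ⟨v, Finsupp.mem_support_iff.2 hm⟩
  refine ⟨.ofCoeff (Finsupp.ofSupportFinite c hfin), fun v => mem_localSections.2 fun m hm u hu => ?_⟩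
  by_contra! hlt
  refine hm ?_
  have : c m = (g v).coeff m := hc m v ⟨u, hu, hlt⟩
  rw [AddMonoidAlgebra.coeff_sub, Finsupp.sub_apply, ← this]
  exact sub_self _

section Divisor

variable {P : Set (Fin n → ℝ)} {I : Set (Fin n → ℝ) → Submodule ℂ (Laurent n)} {k : ℤ}
  {s₀ : Laurent n}

/-- On overlaps the local lifts differ by s₀ · G v w, where s₀ can be cancelled, so G is a cocycle
for K_X^{-(k-1)}. Splitting it, possible as k - 1 ≥ 0, corrects the lifts by multiples of s₀ into
one global section. -/
theorem IsReflexive.toH0_surjective_of_divisor (hP : IsReflexive P) (hn : 1 ≤ n) (hk : 1 ≤ k)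
    (h0 : s₀ ≠ 0) (hs₀ : s₀ ∈ globalSections P 1)
    (hI : ∀ v w : Vertex P, vanishing I k (rays P v ∩ rays P w)
      = (localSections (rays P v ∩ rays P w) (k - 1)).map (LinearMap.mulLeft ℂ s₀)) :
    Function.Surjective (toH0 P I k) := by
  intro x
  obtain ⟨F, rfl⟩ := Submodule.mkQ_surjective _ x
  obtain ⟨v₀⟩ := hP.nonempty_vertex
  have hF := F.2
  simp only [compatible, Submodule.mem_inf, Submodule.mem_pi, Set.mem_univ, forall_const,
    Submodule.mem_iInf, Submodule.mem_comap, LinearMap.sub_apply, LinearMap.proj_apply, hI,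
    Submodule.mem_map, LinearMap.mulLeft_apply] at hF
  obtain ⟨hF1, hF2⟩ := hF
  choose G hG hGF using hF2
  have hcocycle : ∀ v w, G v v₀ - G w v₀ = G v w := by
    intro v w
    apply mul_left_cancel₀ h0
    rw [mul_sub, hGF, hGF, hGF]
    abel
  obtain ⟨κ, hκ⟩ := hP.exists_splitting (j := k - 1) (by omega) (fun v => G v v₀)
    fun v w => by rw [hcocycle]; exact hG v w
  have hdiff : ∀ v, (F : Vertex P → Laurent n) v₀ + s₀ * κ
      = (F : Vertex P → Laurent n) v - s₀ * (G v v₀ - κ) := by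
    intro v
    rw [mul_sub, hGF]
    abel
  have hmul : ∀ v : Vertex P, s₀ * (G v v₀ - κ) ∈ localSections (rays P v) k := by
    intro v
    have := localSections_mul_le (rays P v) 1 (k - 1)
      (Submodule.mul_mem_mul (localSections_anti (rays_subset P v) 1 hs₀) (hκ v))
    rwa [add_sub_cancel] at this
  refine ⟨⟨(F : Vertex P → Laurent n) v₀ + s₀ * κ, (hP.mem_globalSections_iff hn).2 fun v => ?_⟩,
    (toH0_eq_iff _ F).2 fun v => ?_⟩
  · rw [hdiff v]
    exact Submodule.sub_mem _ (hF1 v) (hmul v)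
  · have hv := hI v v
    rw [Set.inter_self] at hv
    rw [hv]
    refine ⟨-(G v v₀ - κ), Submodule.neg_mem _ (hκ v), ?_⟩
    simp only [LinearMap.mulLeft_apply]
    rw [hdiff v]
    ring

/-- Multiplication by a section of `K_X^{-1}`. -/
noncomputable def mulSection (hs₀ : s₀ ∈ globalSections P 1) (k : ℤ) :
    ↥(globalSections P (k - 1)) →ₗ[ℂ] ↥(globalSections P k) :=
  (LinearMap.mulLeft ℂ s₀).restrict fun f hf => by
    have := localSections_mul_le _ 1 (k - 1) (Submodule.mul_mem_mul hs₀ hf)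
    rwa [add_sub_cancel] at this

theorem coe_mulSection (hs₀ : s₀ ∈ globalSections P 1) (k : ℤ) (f : globalSections P (k - 1)) :
    (mulSection hs₀ k f : Laurent n) = s₀ * f := rfl

theorem mulSection_injective (h0 : s₀ ≠ 0) (hs₀ : s₀ ∈ globalSections P 1) (k : ℤ) :
    Function.Injective (mulSection hs₀ k) := fun _ _ h =>
  Subtype.ext (mul_left_cancel₀ h0 (congrArg Subtype.val h))

/-- The local quotients of f by s₀ are the same Laurent polynomial on all charts, because s₀ can be
cancelled; so the quotient is a global section. -/
theorem IsReflexive.ker_toH0_of_divisor (hP : IsReflexive P) (hn : 1 ≤ n)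
    (h0 : s₀ ≠ 0) (hs₀ : s₀ ∈ globalSections P 1)
    (hI : ∀ v : Vertex P, vanishing I k (rays P v)
      = (localSections (rays P v) (k - 1)).map (LinearMap.mulLeft ℂ s₀)) :
    (toH0 P I k).ker = (mulSection hs₀ k).range := by
  ext f
  rw [mem_ker_toH0]
  constructor
  · intro h
    obtain ⟨v₀⟩ := hP.nonempty_vertex
    simp only [hI, Submodule.mem_map, LinearMap.mulLeft_apply] at h
    choose G hG hGf using h
    have hconst : ∀ v, G v₀ = G v := fun v => mul_left_cancel₀ h0 ((hGf v₀).trans (hGf v).symm)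
    refine ⟨⟨G v₀, (hP.mem_globalSections_iff hn).2 fun v => ?_⟩, Subtype.ext (hGf v₀)⟩
    rw [hconst v]
    exact hG v
  · rintro ⟨g, rfl⟩ v
    rw [hI]
    exact ⟨g, localSections_anti (rays_subset P v) _ g.2, rfl⟩

/-- Take determinants and dimensions in the exact sequence given by multiplication by s₀. Since t
acts on s₀ by t^{-W}, the image of the sections of K_X^{-(k-1)} carries an extra weight -W per
dimension. -/
theorem IsReflexive.isWeight_of_divisor (hP : IsReflexive P) (hn : 1 ≤ n) (hk : 1 ≤ k)
    {l : Fin n → ℝ} (hinv : IsInvariant l I) {W : ℝ} (h0 : s₀ ≠ 0)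
    (hs₀ : s₀ ∈ globalSections P 1) (hW : ∀ p, s₀.coeff p ≠ 0 → toReal p ⬝ᵥ l = W)
    (hI : ∀ v w : Vertex P, vanishing I k (rays P v ∩ rays P w)
      = (localSections (rays P v ∩ rays P w) (k - 1)).map (LinearMap.mulLeft ℂ s₀)) :
    IsWeight P hinv k (-latticeMoment P l k + latticeMoment P l (k - 1)
        + W * latticeCount P (k - 1)) ∧
      (Module.finrank ℂ (H0 P I k) : ℝ) = latticeCount P k - latticeCount P (k - 1) := by
  have hs := hP.toH0_surjective_of_divisor hn hk h0 hs₀ hI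
  have hker := hP.ker_toH0_of_divisor (I := I) (k := k) hn h0 hs₀ fun v => by
    have := hI v v
    rwa [Set.inter_self] at this
  have := hP.finite_globalSections k
  refine ⟨⟨hP.finite_H0 hs, fun τ => ?_⟩, ?_⟩
  · have hact : act l τ s₀ = Complex.exp (-τ * (W : ℂ)) • s₀ := by
      ext m
      rw [coeff_act, AddMonoidAlgebra.coeff_smul_apply, smul_eq_mul, mul_comm]
      by_cases hm : s₀.coeff m = 0
      · rw [hm, mul_zero, mul_zero]
      · rw [hW m hm]
    have h := det_exact (mulSection_injective h0 hs₀ k) hs hker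
      (a := actSections P l (k - 1) τ) (b := actSections P l k τ)
      (c := Complex.exp (-τ * (W : ℂ))) (fun f => Subtype.ext (by
        rw [coe_actSections, coe_mulSection, map_mul, hact, Submodule.coe_smul, coe_mulSection,
          coe_actSections, smul_mul_assoc])) (actH0_toH0 hinv k τ)
    rw [hP.det_actSections, hP.det_actSections, ← Complex.exp_nat_mul, ← Complex.exp_add] at h
    have hc : ((Module.finrank ℂ (globalSections P (k - 1)) : ℕ) : ℂ)
        = (latticeCount P (k - 1) : ℂ) := by
      rw [← hP.finrank_globalSections (k - 1)]
      push_cast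
      rfl
    rw [hc] at h
    apply mul_left_cancel₀ (Complex.exp_ne_zero _)
    rw [h, ← Complex.exp_add]
    congr 1
    push_cast
    ring
  · have h := finrank_exact (mulSection_injective h0 hs₀ k) hs hker
    rw [← hP.finrank_globalSections, ← hP.finrank_globalSections, ← h]
    push_cast
    ring

end Divisor

/-- The maximum W is attained at a vertex p with nonzero coefficient in s. Thus the initial form is
nonzero, and W = ⟨p, l⟩ lies in Γ since p is a lattice point. On the overlap of the charts of v and
w the monomial z^v trivialises K_X^{-1}. -/
theorem IsReflexive.isWeight_centralIdeal {P : Set (Fin n → ℝ)} (hP : IsReflexive P) (hn : 1 ≤ n)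
    {s : Laurent n} (hs : IsAnticanonicalSection P s)
    (hgen : ∀ p : Fin n → ℤ, toReal p ∈ P.extremePoints ℝ → s.coeff p ≠ 0)
    {l : Fin n → ℝ} {Γ : AddSubgroup ℝ} (hΓ : ∀ i, l i ∈ Γ) {k : ℤ} (hk : 1 ≤ k) :
    IsWeight P (centralIdeal_invariant Γ l s) k (-latticeMoment P l k + latticeMoment P l (k - 1)
        + supportValue P l * latticeCount P (k - 1)) ∧
      (Module.finrank ℂ (H0 P (centralIdeal Γ l s) k) : ℝ)
        = latticeCount P k - latticeCount P (k - 1) := by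
  obtain ⟨⟨p, hp, hpW⟩, hle⟩ := hP.exists_supportValue l
  obtain ⟨p, rfl⟩ := hP.lattice.exists_toReal hp
  have hglob : s ∈ globalSections P 1 := (hP.mem_globalSections_iff hn).2 hs
  have hW : ∀ q, s.coeff q ≠ 0 → toReal q ⬝ᵥ l ≤ supportValue P l := by
    intro q hq
    refine hle _ (hP.mem_iff.2 fun u hu => ?_)
    simpa using mem_globalSections.1 hglob q hq u hu
  have hne : initialForm l (supportValue P l) s ≠ 0 := by
    intro h
    refine coeff_initialForm_ne_zero.2 ⟨hgen p hp, hpW⟩ ?_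
    rw [h]
    rfl
  refine hP.isWeight_of_divisor hn hk (centralIdeal_invariant Γ l s) hne
    (mem_globalSections.2 fun q hq =>
      mem_globalSections.1 hglob q (coeff_initialForm_ne_zero.1 hq).1)
    (fun q hq => (coeff_initialForm_ne_zero.1 hq).2) fun v w => ?_
  obtain ⟨v', hv'⟩ := hP.lattice.exists_toReal v.2
  refine vanishing_centralIdeal hΓ (hpW ▸ pairing_mem hΓ p) hW hne
    (localSections_anti (fun u hu => hu.1.1) 1 hglob) (v := v') (fun u hu => ?_) k
  rw [hv']
  exact hu.1.2

end ToricFano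

namespace ToricFano

open Filter Polynomial Topology

/-! ### Expansions of eventually polynomial functions -/

theorem WithBot.le_natCast_of_lt_succ {x : WithBot ℕ} {e : ℕ} (h : x < ((e + 1 : ℕ) : WithBot ℕ)) :
    x ≤ e := by
  cases x with
  | bot => exact bot_le
  | coe x => exact WithBot.coe_le_coe.2 (Nat.lt_succ_iff.1 (WithBot.coe_lt_coe.1 h))

theorem degree_C_mul_le (a : ℝ) (p : ℝ[X]) : (C a * p).degree ≤ p.degree := by
  rw [← smul_eq_C_mul]
  exact degree_smul_le a p

theorem isBigO_eval_of_degree_lt {p : ℝ[X]} {e : ℕ} (hp : p.degree < e) :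
    (fun k : ℕ => p.eval (k : ℝ)) =O[atTop] (fun k : ℕ => (k : ℝ) ^ ((e : ℤ) - 1)) := by
  rcases e with _ | e
  · have : p = 0 := by
      rw [← degree_eq_bot]
      exact Nat.WithBot.lt_zero_iff.1 (by simpa using hp)
    simp only [this, eval_zero]
    exact Asymptotics.isBigO_zero _ _
  · have hle : p.degree ≤ (X ^ e : ℝ[X]).degree := by
      rw [degree_X_pow]
      exact WithBot.le_natCast_of_lt_succ hp
    have h := (isBigO_atTop_of_degree_le p (X ^ e) hle).comp_tendsto
      (tendsto_natCast_atTop_atTop (R := ℝ))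
    refine h.congr_right fun k => ?_
    simp

theorem degree_difference_lt {r : ℝ[X]} {e : ℕ} (hr : r.degree < (e + 1 : ℕ)) (a : ℝ) :
    (r.comp (X + C a) - r).degree < e := by
  by_cases h0 : r = 0
  · simp [h0]
  have hd : (r.comp (X + C a)).degree = r.degree := by
    rw [degree_eq_natDegree h0, degree_eq_natDegree, natDegree_comp, natDegree_X_add_C, mul_one]
    rw [Ne, comp_X_add_C_eq_zero_iff]
    exact h0
  have hlt : (r.comp (X + C a) - r).degree < (r.comp (X + C a)).degree := by
    refine degree_sub_lt_left hd (by rwa [Ne, comp_X_add_C_eq_zero_iff]) ?_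
    rw [leadingCoeff_comp (by simp), leadingCoeff_X_add_C, one_pow, mul_one]
  rw [hd] at hlt
  exact hlt.trans_le (WithBot.le_natCast_of_lt_succ hr)

/-- The binomial expansion to three terms: the second and third become the two leading terms of the
difference of X^{e+2}. -/
theorem exists_add_one_pow (e : ℕ) : ∃ p : ℝ[X], p.degree < e ∧
    (X + 1 : ℝ[X]) ^ (e + 2) = X ^ (e + 2) + C ((e : ℝ) + 2) * X ^ (e + 1)
      + C (((e : ℝ) + 2) * (e + 1) / 2) * X ^ e + p := by
  induction e with
  | zero =>
    refine ⟨0, by simp, ?_⟩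
    simp
    rw [show (C (2 : ℝ)) = 2 from rfl]
    ring
  | succ e ih =>
    obtain ⟨p, hp, h⟩ := ih
    refine ⟨(X + 1) * p + C (((e : ℝ) + 2) * (e + 1) / 2) * X ^ e, ?_, ?_⟩
    · refine (degree_add_le _ _).trans_lt (max_lt ?_ ?_)
      · rw [mul_comm]
        by_cases hp0 : p = 0
        · simp [hp0]
        · rw [degree_mul, show (X + 1 : ℝ[X]) = X + C 1 by simp, degree_X_add_C,
            degree_eq_natDegree hp0] at *
          exact_mod_cast Nat.succ_lt_succ (by exact_mod_cast hp)
      · exact (degree_C_mul_X_pow_le _ _).trans_lt (by exact_mod_cast Nat.lt_succ_self e)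
    · rw [pow_succ, h]
      have hc : C ((((e + 1 : ℕ) : ℝ) + 2) * ((e + 1 : ℕ) + 1) / 2)
          = C (((e : ℝ) + 2) * (e + 1) / 2) + C ((e : ℝ) + 2) := by
        rw [← C_add]; congr 1; push_cast; ring
      have hc' : C (((e + 1 : ℕ) : ℝ) + 2) = C ((e : ℝ) + 2) + 1 := by
        rw [← C_1, ← C_add]; congr 1; push_cast; ring
      rw [hc, hc']
      ring

theorem degree_lt_of_tendsto {r : ℝ[X]} {d : ℕ}
    (h : Tendsto (fun k : ℕ => r.eval (k : ℝ) / (k : ℝ) ^ d) atTop (𝓝 0)) : r.degree < d := by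
  by_contra hle
  rw [not_lt, ← degree_X_pow (R := ℝ)] at hle
  have h1 := (isBigO_atTop_of_degree_le (X ^ d) r hle).comp_tendsto
    (tendsto_natCast_atTop_atTop (R := ℝ))
  have h2 : (fun k : ℕ => r.eval (k : ℝ)) =o[atTop] (fun k : ℕ => (k : ℝ) ^ d) := by
    refine (Asymptotics.isLittleO_iff_tendsto' ?_).2 h
    filter_upwards [eventually_gt_atTop 0] with k hk h
    have : (k : ℝ) ^ d ≠ 0 := by positivity
    exact absurd h this
  have h3 : (fun k : ℕ => (k : ℝ) ^ d) =o[atTop] (fun k : ℕ => (k : ℝ) ^ d) := by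
    refine Asymptotics.IsBigO.trans_isLittleO ?_ h2
    refine h1.congr_left fun k => ?_
    simp
  refine Asymptotics.isLittleO_irrefl ?_ h3
  refine Eventually.frequently ?_
  filter_upwards [eventually_gt_atTop 0] with k hk
  positivity

theorem tendsto_eval_div_pow {r : ℝ[X]} {d : ℕ} (hr : r.degree < d) :
    Tendsto (fun k : ℕ => r.eval (k : ℝ) / (k : ℝ) ^ d) atTop (𝓝 0) := by
  have h := (div_tendsto_atTop_zero_of_degree_lt r (X ^ d) (by rwa [degree_X_pow])).comp
    (tendsto_natCast_atTop_atTop (R := ℝ))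
  refine h.congr fun k => ?_
  simp

/-- If the partial sums of an eventually polynomial function `q` have no term of degree `d`,
the two leading coefficients of `q` are proportional. -/
theorem EventuallyPoly.expansion {q : ℕ → ℝ} (hq : EventuallyPoly q) {d : ℕ} (hd : 1 ≤ d) {t A : ℝ}
    (ht : Tendsto (fun k : ℕ => (∑ j ∈ Finset.range k, q j - t * (k : ℝ) ^ (d + 1)) / (k : ℝ) ^ d)
      atTop (𝓝 0))
    (hA : Tendsto (fun k : ℕ => q k / (k : ℝ) ^ d) atTop (𝓝 A)) :
    ∃ p : ℝ[X], (∀ᶠ k : ℕ in atTop, q k = p.eval (k : ℝ)) ∧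
      (p - (C A * X ^ d + C (d / 2 * A) * X ^ (d - 1))).degree < ((d - 1 : ℕ) : WithBot ℕ) := by
  obtain ⟨e, rfl⟩ : ∃ e, d = e + 1 := ⟨d - 1, by omega⟩
  have hT : EventuallyPoly fun k => ∑ j ∈ Finset.range k, q j :=
    EventuallyPoly.of_difference (by simpa [Finset.sum_range_succ] using hq)
  obtain ⟨T, hT⟩ := hT
  -- The hypothesis `ht` says that T, the polynomial of partial sums, has no term of degree d = e +
  -- 1. So r has degree at most e and its difference has degree below e.
  set r := T - C t * X ^ (e + 2) with hr
  have hrdeg : r.degree < (e + 1 : ℕ) := by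
    refine degree_lt_of_tendsto (ht.congr' ?_)
    filter_upwards [hT] with k hk
    rw [hk, hr]
    simp
  obtain ⟨p₀, hp₀, hpow⟩ := exists_add_one_pow e
  set p := T.comp (X + C 1) - T with hp
  have hqp : ∀ᶠ k : ℕ in atTop, q k = p.eval (k : ℝ) := by
    filter_upwards [hT, (tendsto_add_atTop_nat 1).eventually hT] with k h1 h2
    rw [Finset.sum_range_succ, h1] at h2
    rw [hp, eval_sub, eval_comp, eval_add, eval_X, eval_C]
    push_cast at h2
    linarith
  -- The difference of t X^{e+2} begins with t(e+2) X^{e+1} + t(e+2)(e+1)/2 X^e, whose coefficients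
  -- have ratio (e+1)/2 = d/2.
  set A' := t * ((e : ℝ) + 2) with hA'
  have hlow : p - (C A' * X ^ (e + 1) + C (((e + 1 : ℕ) : ℝ) / 2 * A') * X ^ e)
      = C t * p₀ + (r.comp (X + C 1) - r) := by
    have hTr : T = r + C t * X ^ (e + 2) := by rw [hr]; ring
    rw [hp, hTr]
    simp only [add_comp, mul_comp, C_comp, pow_comp, X_comp, C_1]
    rw [hpow, hA', C_mul]
    have : C (((e + 1 : ℕ) : ℝ) / 2 * (t * ((e : ℝ) + 2)))
        = C t * C (((e : ℝ) + 2) * (e + 1) / 2) := by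
      rw [← C_mul]; congr 1; push_cast; ring
    rw [this]
    ring
  have hdeg : (p - (C A' * X ^ (e + 1) + C (((e + 1 : ℕ) : ℝ) / 2 * A') * X ^ e)).degree
      < (e : WithBot ℕ) := by
    rw [hlow]
    refine (degree_add_le _ _).trans_lt (max_lt ?_ (degree_difference_lt hrdeg 1))
    exact (degree_C_mul_le t p₀).trans_lt hp₀
  have hAA : A = A' := by
    have hdeg' : (p - C A' * X ^ (e + 1)).degree < ((e + 1 : ℕ) : WithBot ℕ) := by
      have : p - C A' * X ^ (e + 1)
          = (p - (C A' * X ^ (e + 1) + C (((e + 1 : ℕ) : ℝ) / 2 * A') * X ^ e))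
            + C (((e + 1 : ℕ) : ℝ) / 2 * A') * X ^ e := by ring
      rw [this]
      have hlt : ((e : ℕ) : WithBot ℕ) < (e + 1 : ℕ) := by exact_mod_cast Nat.lt_succ_self e
      exact (degree_add_le _ _).trans_lt
        (max_lt (hdeg.trans hlt) ((degree_C_mul_X_pow_le _ _).trans_lt hlt))
    have h1 := (tendsto_eval_div_pow hdeg').add_const A'
    rw [zero_add] at h1
    refine tendsto_nhds_unique hA (h1.congr' ?_)
    filter_upwards [hqp, eventually_gt_atTop 0] with k hk hk0
    have : (k : ℝ) ≠ 0 := by positivity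
    rw [hk]
    simp only [eval_sub, eval_mul, eval_C, eval_pow, eval_X]
    field_simp
    ring
  refine ⟨p, hqp, ?_⟩
  rw [hAA]
  exact hdeg

theorem EventuallyPoly.isBigO_expansion {q : ℕ → ℝ} (hq : EventuallyPoly q) {d : ℕ} (hd : 1 ≤ d)
    {t A : ℝ}
    (ht : Tendsto (fun k : ℕ => (∑ j ∈ Finset.range k, q j - t * (k : ℝ) ^ (d + 1)) / (k : ℝ) ^ d)
      atTop (𝓝 0))
    (hA : Tendsto (fun k : ℕ => q k / (k : ℝ) ^ d) atTop (𝓝 A)) :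
    (fun k : ℕ => q k - (A * (k : ℝ) ^ (d : ℤ) + d / 2 * A * (k : ℝ) ^ ((d : ℤ) - 1)))
      =O[atTop] (fun k : ℕ => (k : ℝ) ^ ((d : ℤ) - 2)) ∧
    (fun k : ℕ => q k - q (k - 1) - d * A * (k : ℝ) ^ ((d : ℤ) - 1))
      =O[atTop] (fun k : ℕ => (k : ℝ) ^ ((d : ℤ) - 2)) := by
  obtain ⟨p, hp, hdeg⟩ := hq.expansion hd ht hA
  obtain ⟨e, rfl⟩ : ∃ e, d = e + 1 := ⟨d - 1, by omega⟩
  rw [Nat.add_sub_cancel] at hdeg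
  have he1 : ((e + 1 : ℕ) : ℤ) - 1 = (e : ℕ) := by push_cast; ring
  have he2 : ((e + 1 : ℕ) : ℤ) - 2 = (e : ℤ) - 1 := by push_cast; ring
  rw [he1, he2]
  set r := p - (C A * X ^ (e + 1) + C (((e + 1 : ℕ) : ℝ) / 2 * A) * X ^ e) with hr
  constructor
  · refine (isBigO_eval_of_degree_lt hdeg).congr' ?_ EventuallyEq.rfl
    filter_upwards [hp] with k hk
    rw [hk, hr]
    simp only [eval_sub, eval_add, eval_mul, eval_C, eval_pow, eval_X, zpow_natCast]
  · have hlt : ((e : ℕ) : WithBot ℕ) < (e + 1 : ℕ) := by exact_mod_cast Nat.lt_succ_self e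
    have hX : ∃ s : ℝ[X], s.degree < e ∧
        (X + C (-1) : ℝ[X]) ^ (e + 1) = X ^ (e + 1) - C ((e : ℝ) + 1) * X ^ e + s := by
      clear * -
      induction e with
      | zero => exact ⟨0, by simp, by simp [sub_eq_add_neg]⟩
      | succ e ih =>
        obtain ⟨s, hs, h⟩ := ih
        refine ⟨(X + C (-1)) * s + C ((e : ℝ) + 1) * X ^ e, ?_, ?_⟩
        · refine (degree_add_le _ _).trans_lt (max_lt ?_ ?_)
          · by_cases hs0 : s = 0
            · simp [hs0]
            · rw [mul_comm, degree_mul, degree_X_add_C, degree_eq_natDegree hs0] at *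
              exact_mod_cast Nat.succ_lt_succ (by exact_mod_cast hs)
          · exact (degree_C_mul_X_pow_le _ _).trans_lt (by exact_mod_cast Nat.lt_succ_self e)
        · rw [pow_succ, h]
          have hc : C (((e + 1 : ℕ) : ℝ) + 1) = C ((e : ℝ) + 1) + 1 := by
            rw [← C_1, ← C_add]; congr 1; push_cast; ring
          rw [hc, C_neg, C_1]
          ring
    obtain ⟨s, hs, hX⟩ := hX
    have hrest : p = C A * X ^ (e + 1) + (C (((e + 1 : ℕ) : ℝ) / 2 * A) * X ^ e + r) := by
      rw [hr]; ring
    set r' := C (((e + 1 : ℕ) : ℝ) / 2 * A) * X ^ e + r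
    have hr' : r'.degree < (e + 1 : ℕ) := (degree_add_le _ _).trans_lt
      (max_lt ((degree_C_mul_X_pow_le _ _).trans_lt hlt) (hdeg.trans hlt))
    have hfin : (-(r'.comp (X + C (-1)) - r') - C A * s).degree < e := by
      refine (degree_sub_le _ _).trans_lt (max_lt ?_ ((degree_C_mul_le A s).trans_lt hs))
      rw [degree_neg]
      exact degree_difference_lt hr' (-1)
    refine (isBigO_eval_of_degree_lt hfin).congr' ?_ EventuallyEq.rfl
    have hp' := (tendsto_sub_atTop_nat 1).eventually hp
    -- For k > 0 the truncated difference k - 1 is the true one.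
    filter_upwards [hp, hp', eventually_gt_atTop 0] with k hk hk' hk0
    have h1 : ((k - 1 : ℕ) : ℝ) = k - 1 := by
      rw [Nat.cast_sub hk0, Nat.cast_one]
    have h2 := congrArg (eval (k : ℝ)) hX
    simp only [eval_sub, eval_add, eval_mul, eval_C, eval_pow, eval_X] at h2
    rw [hk, hk', hrest, h1]
    simp only [eval_sub, eval_add, eval_mul, eval_C, eval_pow, eval_X, eval_neg, eval_comp,
      zpow_natCast]
    have h3 : (k : ℝ) - 1 = k + -1 := by ring
    rw [h3, h2]
    push_cast
    ring

end ToricFano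

namespace ToricFano

open Filter Topology MeasureTheory

variable {n : ℕ} {P : Set (Fin n → ℝ)}

/-! ### Polynomiality of lattice point sums -/

theorem toReal_injective : Function.Injective (toReal (n := n)) := fun _ _ h =>
  funext fun i => Int.cast_injective (α := ℝ) (congrFun h i)

/-- The lattice points of the cone over `P`, graded by height. -/
def coneSet (P : Set (Fin n → ℝ)) : Set ((Fin n → ℤ) × ℤ) :=
  {a | 0 ≤ a.2 ∧ a.1 ∈ latticePoints P a.2}

theorem add_mem_coneSet {S : Set ((Fin n → ℤ) × ℤ)} (hS : ∀ v ∈ S, v.2 = 1 ∧ toReal v.1 ∈ P)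
    {x : (Fin n → ℤ) × ℤ} (hx : x ∈ AddSubmonoid.closure S) :
    ∀ a ∈ coneSet P, a + x ∈ coneSet P := by
  induction hx using AddSubmonoid.closure_induction with
  | mem v hv =>
    rintro a ⟨ha, ha'⟩
    obtain ⟨h1, h2⟩ := hS v hv
    refine ⟨by rw [Prod.snd_add, h1]; omega, fun u hu => ?_⟩
    have h3 := ha' u hu
    have h4 := hu.1 _ h2
    rw [Prod.fst_add, Prod.snd_add, h1, toReal_add, dotProduct_add]
    push_cast
    linarith
  | zero => intro a ha; rwa [add_zero]
  | add x y _ _ hx hy =>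
    intro a ha
    rw [← add_assoc]
    exact hy _ (hx a ha)

/-- Gordan's lemma: rounding down the coefficients of a conical combination writes each lattice
point of the cone as an element of a finite set B plus a natural combination of the generators (v,
1). Finiteness of B and Dickson's lemma for the coefficients give the well-quasi-order. -/
theorem IsReflexive.isNoetherianSet_coneSet (hP : IsReflexive P) :
    ∃ S : Set ((Fin n → ℤ) × ℤ), S.Finite ∧ (∀ v ∈ S, v.2 = 1) ∧
      IsNoetherianSet S (coneSet P) := by
  classical
  obtain ⟨G, hG⟩ := hP.lattice
  have hGP : ∀ v ∈ G, toReal v ∈ P := fun v hv => by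
    rw [hG]; exact subset_convexHull ℝ _ ⟨v, hv, rfl⟩
  let S : Set ((Fin n → ℤ) × ℤ) := (fun v => (v, (1 : ℤ))) '' (G : Set (Fin n → ℤ))
  have hS : ∀ v ∈ S, v.2 = 1 ∧ toReal v.1 ∈ P := by
    rintro _ ⟨v, hv, rfl⟩
    exact ⟨rfl, hGP v hv⟩
  refine ⟨S, G.finite_toSet.image _, fun v hv => (hS v hv).1,
    fun a ha x hx _ _ _ => add_mem_coneSet hS hx a ha, ?_⟩
  -- The height of the remainder is a sum of fractional parts, one per generator, hence at most the
  -- number of generators.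
  let B : Set ((Fin n → ℤ) × ℤ) := {a ∈ coneSet P | a.2 ≤ G.card}
  have hB : B.Finite := by
    refine ((Set.finite_Icc (0 : ℤ) G.card).biUnion fun j _ =>
      ((hP.finite_latticePoints j).image fun m => (m, j))).subset ?_
    rintro ⟨m, j⟩ ⟨⟨h1, h2⟩, h3⟩
    exact Set.mem_biUnion (x := j) ⟨h1, h3⟩ ⟨m, h2, rfl⟩
  -- every element is a combination of generators up to the finite set `B`
  have hdec : ∀ a ∈ coneSet P, ∃ (b : B) (c : G → ℕ),
      a = b + ∑ v : G, c v • ((v : Fin n → ℤ), (1 : ℤ)) := by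
    rintro ⟨m, k⟩ ⟨hk, hm⟩
    simp only at hk hm
    rcases hk.eq_or_lt with rfl | hk
    -- At height 0 one cannot divide by k, but the point already lies in B.
    · exact ⟨⟨(m, 0), ⟨le_refl _, hm⟩, by positivity⟩, 0, by simp⟩
    have hk' : (0 : ℝ) < k := by exact_mod_cast hk
    have hmem := (hP.inv_smul_mem_iff hk').2 hm
    rw [hG, ← Finset.coe_image, Finset.mem_convexHull'] at hmem
    obtain ⟨w, hw0, hw1, hw⟩ := hmem
    rw [Finset.sum_image toReal_injective.injOn, ← Finset.sum_coe_sort] at hw1 hw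
    have hw0 : ∀ v : G, 0 ≤ (k : ℝ) * w (toReal v) := fun v =>
      mul_nonneg hk'.le (hw0 _ (Finset.mem_image_of_mem _ v.2))
    let c : G → ℕ := fun v => ⌊(k : ℝ) * w (toReal v)⌋₊
    have hc1 : ∀ v : G, 0 ≤ (k : ℝ) * w (toReal v) - c v := fun v =>
      sub_nonneg.2 (Nat.floor_le (hw0 v))
    have hc2 : ∀ v : G, (k : ℝ) * w (toReal v) - c v ≤ 1 := fun v => by
      have := Nat.lt_floor_add_one ((k : ℝ) * w (toReal v))
      simp only [c]
      linarith
    have hsum : ∑ v : G, ((k : ℝ) * w (toReal v) - c v) = k - ∑ v : G, (c v : ℝ) := by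
      rw [Finset.sum_sub_distrib, ← Finset.mul_sum, hw1, mul_one]
    have hm' : toReal m = ∑ v : G, ((k : ℝ) * w (toReal v)) • toReal v := by
      simp only [mul_smul, ← Finset.smul_sum]
      rw [hw, smul_smul, mul_inv_cancel₀ hk'.ne', one_smul]
    have hreal : toReal (m - ∑ v : G, c v • (v : Fin n → ℤ))
        = ∑ v : G, ((k : ℝ) * w (toReal v) - c v) • toReal v := by
      simp only [sub_smul, Finset.sum_sub_distrib]
      rw [← hm', toReal_sub]
      congr 1
      ext i
      simp [toReal]
    refine ⟨⟨(m - ∑ v : G, c v • (v : Fin n → ℤ), k - ∑ v : G, (c v : ℤ)), ⟨?_, fun u hu => ?_⟩, ?_⟩,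
      c, ?_⟩
    · have : (0 : ℝ) ≤ ((k - ∑ v : G, (c v : ℤ) : ℤ) : ℝ) := by
        push_cast
        rw [← hsum]
        exact Finset.sum_nonneg fun v _ => hc1 v
      exact_mod_cast this
    · simp only
      rw [hreal, dotProduct_sum]
      push_cast
      rw [← hsum, ← Finset.sum_neg_distrib]
      refine Finset.sum_le_sum fun v _ => ?_
      rw [dotProduct_smul, smul_eq_mul]
      nlinarith [hc1 v, hu.1 _ (hGP v v.2)]
    · have : ((k - ∑ v : G, (c v : ℤ) : ℤ) : ℝ) ≤ G.card := by
        push_cast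
        rw [← hsum]
        refine (Finset.sum_le_sum fun v _ => hc2 v).trans ?_
        simp
      exact_mod_cast this
    · ext1
      · simp [Prod.fst_sum]
      · simp [Prod.snd_sum]
  rw [Set.partiallyWellOrderedOn_iff_exists_lt]
  intro f hf
  choose b c hbc using fun i => hdec (f i) (hf i)
  have := hB.to_subtype
  obtain ⟨i, j, hij, hb, hc⟩ := (Finite.wellQuasiOrdered (α := B) Eq).prod
    (wellQuasiOrdered_le (α := G → ℕ)) (fun i => (b i, c i))
  refine ⟨i, j, hij, ?_⟩
  have hb : b i = b j := hb
  have hc : c i ≤ c j := hc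
  rw [hbc i, hbc j, hb, add_sub_add_left_eq_sub, ← Finset.sum_sub_distrib]
  refine AddSubmonoid.sum_mem _ fun v _ => ?_
  rw [sub_eq_add_neg, ← sub_nsmul _ (hc v)]
  have hv : ((v : Fin n → ℤ), (1 : ℤ)) ∈ S := ⟨v, v.2, rfl⟩
  exact AddSubmonoid.nsmul_mem _ (AddSubmonoid.subset_closure hv) _

/-- The sum of `f` over the lattice points of `k P`. -/
noncomputable def latticeSum (P : Set (Fin n → ℝ)) (f : (Fin n → ℝ) → ℝ) (k : ℤ) : ℝ :=
  ∑ᶠ m ∈ latticePoints P k, f (toReal m)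

theorem IsReflexive.eventuallyPoly_latticeSum (hP : IsReflexive P) (l : Fin n → ℝ) (c : ℝ) :
    EventuallyPoly fun k : ℕ => latticeSum P (fun x => c + x ⬝ᵥ l) k := by
  obtain ⟨S, hfin, hS, hN⟩ := hP.isNoetherianSet_coneSet
  have h := levelSum_eventuallyPoly (AddMonoidHom.snd (Fin n → ℤ) ℤ) hfin hS hN
    ((pairingHom l).comp (AddMonoidHom.fst _ _)) c
  convert h using 2 with k
  have himg : {a ∈ coneSet P | AddMonoidHom.snd (Fin n → ℤ) ℤ a = k}
      = (fun m => (m, (k : ℤ))) '' latticePoints P k := by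
    ext ⟨m, j⟩
    constructor
    · rintro ⟨⟨-, h1⟩, h2⟩
      have h2 : j = k := h2
      subst h2
      exact ⟨m, h1, rfl⟩
    · rintro ⟨m', h1, h2⟩
      obtain ⟨rfl, rfl⟩ := Prod.mk.inj h2
      exact ⟨⟨by positivity, h1⟩, rfl⟩
  rw [levelSum, himg, finsum_mem_image (Prod.mk_left_injective (k : ℤ)).injOn]
  rfl

/-! ### The leading coefficient -/

open scoped Pointwise in
-- By homogeneity the sum is k^e times a sum over P ∩ (1/k)ℤⁿ, and Riemann sums converge because a
-- convex set has null frontier.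
theorem IsReflexive.tendsto_latticeSum (hP : IsReflexive P) {f : (Fin n → ℝ) → ℝ}
    (hf : Continuous f) {e : ℕ} (hhom : ∀ (r : ℝ) x, f (r • x) = r ^ e * f x) :
    Tendsto (fun k : ℕ => latticeSum P f k / (k : ℝ) ^ (n + e)) atTop (𝓝 (∫ x in P, f x)) := by
  have h := tendsto_tsum_div_pow_atTop_integral P f hf hP.lattice.isCompact.isBounded
    hP.lattice.isCompact.measurableSet (hP.lattice.convex.addHaar_frontier volume)
  refine h.congr' ?_
  filter_upwards [eventually_gt_atTop 0] with k hk
  have hk' : (0 : ℝ) < k := by exact_mod_cast hk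
  have : NeZero k := ⟨hk.ne'⟩
  have hset : P ∩ (k : ℝ)⁻¹ • (Submodule.span ℤ (Set.range (Pi.basisFun ℝ (Fin n))) :
      Set (Fin n → ℝ)) = (fun m => (k : ℝ)⁻¹ • toReal m) '' latticePoints P k := by
    ext x
    have hspan : x ∈ (k : ℝ)⁻¹ • (Submodule.span ℤ (Set.range (Pi.basisFun ℝ (Fin n))) :
        Set (Fin n → ℝ)) ↔ ∀ i, (k : ℝ) * x i ∈ Set.range (algebraMap ℤ ℝ) := by
      rw [← BoxIntegral.unitPartition.mem_smul_span_iff]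
      rfl
    rw [Set.mem_inter_iff, hspan]
    constructor
    · rintro ⟨hx, hi⟩
      choose m hm using hi
      have hxm : x = (k : ℝ)⁻¹ • toReal m := by
        ext i
        have := hm i
        rw [Pi.smul_apply, smul_eq_mul, eq_inv_mul_iff_mul_eq₀ hk'.ne', ← this]
        rfl
      refine ⟨m, ?_, hxm.symm⟩
      rw [hxm, hP.inv_smul_mem_iff hk'] at hx
      exact fun u hu => by simpa using hx u hu
    · rintro ⟨m, hm, rfl⟩
      refine ⟨(hP.inv_smul_mem_iff hk').2 fun u hu => by simpa using hm u hu, fun i => ⟨m i, ?_⟩⟩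
      simp only [Pi.smul_apply, smul_eq_mul]
      rw [mul_inv_cancel_left₀ hk'.ne']
      rfl
  have hfin := (hP.finite_latticePoints k).image fun m => (k : ℝ)⁻¹ • toReal m
  have hinj : Function.Injective fun m : Fin n → ℤ => (k : ℝ)⁻¹ • toReal m := fun a b hab =>
    toReal_injective (smul_right_injective _ (inv_ne_zero hk'.ne') hab)
  rw [hset, tsum_eq_finsum, finsum_set_coe_eq_finsum_mem, finsum_mem_image hinj.injOn, latticeSum,
    Fintype.card_fin]
  · simp only [hhom]
    rw [← mul_finsum_mem, pow_add, inv_pow]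
    field_simp
  · have := hfin.to_subtype
    exact Set.toFinite _

/-! ### Partial sums -/

/-- The gauge of `P`, as the maximum of the linear forms `-u` for `u` a vertex of the dual. -/
noncomputable def supGauge (P : Set (Fin n → ℝ)) (x : Fin n → ℝ) : ℝ :=
  ⨆ u : (polarDual P).extremePoints ℝ, -((u : Fin n → ℝ) ⬝ᵥ x)

theorem IsReflexive.finite_rays (hP : IsReflexive P) : Finite ((polarDual P).extremePoints ℝ) :=
  hP.dual_lattice.finite_extremePoints.to_subtype

theorem IsReflexive.nonempty_rays (hP : IsReflexive P) :
    Nonempty ((polarDual P).extremePoints ℝ) :=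
  (hP.dual_lattice.isCompact.extremePoints_nonempty ⟨0, fun x _ => by simp⟩).to_subtype

theorem IsReflexive.supGauge_le_iff (hP : IsReflexive P) {x : Fin n → ℝ} {r : ℝ} :
    supGauge P x ≤ r ↔ ∀ u ∈ (polarDual P).extremePoints ℝ, -r ≤ u ⬝ᵥ x := by
  have := hP.finite_rays
  have := hP.nonempty_rays
  rw [supGauge, ciSup_le_iff (Set.finite_range _).bddAbove]
  exact ⟨fun h u hu => by linarith [h ⟨u, hu⟩], fun h u => by linarith [h u u.2]⟩

theorem IsReflexive.mem_latticePoints_iff (hP : IsReflexive P) {m : Fin n → ℤ} {k : ℤ} :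
    m ∈ latticePoints P k ↔ supGauge P (toReal m) ≤ k :=
  hP.supGauge_le_iff.symm

/-- Here the integrality of the dual enters: the maximum is attained at a vertex of the dual, a
lattice point. It is nonnegative since 0 is in the hull of these vertices. -/
theorem IsReflexive.exists_supGauge_eq (hP : IsReflexive P) (m : Fin n → ℤ) :
    ∃ N : ℕ, supGauge P (toReal m) = N := by
  have := hP.finite_rays
  have := hP.nonempty_rays
  obtain ⟨u, hu⟩ := exists_eq_ciSup_of_finite
    (f := fun u : (polarDual P).extremePoints ℝ => -((u : Fin n → ℝ) ⬝ᵥ toReal m))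
  obtain ⟨u', hu'⟩ := hP.dual_lattice.exists_toReal u.2
  have hint : supGauge P (toReal m) = ((-(u' ⬝ᵥ m) : ℤ) : ℝ) := by
    rw [supGauge, ← hu, ← hu']
    simp [toReal, dotProduct]
  have hnonneg : 0 ≤ supGauge P (toReal m) := by
    have h0 : (0 : Fin n → ℝ) ∈ convexHull ℝ ((polarDual P).extremePoints ℝ) := by
      rw [hP.dual_lattice.convexHull_extremePoints]
      exact fun x _ => by simp
    obtain ⟨w, hw, -, hle⟩ := exists_vertex_le_of_mem_convexHull h0 (a := 0) (c := 0) (by simp)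
      (by simp) (toReal m)
    have h1 := hP.supGauge_le_iff.1 (le_refl (supGauge P (toReal m))) w hw
    rw [dotProduct_zero, dotProduct_comm] at hle
    linarith
  rw [hint] at hnonneg
  obtain ⟨N, hN⟩ := Int.eq_ofNat_of_zero_le (a := -(u' ⬝ᵥ m)) (by exact_mod_cast hnonneg)
  exact ⟨N, by rw [hint, hN]; rfl⟩

theorem supGauge_smul {r : ℝ} (hr : 0 ≤ r) (x : Fin n → ℝ) :
    supGauge P (r • x) = r * supGauge P x := by
  rw [supGauge, supGauge, Real.mul_iSup_of_nonneg hr]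
  simp [dotProduct_smul]

theorem abs_dotProduct_le (u x : Fin n → ℝ) : |u ⬝ᵥ x| ≤ (∑ i, ‖u i‖) * ‖x‖ := by
  rw [Finset.sum_mul]
  refine (Finset.abs_sum_le_sum_abs _ _).trans (Finset.sum_le_sum fun i _ => ?_)
  rw [abs_mul]
  exact mul_le_mul_of_nonneg_left (norm_le_pi_norm x i) (abs_nonneg _)

theorem IsReflexive.exists_lipschitz_supGauge (hP : IsReflexive P) :
    ∃ C : NNReal, LipschitzWith C (supGauge P) := by
  have := hP.finite_rays
  have := hP.nonempty_rays
  obtain ⟨u₀, hu₀⟩ := Finite.exists_max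
    (fun u : (polarDual P).extremePoints ℝ => ∑ i, ‖(u : Fin n → ℝ) i‖)
  refine ⟨(∑ i, ‖(u₀ : Fin n → ℝ) i‖).toNNReal,
    LipschitzWith.of_le_add_mul _ fun x y => hP.supGauge_le_iff.2 fun u hu => ?_⟩
  have h1 := hP.supGauge_le_iff.1 (le_refl (supGauge P y)) u hu
  have h2 := abs_le.1 (abs_dotProduct_le u (x - y))
  have h3 : (∑ i, ‖u i‖) * ‖x - y‖ ≤ (∑ i, ‖(u₀ : Fin n → ℝ) i‖) * ‖x - y‖ :=
    mul_le_mul_of_nonneg_right (hu₀ ⟨u, hu⟩) (norm_nonneg _)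
  rw [dotProduct_sub] at h2
  rw [dist_eq_norm, Real.coe_toNNReal _ (Finset.sum_nonneg fun _ _ => norm_nonneg _)]
  linarith [h2.1]

/-- A lattice point m lies in jP exactly for j ≥ g(m), g the gauge; as g(m) is a natural number, it
is counted max(0, k - g(m)) times among j < k. -/
theorem IsReflexive.sum_latticeSum (hP : IsReflexive P) (f : (Fin n → ℝ) → ℝ) (k : ℕ) :
    ∑ j ∈ Finset.range k, latticeSum P f j
      = ∑ᶠ m : Fin n → ℤ, f (toReal m) * max 0 (k - supGauge P (toReal m)) := by
  classical
  have hfin := hP.finite_latticePoints k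
  rw [finsum_eq_sum_of_support_subset (s := hfin.toFinset)]
  · have hj : ∀ j ∈ Finset.range k, latticeSum P f j
        = ∑ m ∈ hfin.toFinset, if m ∈ latticePoints P j then f (toReal m) else 0 := by
      intro j hj
      rw [latticeSum, finsum_mem_eq_finite_toFinset_sum _ (hP.finite_latticePoints j),
        ← Finset.sum_filter]
      refine Finset.sum_congr ?_ fun _ _ => rfl
      ext m
      simp only [Set.Finite.mem_toFinset, Finset.mem_filter, iff_and_self, hP.mem_latticePoints_iff]
      intro h
      refine h.trans ?_
      exact_mod_cast (Finset.mem_range.1 hj).le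
    rw [Finset.sum_congr rfl hj, Finset.sum_comm]
    refine Finset.sum_congr rfl fun m _ => ?_
    obtain ⟨N, hN⟩ := hP.exists_supGauge_eq m
    simp only [hP.mem_latticePoints_iff, hN]
    have hcard : (Finset.range k).filter (fun j => N ≤ j) = Finset.Ico N k := by
      ext j; simp [and_comm]
    have hmax : max 0 ((k : ℝ) - N) = ((k - N : ℕ) : ℝ) := by
      rcases le_total N k with h | h
      · rw [Nat.cast_sub h, max_eq_right]
        exact sub_nonneg.2 (by exact_mod_cast h)
      · rw [Nat.sub_eq_zero_of_le h, Nat.cast_zero, max_eq_left]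
        exact sub_nonpos.2 (by exact_mod_cast h)
    have hcast : ∀ j : ℕ, ((N : ℝ) ≤ ((j : ℤ) : ℝ)) ↔ N ≤ j := fun j => by
      rw [Int.cast_natCast, Nat.cast_le]
    simp only [hcast]
    rw [← Finset.sum_filter, hcard, Finset.sum_const, Nat.card_Ico, nsmul_eq_mul, hmax, mul_comm]
  · intro m hm
    rw [Set.Finite.coe_toFinset, hP.mem_latticePoints_iff]
    by_contra h
    refine hm ?_
    simp only
    rw [max_eq_left, mul_zero]
    push Not at h
    rw [Int.cast_natCast] at h
    linarith

theorem lipschitzWith_mul_of_bounded_support {f g : (Fin n → ℝ) → ℝ} {C C' : NNReal}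
    (hf : LipschitzWith C f) (hg : LipschitzWith C' g) {R B M : ℝ} (hR : ∀ x, R < ‖x‖ → g x = 0)
    (hB : ∀ x, ‖x‖ ≤ R → |f x| ≤ B) (hM : ∀ x, |g x| ≤ M) :
    ∃ K : NNReal, LipschitzWith K fun x => f x * g x := by
  -- One point in the ball suffices, by symmetry; with both outside, the two products vanish.
  have key : ∀ x y, ‖x‖ ≤ R →
      |f x * g x - f y * g y| ≤ (|B| * C' + |M| * C) * ‖x - y‖ := by
    intro x y hx
    have h1 := hf.dist_le_mul x y
    have h2 := hg.dist_le_mul x y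
    rw [Real.dist_eq, dist_eq_norm] at h1 h2
    have : f x * g x - f y * g y = f x * (g x - g y) + g y * (f x - f y) := by ring
    rw [this]
    calc |f x * (g x - g y) + g y * (f x - f y)|
        ≤ |f x| * |g x - g y| + |g y| * |f x - f y| := by
          rw [← abs_mul, ← abs_mul]; exact abs_add_le _ _
      _ ≤ |B| * (C' * ‖x - y‖) + |M| * (C * ‖x - y‖) := by
          exact add_le_add
            (mul_le_mul ((hB x hx).trans (le_abs_self B)) h2 (abs_nonneg _) (abs_nonneg _))
            (mul_le_mul ((hM y).trans (le_abs_self M)) h1 (abs_nonneg _) (abs_nonneg _))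
      _ = _ := by ring
  refine ⟨(|B| * C' + |M| * C).toNNReal, LipschitzWith.of_dist_le_mul fun x y => ?_⟩
  rw [Real.dist_eq, dist_eq_norm, Real.coe_toNNReal _ (by positivity)]
  by_cases hx : ‖x‖ ≤ R
  · exact key x y hx
  by_cases hy : ‖y‖ ≤ R
  · rw [abs_sub_comm, norm_sub_rev]
    exact key y x hy
  rw [hR x (not_le.1 hx), hR y (not_le.1 hy)]
  simp only [mul_zero, sub_self, abs_zero]
  positivity

/-- After rescaling by k, the partial sum is a Riemann sum of f · max(0, 1 - g), g the gauge. This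
function is Lipschitz and vanishes off `P`, so the error is o(1/k); t is its integral. -/
theorem IsReflexive.tendsto_sum_latticeSum (hP : IsReflexive P) {f : (Fin n → ℝ) → ℝ}
    {C : NNReal} (hf : LipschitzWith C f) {e : ℕ} (hhom : ∀ (r : ℝ) x, f (r • x) = r ^ e * f x) :
    ∃ t : ℝ, Tendsto (fun k : ℕ => (∑ j ∈ Finset.range k, latticeSum P f j
      - t * (k : ℝ) ^ (n + e + 1)) / (k : ℝ) ^ (n + e)) atTop (𝓝 0) := by
  obtain ⟨C', hC'⟩ := hP.exists_lipschitz_supGauge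
  obtain ⟨R, hR⟩ := hP.lattice.isCompact.isBounded.subset_closedBall 0
  have hsupp : ∀ x, R < ‖x‖ → max 0 (1 - supGauge P x) = 0 := by
    intro x hx
    rw [max_eq_left]
    by_contra! h
    have hxP : x ∈ P := hP.mem_iff.2 (hP.supGauge_le_iff.1 (by linarith))
    have := mem_closedBall_zero_iff.1 (hR hxP)
    linarith
  have hψ : LipschitzWith C' fun x => max 0 (1 - supGauge P x) := by
    have := (((LipschitzWith.const (1 : ℝ)).sub hC').const_max 0)
    simpa using this
  have hcpt : HasCompactSupport fun x => max 0 (1 - supGauge P x) :=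
    HasCompactSupport.intro (isCompact_closedBall 0 R) fun x hx => hsupp x (by simpa using hx)
  obtain ⟨M, hM⟩ := hψ.continuous.bounded_above_of_compact_support hcpt
  obtain ⟨B, hB⟩ := (isCompact_closedBall (0 : Fin n → ℝ) R).exists_bound_of_continuousOn
    hf.continuous.continuousOn
  obtain ⟨K, hK⟩ := lipschitzWith_mul_of_bounded_support hf hψ hsupp
    (fun x hx => hB x (by simpa using hx)) hM
  have h := tendsto_riemannSum hK (R := R) fun x hx => by rw [hsupp x hx, mul_zero]
  refine ⟨∫ x, f x * max 0 (1 - supGauge P x), h.congr' ?_⟩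
  filter_upwards [eventually_gt_atTop 0] with k hk
  have hk' : (0 : ℝ) < k := by exact_mod_cast hk
  have hterm : ∀ m : Fin n → ℤ, f (toReal m) * max 0 (k - supGauge P (toReal m))
      = (k : ℝ) ^ (e + 1) * (f ((k : ℝ)⁻¹ • toReal m)
        * max 0 (1 - supGauge P ((k : ℝ)⁻¹ • toReal m))) := by
    intro m
    have h1 : f (toReal m) = (k : ℝ) ^ e * f ((k : ℝ)⁻¹ • toReal m) := by
      rw [← hhom, smul_smul, mul_inv_cancel₀ hk'.ne', one_smul]
    have h2 : max 0 ((k : ℝ) - supGauge P (toReal m))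
        = k * max 0 (1 - supGauge P ((k : ℝ)⁻¹ • toReal m)) := by
      rw [mul_max_of_nonneg _ _ hk'.le, supGauge_smul (inv_nonneg.2 hk'.le), mul_zero, mul_sub,
        mul_one, mul_inv_cancel_left₀ hk'.ne']
    rw [h1, h2]
    ring
  rw [hP.sum_latticeSum]
  simp_rw [hterm]
  rw [← mul_finsum]
  generalize (∑ᶠ m : Fin n → ℤ, f ((k : ℝ)⁻¹ • toReal m)
    * max 0 (1 - supGauge P ((k : ℝ)⁻¹ • toReal m))) = T
  generalize (∫ x, f x * max 0 (1 - supGauge P x)) = J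
  field_simp
  ring

end ToricFano

namespace ToricFano

open Filter Topology MeasureTheory

variable {n : ℕ} {P : Set (Fin n → ℝ)}

/-! ### Uniqueness of asymptotic expansions -/

theorem isLittleO_zpow_sub_one (p : ℤ) :
    (fun k : ℕ => (k : ℝ) ^ (p - 1)) =o[atTop] fun k : ℕ => (k : ℝ) ^ p := by
  refine (Asymptotics.isLittleO_iff_tendsto' ?_).2 ?_
  · filter_upwards [eventually_gt_atTop 0] with k hk h
    exact absurd h (zpow_ne_zero _ (by exact_mod_cast hk.ne'))
  · refine (tendsto_inv_atTop_nhds_zero_nat (𝕜 := ℝ)).congr' ?_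
    filter_upwards [eventually_gt_atTop 0] with k hk
    have hk' : (k : ℝ) ≠ 0 := by exact_mod_cast hk.ne'
    rw [zpow_sub_one₀ hk', mul_div_assoc, mul_comm, div_mul_cancel₀ _ (zpow_ne_zero _ hk')]

theorem eq_zero_of_mul_zpow_isBigO {c : ℝ} {p : ℤ}
    (h : (fun k : ℕ => c * (k : ℝ) ^ p) =O[atTop] fun k : ℕ => (k : ℝ) ^ (p - 1)) : c = 0 := by
  have h1 := (h.trans_isLittleO (isLittleO_zpow_sub_one p)).tendsto_div_nhds_zero
  refine tendsto_nhds_unique (tendsto_const_nhds.congr' ?_) h1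
  filter_upwards [eventually_gt_atTop 0] with k hk
  have hk' : (k : ℝ) ≠ 0 := by exact_mod_cast hk.ne'
  rw [mul_div_cancel_right₀ _ (zpow_ne_zero _ hk')]

theorem leadingCoeff_unique {f : ℕ → ℝ} {a b : ℝ} {p : ℤ}
    (ha : (fun k : ℕ => f k - a * (k : ℝ) ^ p) =O[atTop] fun k : ℕ => (k : ℝ) ^ (p - 1))
    (hb : (fun k : ℕ => f k - b * (k : ℝ) ^ p) =O[atTop] fun k : ℕ => (k : ℝ) ^ (p - 1)) :
    a = b := by
  refine sub_eq_zero.1 (eq_zero_of_mul_zpow_isBigO (p := p) ((hb.sub ha).congr_left fun k => ?_))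
  ring

theorem leadingCoeffs_unique {f : ℕ → ℝ} {a b a' b' : ℝ} {p : ℤ}
    (h : (fun k : ℕ => f k - (a * (k : ℝ) ^ p + b * (k : ℝ) ^ (p - 1)))
      =O[atTop] fun k : ℕ => (k : ℝ) ^ (p - 2))
    (h' : (fun k : ℕ => f k - (a' * (k : ℝ) ^ p + b' * (k : ℝ) ^ (p - 1)))
      =O[atTop] fun k : ℕ => (k : ℝ) ^ (p - 2)) : a = a' ∧ b = b' := by
  have h12 : p - 2 = p - 1 - 1 := by ring
  have key : ∀ {a b : ℝ}, ((fun k : ℕ => f k - (a * (k : ℝ) ^ p + b * (k : ℝ) ^ (p - 1)))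
      =O[atTop] fun k : ℕ => (k : ℝ) ^ (p - 2)) →
      (fun k : ℕ => f k - a * (k : ℝ) ^ p) =O[atTop] fun k : ℕ => (k : ℝ) ^ (p - 1) := by
    intro a b h
    rw [h12] at h
    refine ((h.trans (isLittleO_zpow_sub_one _).isBigO).add
      ((Asymptotics.isBigO_refl (fun k : ℕ => (k : ℝ) ^ (p - 1)) atTop).const_mul_left b)).congr_left
        fun k => ?_
    ring
  obtain rfl : a = a' := leadingCoeff_unique (key h) (key h')
  refine ⟨rfl, leadingCoeff_unique (f := fun k => f k - a * (k : ℝ) ^ p) (p := p - 1) ?_ ?_⟩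
  · rw [← h12]; exact h.congr_left fun k => by ring
  · rw [← h12]; exact h'.congr_left fun k => by ring

theorem IsWeight.unique {l : Fin n → ℝ} {I : Set (Fin n → ℝ) → Submodule ℂ (Laurent n)}
    {hI : IsInvariant l I} {k : ℤ} {w w' : ℝ} (h : IsWeight P hI k w) (h' : IsWeight P hI k w') :
    w = w' := by
  -- The weights are real, so τ = 1 already separates them.
  have h1 := (h.2 1).symm.trans (h'.2 1)
  rw [one_mul, one_mul, ← Complex.ofReal_exp, ← Complex.ofReal_exp] at h1
  exact Real.exp_injective (Complex.ofReal_injective h1)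

/-! ### Expansions of lattice point sums -/

theorem IsReflexive.latticeCount_expansion (hP : IsReflexive P) (hn : 1 ≤ n) :
    ((fun k : ℕ => latticeCount P k - (vol P * (k : ℝ) ^ (n : ℤ)
        + n / 2 * vol P * (k : ℝ) ^ ((n : ℤ) - 1)))
      =O[atTop] fun k : ℕ => (k : ℝ) ^ ((n : ℤ) - 2)) ∧
    (fun k : ℕ => latticeCount P k - latticeCount P ((k : ℤ) - 1)
        - n * vol P * (k : ℝ) ^ ((n : ℤ) - 1))
      =O[atTop] fun k : ℕ => (k : ℝ) ^ ((n : ℤ) - 2) := by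
  have hq : EventuallyPoly fun k : ℕ => latticeCount P k := by
    have := hP.eventuallyPoly_latticeSum 0 1
    simpa [latticeSum, latticeCount] using this
  obtain ⟨t, ht⟩ := hP.tendsto_sum_latticeSum (f := fun _ => (1 : ℝ)) (e := 0)
    (LipschitzWith.const (1 : ℝ)) (by simp)
  have hA := hP.tendsto_latticeSum (f := fun _ => (1 : ℝ)) (e := 0) continuous_const (by simp)
  have hV : ∫ _ in P, (1 : ℝ) = vol P := by simp [vol]
  rw [hV] at hA
  have h := hq.isBigO_expansion hn ht hA
  refine ⟨h.1, h.2.congr' ?_ EventuallyEq.rfl⟩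
  filter_upwards [eventually_ge_atTop 1] with k hk
  rw [Nat.cast_sub hk, Nat.cast_one]

theorem IsReflexive.latticeMoment_expansion (hP : IsReflexive P) (l : Fin n → ℝ) :
    ((fun k : ℕ => latticeMoment P l k - ((∫ x in P, x ⬝ᵥ l) * (k : ℝ) ^ ((n : ℤ) + 1)
        + (n + 1) / 2 * (∫ x in P, x ⬝ᵥ l) * (k : ℝ) ^ (n : ℤ)))
      =O[atTop] fun k : ℕ => (k : ℝ) ^ ((n : ℤ) - 1)) ∧
    (fun k : ℕ => latticeMoment P l k - latticeMoment P l ((k : ℤ) - 1)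
        - (n + 1) * (∫ x in P, x ⬝ᵥ l) * (k : ℝ) ^ (n : ℤ))
      =O[atTop] fun k : ℕ => (k : ℝ) ^ ((n : ℤ) - 1) := by
  have hq : EventuallyPoly fun k : ℕ => latticeMoment P l k := by
    have := hP.eventuallyPoly_latticeSum l 0
    simpa [latticeSum, latticeMoment] using this
  have hhom : ∀ (r : ℝ) (x : Fin n → ℝ), (r • x) ⬝ᵥ l = r ^ 1 * (x ⬝ᵥ l) := by
    intro r x
    rw [smul_dotProduct, pow_one, smul_eq_mul]
  have hlip : LipschitzWith (∑ i, ‖l i‖₊) fun x : Fin n → ℝ => x ⬝ᵥ l := by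
    refine LipschitzWith.of_dist_le_mul fun x y => ?_
    rw [Real.dist_eq, dist_eq_norm, ← sub_dotProduct, dotProduct_comm]
    simpa using abs_dotProduct_le l (x - y)
  obtain ⟨t, ht⟩ := hP.tendsto_sum_latticeSum hlip hhom
  have h := hq.isBigO_expansion (Nat.le_add_left 1 n) ht
    (hP.tendsto_latticeSum hlip.continuous hhom)
  push_cast at h
  have h1 : (n : ℤ) + 1 - 1 = n := by ring
  have h2 : (n : ℤ) + 1 - 2 = n - 1 := by ring
  rw [h1, h2] at h
  refine ⟨h.1, h.2.congr' ?_ EventuallyEq.rfl⟩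
  filter_upwards [eventually_ge_atTop 1] with k hk
  rw [Nat.cast_sub hk, Nat.cast_one]

theorem IsReflexive.latticeCount_pred_expansion (hP : IsReflexive P) (hn : 1 ≤ n) :
    (fun k : ℕ => latticeCount P ((k : ℤ) - 1) - vol P * (k : ℝ) ^ (n : ℤ))
      =O[atTop] fun k : ℕ => (k : ℝ) ^ ((n : ℤ) - 1) := by
  obtain ⟨h1, h2⟩ := hP.latticeCount_expansion hn
  have h12 : (n : ℤ) - 2 = n - 1 - 1 := by ring
  have h0 := (h1.sub h2).trans (h12 ▸ (isLittleO_zpow_sub_one ((n : ℤ) - 1)).isBigO)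
  refine (h0.add ((Asymptotics.isBigO_refl (fun k : ℕ => (k : ℝ) ^ ((n : ℤ) - 1)) atTop
    ).const_mul_left (-(n / 2 * vol P)))).congr_left fun k => ?_
  ring

theorem IsReflexive.vol_pos (hP : IsReflexive P) : 0 < vol P := by
  refine ENNReal.toReal_pos (Measure.measure_pos_of_nonempty_interior _ ⟨0, hP.zero_mem⟩).ne' ?_
  exact hP.lattice.isCompact.measure_lt_top.ne

theorem IsReflexive.integral_dotProduct (hP : IsReflexive P) (l : Fin n → ℝ) :
    ∫ x in P, x ⬝ᵥ l = (barycenter P ⬝ᵥ l) * vol P := by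
  have hint : IntegrableOn (fun x : Fin n → ℝ => x) P :=
    continuousOn_id.integrableOn_compact hP.lattice.isCompact
  have h1 : ∫ x in P, x ⬝ᵥ l = (∫ x in P, x) ⬝ᵥ l := by
    let φ : (Fin n → ℝ) →L[ℝ] ℝ :=
      LinearMap.toContinuousLinearMap ((dotProductBilin ℝ ℝ).flip l)
    exact φ.integral_comp_comm hint
  have h2 : barycenter P = (vol P)⁻¹ • ∫ x in P, x := setAverage_eq _ _ _
  rw [h1, h2, smul_dotProduct, smul_eq_mul, mul_right_comm, inv_mul_cancel₀ hP.vol_pos.ne', one_mul]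

/-! ### The log-Futaki invariant -/

section LogFutaki

variable {s : Laurent n} {l : Fin n → ℝ} {Γ : AddSubgroup ℝ}

/-- The expansions that define the log-Futaki invariant exist, and their coefficients are unique. -/
theorem IsReflexive.isLogFutaki_iff_coeffs (hP : IsReflexive P) (hn : 1 ≤ n)
    (hs : IsAnticanonicalSection P s)
    (hgen : ∀ p : Fin n → ℤ, toReal p ∈ P.extremePoints ℝ → s.coeff p ≠ 0)
    (hΓ : ∀ i, l i ∈ Γ) (β F : ℝ) {A : ℝ} (hA : ∫ x in P, x ⬝ᵥ l = A) :
    IsLogFutaki P Γ l s β F ↔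
      F = 2 * (-((n + 1) / 2 * A) * vol P - -A * (n / 2 * vol P)) / vol P
        + (1 - β) * (-(supportValue P l * vol P - (n + 1) * A) + n * vol P / vol P * -A) := by
  obtain ⟨hS, hS'⟩ := hP.latticeMoment_expansion l
  obtain ⟨hL, hL'⟩ := hP.latticeCount_expansion hn
  have hLpred := hP.latticeCount_pred_expansion hn
  rw [hA] at hS hS'
  have hw : (fun k : ℕ => -latticeMoment P l k
      - (-A * (k : ℝ) ^ ((n : ℤ) + 1) + -((n + 1) / 2 * A) * (k : ℝ) ^ (n : ℤ)))
      =O[atTop] fun k : ℕ => (k : ℝ) ^ ((n : ℤ) - 1) :=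
    hS.neg_left.congr_left fun k => by ring
  -- W d_{k-1} contributes W V and w_k - w_{k-1} contributes -(n+1)A at order k^n.
  have hw' : (fun k : ℕ => -latticeMoment P l k + latticeMoment P l ((k : ℤ) - 1)
        + supportValue P l * latticeCount P ((k : ℤ) - 1)
      - (supportValue P l * vol P - (n + 1) * A) * (k : ℝ) ^ (n : ℤ))
      =O[atTop] fun k : ℕ => (k : ℝ) ^ ((n : ℤ) - 1) :=
    ((hLpred.const_mul_left (supportValue P l)).sub hS').congr_left fun k => by ring
  have hd : ∀ k : ℕ, (Module.finrank ℂ (H0 P (zeroIdeal n) k) : ℝ) = latticeCount P k :=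
    fun k => hP.finrank_H0_zeroIdeal hn k
  have hd' : ∀ᶠ k : ℕ in atTop, (Module.finrank ℂ (H0 P (centralIdeal Γ l s) k) : ℝ)
      = latticeCount P k - latticeCount P ((k : ℤ) - 1) := by
    filter_upwards [eventually_ge_atTop 1] with k hk
    exact (hP.isWeight_centralIdeal hn hs hgen hΓ (by exact_mod_cast hk)).2
  have hW : ∀ k : ℕ, IsWeight P (zeroIdeal_invariant l) k (-latticeMoment P l k) :=
    fun k => hP.isWeight_zeroIdeal hn l k
  have hW' : ∀ᶠ k : ℕ in atTop, IsWeight P (centralIdeal_invariant Γ l s) k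
      (-latticeMoment P l k + latticeMoment P l ((k : ℤ) - 1)
        + supportValue P l * latticeCount P ((k : ℤ) - 1)) := by
    filter_upwards [eventually_ge_atTop 1] with k hk
    exact (hP.isWeight_centralIdeal hn hs hgen hΓ (by exact_mod_cast hk)).1
  have hp : ∀ k : ℕ, (k : ℝ) ^ (n + 1) = (k : ℝ) ^ ((n : ℤ) + 1) := fun k => by
    rw [← zpow_natCast]; norm_cast
  have hp' : ∀ k : ℕ, (k : ℝ) ^ n = (k : ℝ) ^ (n : ℤ) := fun k => (zpow_natCast _ _).symm
  simp only [IsLogFutaki, hp, hp', hd]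
  constructor
  · rintro ⟨w, w', a₀, a₁, b₀, b₁, a'₀, b'₀, h1, h2, h3, h4, h5, h6, rfl⟩
    have e1 : ∀ᶠ k : ℕ in atTop, w k = -latticeMoment P l k := by
      filter_upwards [h1] with k hk using hk.unique (hW k)
    have e2 : ∀ᶠ k : ℕ in atTop, w' k = -latticeMoment P l k + latticeMoment P l ((k : ℤ) - 1)
        + supportValue P l * latticeCount P ((k : ℤ) - 1) := by
      filter_upwards [h2, hW'] with k hk hk' using hk.unique hk'
    have hn1 : (n : ℤ) + 1 - 1 = n := by ring
    have hn2 : (n : ℤ) + 1 - 2 = n - 1 := by ring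
    have hn3 : (n : ℤ) - 1 - 1 = n - 2 := by ring
    obtain ⟨rfl, rfl⟩ := leadingCoeffs_unique (p := (n : ℤ) + 1)
      (f := fun k : ℕ => -latticeMoment P l k)
      (by
        rw [hn1, hn2]
        refine h3.congr' ?_ EventuallyEq.rfl
        filter_upwards [e1] with k hk
        rw [hk])
      (by rw [hn1, hn2]; exact hw)
    obtain ⟨rfl, rfl⟩ := leadingCoeffs_unique h4 hL
    obtain rfl := leadingCoeff_unique
      (by
        refine h5.congr' ?_ EventuallyEq.rfl
        filter_upwards [e2] with k hk
        rw [hk])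
      hw'
    obtain rfl := leadingCoeff_unique (p := (n : ℤ) - 1)
      (f := fun k : ℕ => latticeCount P k - latticeCount P ((k : ℤ) - 1))
      (by
        rw [hn3]
        refine h6.congr' ?_ EventuallyEq.rfl
        filter_upwards [hd'] with k hk
        rw [hk])
      (by rw [hn3]; exact hL')
    rfl
  · rintro rfl
    refine ⟨_, _, _, _, _, _, _, _, Eventually.of_forall hW, hW', hw, hL, hw',
      hL'.congr' ?_ EventuallyEq.rfl, rfl⟩
    filter_upwards [hd'] with k hk
    rw [hk]

end LogFutaki

end ToricFano

theorem mainTheorem2 {n : ℕ} (hn : 1 ≤ n) (P : Set (Fin n → ℝ)) (hP : ToricFano.IsReflexive P)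
    (s : ToricFano.Laurent n) (hs : ToricFano.IsAnticanonicalSection P s)
    (hgen : ∀ p : Fin n → ℤ, ToricFano.toReal p ∈ P.extremePoints ℝ → s.coeff p ≠ 0)
    (l : Fin n → ℝ) (Γ : AddSubgroup ℝ) (hΓ : ∀ i, l i ∈ Γ) (β : ℝ) (F : ℝ) :
    ToricFano.IsLogFutaki P Γ l s β F ↔
      F = -(β * (ToricFano.barycenter P ⬝ᵥ l) + (1 - β) * ToricFano.supportValue P l)
        * ToricFano.vol P := by
  rw [hP.isLogFutaki_iff_coeffs hn hs hgen hΓ β F (hP.integral_dotProduct l)]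
  have hV := hP.vol_pos.ne'
  -- With A = ⟨P_c, l⟩ V the two terms are -A and (1-β)(A - W V).
  refine Eq.congr_right ?_
  field_simp
  ring
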